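/- Let $p,q\in\mathbb C$ with $|p|<1$, $q\neq 0$, and let $n,N\ge 0$ be integers (empty products are $1$). For $u\in\mathbb C\setminus\{0\}$ and $k\in\mathbb Z_{\ge 0}$ put $$\theta(u)=\prod_{j=0}^\infty(1-p^ju)(1-p^{j+1}/u),\qquad (u)_k=\prod_{m=0}^{k-1}\theta(q^mu),\qquad (u_1,\dots,u_m)_k=(u_1)_k\cdots(u_m)_k .$$ For $z=(z_1,\dots,z_n)$ and $x=(x_1,\dots,x_n)\in\mathbb Z_{\ge0}^n$ write $Z=z_1\cdots z_n$, $|x|=x_1+\dots+x_n$ and $$\frac{\Delta(zq^x)}{\Delta(z)}=\prod_{1\le i<j\le n}\frac{q^{x_i}\theta(q^{x_j-x_i}z_j/z_i)}{\theta(z_j/z_i)} .$$ Let $a,b,c,d,e,f,g,z_1,\dots,z_n$ be non-zero complex numbers with $a^3q^{N+2}=bcdefg\,z_1^2\cdots z_n^2$, and let $\lambda=a^2q/(bde)$. Assume that no denominator in the following identity vanishes (for each factor with index $|x|$ or $x_i$ this means that it is non-zero at index $N$). Then $$\begin{aligned} &\sum_{\substack{x_1,\dots,x_n\ge0\\ x_1+\dots+x_n\le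 N}}\frac{\Delta(zq^x)}{\Delta(z)}\frac{\theta(aq^{2|x|})}{\theta(a)}\frac{\prod_{1\le i<j\le n}(z_iz_j)_{x_i+x_j}}{\prod_{i=1}^n(b/z_i)_{|x|-x_i}}\frac{(a,q^{-N},c,d)_{|x|}\prod_{i=1}^n(b/z_i)_{|x|}}{(aq^{N+1},aq/c,aq/d)_{|x|}}\,q^{|x|}\\ &\qquad\times\prod_{i=1}^n\frac{(ez_i,fz_i,gz_i,aqz_i/(efgZ^2))_{x_i}}{(aqz_i/b)_{x_i}\prod_{j=1}^n(qz_i/z_j)_{x_i}}\;A_x\\ &=\frac{(aq,\lambda q/c)_N}{(\lambda q,aq/c)_N}\sum_{\substack{x_1,\dots,x_n\ge0\\ x_1+\dots+x_n\le N}}\frac{\Delta(zq^x)}{\Delta(z)}\frac{\theta(\lambda q^{2|x|})}{\theta(\lambda)}\frac{\prod_{1\le i<j\le n}(z_iz_j)_{x_i+x_j}}{\prod_{i=1}^n(\lambda b/(az_i))_{|x|-x_i}}\\ &\qquad\times\frac{(\lambda,q^{-N},c,\lambda d/a)_{|x|}\prod_{i=1}^n(\lambda b/(az_i))_{|x|}}{(\lambda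 q^{N+1},\lambda q/c,aq/d)_{|x|}}\,q^{|x|}\prod_{i=1}^n\frac{(\lambda ez_i/a,fz_i,gz_i,aqz_i/(efgZ^2))_{x_i}}{(aqz_i/b)_{x_i}\prod_{j=1}^n(qz_i/z_j)_{x_i}}\;B_x , \end{aligned}$$ where, for $n$ odd, $$A_x=\frac1{(aq/(eZ),aq/(fZ),aq/(gZ),aq/(efgZ))_{|x|}},$$ $$B_x=\frac{(aq/(cfZ),\lambda q/(fZ))_N}{(aq/(fZ),\lambda q/(cfZ))_N\,(aq/(eZ),\lambda q/(fZ),\lambda q/(gZ),aq/(efgZ))_{|x|}},$$ and, for $n$ even, $$A_x=\frac1{(aq/Z,aq/(efZ),aq/(egZ),aq/(fgZ))_{|x|}},$$ $$B_x=\frac{(aq/(cZ),\lambda q/Z)_N}{(aq/Z,\lambda q/(cZ))_N\,(\lambda q/Z,aq/(efZ),aq/(egZ),\lambda q/(fgZ))_{|x|}}.$$ -/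

import Mathlib

noncomputable section

/-- The theta function `θ(z) = ∏_{j ≥ 0} (1 - p^j z)(1 - p^(j+1) / z)` of nome `p`.
For `‖p‖ < 1` and `z ≠ 0` the product converges absolutely, and `p = 0` gives `1 - z`. -/
def ellTheta (p z : ℂ) : ℂ :=
  ∏' j : ℕ, (1 - p ^ j * z) * (1 - p ^ (j + 1) / z)

/-- The elliptic shifted factorial `(z)_k = θ(z) θ(qz) ⋯ θ(q^(k-1) z)`, for `k ≥ 0`. -/
def ellPoch (p q z : ℂ) (k : ℕ) : ℂ :=
  ∏ m ∈ Finset.range k, ellTheta p (q ^ m * z)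

/-- The product notation `(u_1, …, u_m)_k = (u_1)_k ⋯ (u_m)_k`. -/
def ellPochs (p q : ℂ) (us : List ℂ) (k : ℕ) : ℂ :=
  (us.map fun u => ellPoch p q u k).prod

/-- `|x| = x_1 + ⋯ + x_n`. -/
def wt {n : ℕ} (x : Fin n → ℕ) : ℕ := ∑ i, x i

/-- The finite set of all `x ∈ ℕ^n` with `x_1 + ⋯ + x_n ≤ N`. -/
def indexSet (n N : ℕ) : Finset (Fin n → ℕ) :=
  (Fintype.piFinset fun _ : Fin n => Finset.range (N + 1)).filter fun x => wt x ≤ N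

theorem mem_indexSet {n N : ℕ} {x : Fin n → ℕ} : x ∈ indexSet n N ↔ wt x ≤ N := by
  simp only [indexSet, Finset.mem_filter, Fintype.mem_piFinset, Finset.mem_range,
    and_iff_right_iff_imp]
  intro h i
  have : x i ≤ wt x := Finset.single_le_sum (fun _ _ => Nat.zero_le _) (Finset.mem_univ i)
  omega

/-- The `A`-type factor
`Δ(z q^x) / Δ(z) = ∏_{i < j} q^(x_i) θ(q^(x_j - x_i) z_j / z_i) / θ(z_j / z_i)`. -/
def deltaRatio (p q : ℂ) {n : ℕ} (z : Fin n → ℂ) (x : Fin n → ℕ) : ℂ :=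
  ∏ i, ∏ j ∈ Finset.Ioi i,
    q ^ x i * ellTheta p (q ^ ((x j : ℤ) - (x i : ℤ)) * z j / z i) / ellTheta p (z j / z i)

end

/-! The multiple sums are cut into slices `|x| = k`. Reversing `(b/z_i)_{k-x_i}` against `(b/z_i)_k`
turns their quotient into `(q^(1-k) z_i/b)_{x_i}` times elementary powers. A slice of the left side
is then a weight depending only on `k` times a sum `S_k(X, Y)` (`dSum`), symmetric in `X` and `Y`,
at `X = e`, `Y = q^(1-k)/b`. The right side has the same `S_k`, with the same `f`, `g`, `h =
aq/(efgZ²)` and `η = aq/b`, at `X = λe/a`, `Y = q^(1-k) a/(λb)`.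

The two are linked by the expansion `dSum_connection`: if `XYσλq^k = η`, then `(ησ)_k S_k(X, Y)` is
a combination over `j ≤ k` of `(η/X, η/Y)_j (σX, σY)_{k-j}`, with coefficients that contain
`S_j(η/(λq^j), 1/σ)`. For `σ = a/(λe)` these are the sums on the right side. After interchanging
summations, the inner sum is the elliptic Jackson (Frenkel–Turaev) sum. That sum is in turn the
expansion for `n = 1`, `z_1 = 1`, since there `S_j` is a single product.

The expansion is proved by induction on `k`. On the curve where `XY` is fixed, both sides are binary
forms of degree `k` in two functions, so agreement at `k + 1` separated points is enough. Both sides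
satisfy the same contiguous relation between levels `k` and `k + 1` (`dSum_relation`,
`connSum_relation`). It carries agreement along a geometric progression, starting from a point where
the expansion has only one surviving term. For the expansion the relation is the three-term theta
relation, term by term. For `S_k` it comes from evaluating a double sum in two ways, by partial
fractions of type `D` on level `k` and of type `A` on level `k + 1`.

All the addition formulas follow from writing `θ(xy) θ(x/y)` as a `2 × 2` determinant
(`exists_ellTheta_det`), a consequence of the Jacobi triple product. Auxiliary genericity conditions
are removed by deforming parameters with some `s` near `1`: zeros of `θ` are countable and both
sides are continuous. The parity of `n` enters only through the value of the type `D` sum. In both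
cases this is a product of four theta functions, recorded by parameters `U`, `V`, `s₁`, `s₂`, so one
argument serves both. -/

noncomputable section

open Filter Topology

/-! ### Theta function: factorization, inversion, continuity, zeros -/

/-- The one-sided product `∏_{j ≥ 0} (1 - p^j u)`. -/
def qPochInf (p u : ℂ) : ℂ := ∏' j : ℕ, (1 + -(p ^ j * u))

theorem summable_norm_qPochInf {p : ℂ} (hp : ‖p‖ < 1) (u : ℂ) :
    Summable fun j : ℕ => ‖-(p ^ j * u)‖ := by
  simp only [norm_neg, norm_mul, norm_pow]
  exact (summable_geometric_of_lt_one (norm_nonneg _) hp).mul_right _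

theorem multipliable_qPochInf {p : ℂ} (hp : ‖p‖ < 1) (u : ℂ) :
    Multipliable fun j : ℕ => (1 + -(p ^ j * u)) :=
  multipliable_one_add_of_summable (summable_norm_qPochInf hp u)

theorem qPochInf_ne_zero {p u : ℂ} (hp : ‖p‖ < 1) (h : ∀ j : ℕ, 1 - p ^ j * u ≠ 0) :
    qPochInf p u ≠ 0 :=
  tprod_one_add_ne_zero_of_summable (fun j => by simpa [sub_eq_add_neg] using h j)
    (summable_norm_qPochInf hp u)

theorem qPochInf_eq {p : ℂ} (hp : ‖p‖ < 1) (u : ℂ) :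
    qPochInf p u = (1 - u) * qPochInf p (p * u) := by
  have hm : Multipliable fun j : ℕ => (1 + -(p ^ (j + 1) * u)) :=
    (multipliable_qPochInf hp (p * u)).congr fun j => by ring
  have h := tprod_eq_zero_mul' (f := fun j : ℕ => 1 + -(p ^ j * u)) hm
  have h2 : ∏' j : ℕ, (1 + -(p ^ (j + 1) * u)) = qPochInf p (p * u) :=
    tprod_congr fun j => by ring
  simp only [pow_zero, one_mul, ← sub_eq_add_neg] at h h2
  rw [← h2, ← h]
  simp only [qPochInf, sub_eq_add_neg]

theorem continuous_qPochInf {p : ℂ} (hp : ‖p‖ < 1) : Continuous (qPochInf p) := by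
  rw [continuous_iff_continuousAt]
  intro u₀
  have hK : IsOpen (Metric.ball (0 : ℂ) (‖u₀‖ + 1)) := Metric.isOpen_ball
  have h := Summable.hasProdLocallyUniformlyOn_nat_one_add (R := ℂ)
    (f := fun (j : ℕ) (u : ℂ) => -(p ^ j * u)) hK (u := fun j => ‖p‖ ^ j * (‖u₀‖ + 1))
    ((summable_geometric_of_lt_one (norm_nonneg _) hp).mul_right _)
    (Eventually.of_forall fun j u hu => by
      rw [norm_neg, norm_mul, norm_pow]
      have : ‖u‖ < ‖u₀‖ + 1 := by simpa using hu
      gcongr)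
    (fun j => by fun_prop)
  have hc : ContinuousOn (qPochInf p) (Metric.ball (0 : ℂ) (‖u₀‖ + 1)) :=
    TendstoLocallyUniformlyOn.continuousOn h
      (Eventually.of_forall fun s => by fun_prop).frequently
  exact hc.continuousAt (hK.mem_nhds (by simp))

theorem ellTheta_eq_mul {p : ℂ} (hp : ‖p‖ < 1) (u : ℂ) :
    ellTheta p u = qPochInf p u * qPochInf p (p / u) := by
  unfold qPochInf
  rw [← (multipliable_qPochInf hp u).tprod_mul (multipliable_qPochInf hp (p / u))]
  exact tprod_congr fun j => by ring

theorem ellTheta_one {p : ℂ} (hp : ‖p‖ < 1) : ellTheta p 1 = 0 := by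
  rw [ellTheta_eq_mul hp, qPochInf_eq hp]; simp

theorem ellTheta_inv {p : ℂ} (hp : ‖p‖ < 1) {u : ℂ} (hu : u ≠ 0) :
    ellTheta p u⁻¹ = -(u⁻¹ * ellTheta p u) := by
  rw [ellTheta_eq_mul hp, ellTheta_eq_mul hp, qPochInf_eq hp u⁻¹, qPochInf_eq hp u, div_inv_eq_mul,
    ← div_eq_mul_inv]
  field_simp
  ring

theorem continuousAt_ellTheta {p : ℂ} (hp : ‖p‖ < 1) {u : ℂ} (hu : u ≠ 0) :
    ContinuousAt (ellTheta p) u := by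
  have : ellTheta p = fun u => qPochInf p u * qPochInf p (p / u) := funext (ellTheta_eq_mul hp)
  rw [this]
  have hc := continuous_qPochInf hp
  exact hc.continuousAt.mul
    (ContinuousAt.comp (g := qPochInf p) hc.continuousAt (continuousAt_const.div continuousAt_id hu))

/-- Away from the points `p^(-j)` and `p^(j+1)` no factor vanishes, and an absolutely convergent
product of non-zero factors is non-zero. Countability, rather than discreteness, is all that the
deformation arguments below use. -/
theorem countable_ellTheta_zeros {p : ℂ} (hp : ‖p‖ < 1) :
    {u : ℂ | u ≠ 0 ∧ ellTheta p u = 0}.Countable := by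
  refine ((Set.countable_range fun j : ℕ => (p ^ j)⁻¹).union
    (Set.countable_range fun j : ℕ => p ^ (j + 1))).mono ?_
  rintro u ⟨hu, h⟩
  by_contra hn
  simp only [Set.mem_union, Set.mem_range, not_or, not_exists] at hn
  rw [ellTheta_eq_mul hp] at h
  refine mul_ne_zero (qPochInf_ne_zero hp fun j hj => hn.1 j ?_)
    (qPochInf_ne_zero hp fun j hj => hn.2 j ?_) h
  · exact inv_eq_of_mul_eq_one_right (sub_eq_zero.1 hj).symm
  · field_simp at hj
    rw [pow_succ]
    linear_combination -hj

/-- A function that is continuous at `1` and vanishes off a countable set vanishes at `1`. -/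
theorem eq_zero_of_countable {E : ℂ → ℂ} (hE : ContinuousAt E 1) {S : Set ℂ} (hS : S.Countable)
    (h : ∀ s, s ≠ 0 → s ∉ S → E s = 0) : E 1 = 0 := by
  have hd : Dense (S ∪ {0})ᶜ := (hS.union (Set.countable_singleton 0)).dense_compl ℂ
  by_contra hne
  have hev : ∀ᶠ s in 𝓝 (1 : ℂ), E s ≠ 0 := hE.eventually_ne hne
  obtain ⟨s, hs, hs'⟩ := hd.inter_nhds_nonempty hev
  simp only [Set.mem_compl_iff, Set.mem_union, Set.mem_singleton_iff, not_or] at hs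
  exact hs' (h s hs.2 hs.1)

theorem countable_ellTheta_const_mul {p : ℂ} (hp : ‖p‖ < 1) {c : ℂ} (hc : c ≠ 0) :
    {s : ℂ | s ≠ 0 ∧ ellTheta p (c * s) = 0}.Countable := by
  refine ((countable_ellTheta_zeros hp).preimage (mul_right_injective₀ hc)).mono ?_
  rintro s ⟨hs, h⟩
  exact ⟨mul_ne_zero hc hs, h⟩

/-! ### Gaussian binomials and the Jacobi triple product -/

section TripleProduct

/-- `(p; p)_m`. -/
def qFact (p : ℂ) (m : ℕ) : ℂ := ∏ i ∈ Finset.range m, (1 - p ^ (i + 1))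

theorem one_sub_pow_ne_zero {p : ℂ} (hp : ‖p‖ < 1) (i : ℕ) : 1 - p ^ (i + 1) ≠ 0 := by
  intro h
  have : ‖p ^ (i + 1)‖ = 1 := by rw [← sub_eq_zero.1 h]; simp
  rw [norm_pow] at this
  exact (pow_lt_one₀ (norm_nonneg _) hp (Nat.succ_ne_zero i)).ne this

theorem qFact_ne_zero {p : ℂ} (hp : ‖p‖ < 1) (m : ℕ) : qFact p m ≠ 0 :=
  Finset.prod_ne_zero_iff.2 fun i _ => one_sub_pow_ne_zero hp i

theorem tendsto_qFact {p : ℂ} (hp : ‖p‖ < 1) :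
    Tendsto (qFact p) atTop (𝓝 (qPochInf p p)) := by
  have := (multipliable_qPochInf hp p).tendsto_prod_tprod_nat
  refine this.congr fun m => Finset.prod_congr rfl fun i _ => by ring

theorem qPochInf_self_ne_zero {p : ℂ} (hp : ‖p‖ < 1) : qPochInf p p ≠ 0 :=
  qPochInf_ne_zero hp fun j => by simpa [pow_succ] using one_sub_pow_ne_zero hp j

/-- The Gaussian binomial coefficient. -/
def gaussBinom (p : ℂ) : ℕ → ℕ → ℂ
  | _, 0 => 1
  | 0, _ + 1 => 0
  | m + 1, k + 1 => gaussBinom p m k + p ^ (k + 1) * gaussBinom p m (k + 1)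

theorem gaussBinom_eq_zero (p : ℂ) : ∀ {m k : ℕ}, m < k → gaussBinom p m k = 0
  | 0, k + 1, _ => by simp [gaussBinom]
  | m + 1, k + 1, h => by
      rw [gaussBinom, gaussBinom_eq_zero p (by omega : m < k),
        gaussBinom_eq_zero p (by omega : m < k + 1)]
      ring

/-- Pascal's rule with factorials cleared. In the last case the two induction hypotheses carry the
weights `1 - p^(k+1)` and `p^(k+1) (1 - p^(l+1))`, which add up to `1 - p^(k+l+2)`. -/
theorem gaussBinom_mul (p : ℂ) : ∀ (k l : ℕ),
    gaussBinom p (k + l) k * (qFact p k * qFact p l) = qFact p (k + l)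
  | 0, l => by cases l <;> simp [gaussBinom, qFact]
  | k + 1, 0 => by
      have h := gaussBinom_mul p k 0
      rw [show k + 1 + 0 = k + 1 by ring, gaussBinom, gaussBinom_eq_zero p (Nat.lt_succ_self k)]
      simp only [qFact, add_zero, Finset.prod_range_succ, Finset.range_zero, Finset.prod_empty]
        at h ⊢
      linear_combination (1 - p ^ (k + 1)) * h
  | k + 1, l + 1 => by
      have h1 := gaussBinom_mul p k (l + 1)
      have h2 := gaussBinom_mul p (k + 1) l
      rw [show k + 1 + (l + 1) = (k + l + 1) + 1 by ring, gaussBinom]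
      rw [show k + (l + 1) = k + l + 1 by ring] at h1
      rw [show k + 1 + l = k + l + 1 by ring] at h2
      have e : ∀ m, qFact p (m + 1) = qFact p m * (1 - p ^ (m + 1)) := fun m => by
        simp [qFact, Finset.prod_range_succ]
      rw [e (k + l + 1), e k, e l]
      rw [e l] at h1
      rw [e k] at h2
      linear_combination (1 - p ^ (k + 1)) * h1 + p ^ (k + 1) * (1 - p ^ (l + 1)) * h2

/-- The `q`-binomial theorem. Splitting off the factor `j = 0` leaves the shorter product at `p x`,
and Pascal's rule matches the coefficients. -/
theorem prod_one_sub_eq_sum (p : ℂ) (m : ℕ) : ∀ x : ℂ,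
    ∏ j ∈ Finset.range m, (1 - p ^ j * x)
      = ∑ k ∈ Finset.range (m + 1), (-1) ^ k * p ^ (k.choose 2) * gaussBinom p m k * x ^ k := by
  induction m with
  | zero => intro x; simp [gaussBinom]
  | succ m ih =>
    intro x
    rw [Finset.prod_range_succ', Finset.sum_range_succ']
    have : ∏ j ∈ Finset.range m, (1 - p ^ (j + 1) * x)
        = ∏ j ∈ Finset.range m, (1 - p ^ j * (p * x)) :=
      Finset.prod_congr rfl fun j _ => by ring
    rw [this, ih (p * x)]
    have hs : ∀ k, (-1) ^ (k + 1) * p ^ ((k + 1).choose 2) * gaussBinom p (m + 1) (k + 1)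
          * x ^ (k + 1)
        = ((-1) ^ (k + 1) * p ^ ((k + 1).choose 2) * gaussBinom p m (k + 1) * (p * x) ^ (k + 1))
          - x * ((-1) ^ k * p ^ (k.choose 2) * gaussBinom p m k * (p * x) ^ k) := by
      intro k
      rw [gaussBinom, Nat.choose_succ_succ' k 1, Nat.choose_one_right]
      ring
    simp only [hs]
    rw [Finset.sum_sub_distrib, ← Finset.mul_sum]
    have h2 := Finset.sum_range_succ' (fun k => (-1) ^ k * p ^ (k.choose 2) * gaussBinom p m k
      * (p * x) ^ k) (m + 1)
    rw [Finset.sum_range_succ, gaussBinom_eq_zero p (Nat.lt_succ_self m)] at h2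
    have h0 : gaussBinom p m 0 = 1 := by cases m <;> rfl
    have h0' : gaussBinom p (m + 1) 0 = 1 := rfl
    simp only [h0, h0', pow_zero, Nat.choose_zero_succ, mul_one, mul_zero, zero_mul, add_zero]
      at h2 ⊢
    linear_combination h2

/-- `(-1)^n p^(n(n-1)/2) u^n`. -/
def thetaTerm (p u : ℂ) (n : ℤ) : ℂ := (-1) ^ n * p ^ (n * (n - 1) / 2) * u ^ n

theorem even_tri (n : ℤ) : 2 * (n * (n - 1) / 2) = n * (n - 1) :=
  Int.mul_ediv_cancel' (by
    have := Int.even_mul_succ_self (n - 1)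
    rw [show n - 1 + 1 = n by ring, mul_comm] at this
    exact this.two_dvd)

theorem thetaTerm_succ {p u : ℂ} (hp0 : p ≠ 0) (hu : u ≠ 0) (n : ℤ) :
    thetaTerm p u (n + 1) = -(p ^ n * u) * thetaTerm p u n := by
  unfold thetaTerm
  have : (n + 1) * (n + 1 - 1) / 2 = n * (n - 1) / 2 + n := by
    have := even_tri n; have := even_tri (n + 1)
    linarith
  rw [this, zpow_add₀ hp0, zpow_add₀ hu, zpow_add₀ (by norm_num : (-1 : ℂ) ≠ 0)]
  simp only [zpow_one]
  ring

theorem thetaTerm_ne_zero {p u : ℂ} (hp0 : p ≠ 0) (hu : u ≠ 0) (n : ℤ) : thetaTerm p u n ≠ 0 :=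
  mul_ne_zero (mul_ne_zero (zpow_ne_zero _ (by norm_num)) (zpow_ne_zero _ hp0)) (zpow_ne_zero _ hu)

theorem summable_thetaTerm {p u : ℂ} (hp : ‖p‖ < 1) (hp0 : p ≠ 0) (hu : u ≠ 0) :
    Summable fun n : ℤ => ‖thetaTerm p u n‖ := by
  have hlim : ∀ v : ℂ, Tendsto (fun n : ℕ => ‖p‖ ^ n * ‖v‖) atTop (𝓝 0) := fun v => by
    simpa using (tendsto_pow_atTop_nhds_zero_of_lt_one (norm_nonneg p) hp).mul_const ‖v‖
  refine Summable.of_nat_of_neg ?_ ?_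
  · refine summable_of_ratio_test_tendsto_lt_one (l := 0) one_pos
      (Eventually.of_forall fun n => norm_ne_zero_iff.2 (thetaTerm_ne_zero hp0 hu _)) ?_
    refine (hlim u).congr fun n => ?_
    have := thetaTerm_ne_zero hp0 hu n
    push_cast
    rw [thetaTerm_succ hp0 hu, norm_norm, norm_norm, norm_mul,
      mul_div_cancel_right₀ _ (norm_ne_zero_iff.2 this), norm_neg, norm_mul]
    simp
  · refine summable_of_ratio_test_tendsto_lt_one (l := 0) one_pos
      (Eventually.of_forall fun n => norm_ne_zero_iff.2 (thetaTerm_ne_zero hp0 hu _)) ?_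
    refine (hlim (p / u)).congr fun n => ?_
    have := thetaTerm_ne_zero hp0 hu (-((n : ℤ) + 1))
    have h := thetaTerm_succ hp0 hu (-((n : ℤ) + 1))
    rw [show -((n : ℤ) + 1) + 1 = -n by ring] at h
    push_cast
    rw [norm_norm, norm_norm, h, norm_mul, ← div_div, div_right_comm,
      div_self (norm_ne_zero_iff.2 this), norm_neg, norm_mul, norm_div, zpow_neg, norm_inv,
      one_div, mul_inv, inv_inv, norm_zpow]
    norm_cast
    rw [pow_succ]
    field_simp

/-- This is the `q`-binomial theorem with `2N` factors at `u / p^N`. The upper half of the product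
is already `∏ (1 - p^j u)`. In the lower half each factor is flipped by pulling out `-(u /
p^(j+1))`, and the monomials collected are the inverse of the theta term of index `-N`. -/
theorem finite_triple_product {p u : ℂ} (hp0 : p ≠ 0) (hu : u ≠ 0) (N : ℕ) :
    ∏ j ∈ Finset.range N, ((1 - p ^ j * u) * (1 - p ^ (j + 1) / u))
      = ∑ n ∈ Finset.Icc (-N : ℤ) N, thetaTerm p u n * gaussBinom p (2 * N) (N + n).toNat := by
  have h := prod_one_sub_eq_sum p (N + N) (u / p ^ N)
  rw [Finset.prod_range_add] at h
  have h1 : ∏ j ∈ Finset.range N, (1 - p ^ (N + j) * (u / p ^ N))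
      = ∏ j ∈ Finset.range N, (1 - p ^ j * u) :=
    Finset.prod_congr rfl fun j _ => by rw [pow_add]; field_simp
  have h2 : ∏ j ∈ Finset.range N, (1 - p ^ j * (u / p ^ N))
      = (thetaTerm p u (-N))⁻¹ *
         ∏ j ∈ Finset.range N, (1 - p ^ (j + 1) / u) := by
    rw [← Finset.prod_range_reflect]
    have : ∀ M : ℕ, ∏ j ∈ Finset.range M, (-(u / p ^ (j + 1))) = (thetaTerm p u (-M))⁻¹ := by
      intro M
      induction M with
      | zero => simp [thetaTerm]
      | succ M ih =>
        have h := thetaTerm_succ hp0 hu (-((M : ℤ) + 1))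
        rw [show -((M : ℤ) + 1) + 1 = -M by ring] at h
        rw [Finset.prod_range_succ, ih, h]
        have := thetaTerm_ne_zero hp0 hu (-((M : ℤ) + 1))
        push_cast
        rw [zpow_neg]
        norm_cast
        field_simp
    rw [← this N, ← Finset.prod_mul_distrib]
    refine Finset.prod_congr rfl fun j hj => ?_
    have hj := Finset.mem_range.1 hj
    have : p ^ N = p ^ (N - 1 - j) * p ^ (j + 1) := by
      rw [← pow_add]; congr 1; omega
    rw [this]
    field_simp
    ring
  rw [h1, h2] at h
  have hne := thetaTerm_ne_zero hp0 hu (-(N : ℤ))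
  have h3 : ∏ j ∈ Finset.range N, ((1 - p ^ j * u) * (1 - p ^ (j + 1) / u))
      = thetaTerm p u (-N) * ∑ k ∈ Finset.range (N + N + 1),
          (-1) ^ k * p ^ (k.choose 2) * gaussBinom p (N + N) k * (u / p ^ N) ^ k := by
    rw [← h, Finset.prod_mul_distrib]
    rw [← mul_assoc, ← mul_assoc, mul_inv_cancel₀ hne]
    ring
  rw [h3, Finset.mul_sum]
  refine Finset.sum_nbij' (fun k => (k : ℤ) - N) (fun n => (N + n).toNat) ?_ ?_ ?_ ?_ ?_
  · intro k hk; simp at hk ⊢; omega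
  · intro k hk; simp at hk ⊢; omega
  · intro k hk; simp
  · intro k hk; simp at hk ⊢; omega
  · intro k hk
    have e : ((N : ℤ) + ((k : ℤ) - N)).toNat = k := by simp
    rw [e, ← two_mul]
    have key : ∀ k : ℕ, thetaTerm p u (-N) * ((-1) ^ k * p ^ (k.choose 2) * (u / p ^ N) ^ k)
        = thetaTerm p u ((k : ℤ) - N) := by
      intro k
      induction k with
      | zero => simp
      | succ k ih =>
        rw [show ((k + 1 : ℕ) : ℤ) - N = ((k : ℤ) - N) + 1 by push_cast; ring,
          thetaTerm_succ hp0 hu, ← ih, Nat.choose_succ_succ' k 1, Nat.choose_one_right,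
          zpow_sub₀ hp0]
        simp only [zpow_natCast]
        rw [pow_succ (u / p ^ N), pow_add, pow_succ (-1 : ℂ)]
        ring
    rw [← key k]
    ring

/-- The Jacobi triple product, by dominated convergence in its finite form. The Gaussian binomials
are quotients of `(p; p)_m`; these and their inverses are bounded, so the binomials are uniformly
bounded and tend to `1 / (p; p)_∞`. -/
theorem qPochInf_mul_ellTheta {p u : ℂ} (hp : ‖p‖ < 1) (hp0 : p ≠ 0) (hu : u ≠ 0) :
    qPochInf p p * ellTheta p u = ∑' n : ℤ, thetaTerm p u n := by
  have hlim1 : Tendsto (fun N : ℕ => ∏ j ∈ Finset.range N, ((1 - p ^ j * u) * (1 - p ^ (j + 1) / u)))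
      atTop (𝓝 (ellTheta p u)) := by
    have := ((multipliable_qPochInf hp u).mul (multipliable_qPochInf hp (p / u)))
    have := (this.congr (g := fun j : ℕ => (1 - p ^ j * u) * (1 - p ^ (j + 1) / u))
      (fun j => by ring)).tendsto_prod_tprod_nat
    exact this
  have hinv : Tendsto (fun m => (qFact p m)⁻¹) atTop (𝓝 (qPochInf p p)⁻¹) :=
    (tendsto_qFact hp).inv₀ (qPochInf_self_ne_zero hp)
  obtain ⟨C1, hC1⟩ := (Metric.isBounded_range_of_tendsto _ (tendsto_qFact hp)).exists_norm_le
  obtain ⟨C2, hC2⟩ := (Metric.isBounded_range_of_tendsto _ hinv).exists_norm_le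
  have hC1' : ∀ m, ‖qFact p m‖ ≤ C1 := fun m => hC1 _ ⟨m, rfl⟩
  have hC2' : ∀ m, ‖(qFact p m)⁻¹‖ ≤ C2 := fun m => hC2 _ ⟨m, rfl⟩
  have hC1n : 0 ≤ C1 := (norm_nonneg _).trans (hC1' 0)
  have hC2n : 0 ≤ C2 := (norm_nonneg _).trans (hC2' 0)
  have hg : ∀ k l, gaussBinom p (k + l) k = qFact p (k + l) * (qFact p k)⁻¹ * (qFact p l)⁻¹ := by
    intro k l
    rw [← gaussBinom_mul p k l]
    have := qFact_ne_zero hp k; have := qFact_ne_zero hp l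
    field_simp
  let f : ℕ → ℤ → ℂ := fun N n => if n ∈ Finset.Icc (-N : ℤ) N then
    thetaTerm p u n * gaussBinom p (2 * N) (N + n).toNat else 0
  have hf : ∀ N, ∑' n, f N n
      = ∏ j ∈ Finset.range N, ((1 - p ^ j * u) * (1 - p ^ (j + 1) / u)) := by
    intro N
    rw [finite_triple_product hp0 hu, tsum_eq_sum (s := Finset.Icc (-N : ℤ) N)]
    · exact Finset.sum_congr rfl fun n hn => if_pos hn
    · intro n hn; exact if_neg hn
  have hsplit : ∀ (N : ℕ) (n : ℤ), n ∈ Finset.Icc (-N : ℤ) N →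
      gaussBinom p (2 * N) (N + n).toNat
        = qFact p (2 * N) * (qFact p (N + n).toNat)⁻¹ * (qFact p (N - n).toNat)⁻¹ := by
    intro N n hn
    have hn := Finset.mem_Icc.1 hn
    have e : 2 * N = (N + n).toNat + (N - n).toNat := by omega
    rw [e, hg]
  have hlim2 := tendsto_tsum_of_dominated_convergence (𝓕 := atTop) (f := f)
    (g := fun n => thetaTerm p u n * (qPochInf p p)⁻¹)
    (bound := fun n => ‖thetaTerm p u n‖ * (C1 * C2 * C2))
    ((summable_thetaTerm hp hp0 hu).mul_right _)
    (by
      intro n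
      have hev : ∀ᶠ N : ℕ in atTop, thetaTerm p u n * (qFact p (2 * N)
          * (qFact p (N + n).toNat)⁻¹ * (qFact p (N - n).toNat)⁻¹) = f N n := by
        filter_upwards [eventually_ge_atTop n.natAbs] with N hN
        have hn : n ∈ Finset.Icc (-N : ℤ) N := by rw [Finset.mem_Icc]; omega
        simp only [f, if_pos hn, hsplit N n hn]
      refine Tendsto.congr' hev ?_
      have t1 : Tendsto (fun N : ℕ => 2 * N) atTop atTop :=
        tendsto_atTop_mono (fun N => by simp only [id]; omega) tendsto_id
      have t2 : ∀ n : ℤ, Tendsto (fun N : ℕ => ((N : ℤ) + n).toNat) atTop atTop := by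
        intro n
        refine tendsto_atTop.2 fun b => ?_
        filter_upwards [eventually_ge_atTop (b + n.natAbs)] with N hN
        omega
      have h0 := qPochInf_self_ne_zero hp
      have := ((((tendsto_qFact hp).comp t1).mul (hinv.comp (t2 n))).mul
        (hinv.comp (t2 (-n)))).const_mul (thetaTerm p u n)
      rw [mul_inv_cancel₀ h0, one_mul] at this
      exact this)
    (Eventually.of_forall fun N n => by
      by_cases hn : n ∈ Finset.Icc (-N : ℤ) N
      · simp only [f, if_pos hn, hsplit N n hn, norm_mul]
        gcongr
        · exact hC1' _
        · exact hC2' _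
        · exact hC2' _
      · simp only [f, if_neg hn, norm_zero]
        positivity)
  have := tendsto_nhds_unique hlim1 (hlim2.congr hf)
  rw [this, tsum_mul_right]
  have := qPochInf_self_ne_zero hp
  field_simp

end TripleProduct

/-! ### Determinant form of `θ(xy) θ(x/y)` and interpolation -/

/-- The sublattice `m + n` even and its odd coset are parametrized by `(a + b, a - b)` and `(a + b +
1, a - b)`. In these coordinates a product of two theta series separates into functions of `x` and
of `y`. -/
theorem tsum_int_prod_eq_add {F : ℤ × ℤ → ℂ} (hF : Summable F) :
    ∑' z, F z = (∑' z : ℤ × ℤ, F (z.1 + z.2, z.1 - z.2))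
      + ∑' z : ℤ × ℤ, F (z.1 + z.2 + 1, z.1 - z.2) := by
  let e0 : ℤ × ℤ → ℤ × ℤ := fun z => (z.1 + z.2, z.1 - z.2)
  let e1 : ℤ × ℤ → ℤ × ℤ := fun z => (z.1 + z.2 + 1, z.1 - z.2)
  have i0 : Function.Injective e0 := by
    rintro ⟨a, b⟩ ⟨c, d⟩ h; simp only [e0, Prod.mk.injEq] at h ⊢; omega
  have i1 : Function.Injective e1 := by
    rintro ⟨a, b⟩ ⟨c, d⟩ h; simp only [e1, Prod.mk.injEq] at h ⊢; omega
  have hc : Set.range e1 = (Set.range e0)ᶜ := by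
    ext ⟨m, n⟩
    simp only [Set.mem_range, Set.mem_compl_iff, Prod.exists, e0, e1, Prod.mk.injEq]
    constructor
    · rintro ⟨a, b, h1, h2⟩ ⟨c, d, h3, h4⟩; omega
    · intro h
      by_cases hp : (m + n) % 2 = 0
      · exact absurd ⟨(m + n) / 2, (m - n) / 2, by omega, by omega⟩ h
      · exact ⟨(m + n) / 2, (m - n) / 2, by omega, by omega⟩
  have h := Summable.tsum_add_tsum_compl (f := F) (s := Set.range e0) (hF.subtype _)
    (hF.subtype _)
  rw [← hc, tsum_range F i0, tsum_range F i1] at h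
  exact h.symm

theorem ellTheta_zero (u : ℂ) : ellTheta 0 u = 1 - u := by
  have h0 : qPochInf 0 0 = 1 := by simp [qPochInf]
  rw [ellTheta_eq_mul (by simp), qPochInf_eq (by simp) u]
  simp [h0]

/-- The product `θ(xy) θ(x/y)` is, up to elementary factors, a `2 × 2` determinant. -/
theorem exists_ellTheta_det {p : ℂ} (hp : ‖p‖ < 1) :
    ∃ A B : ℂ → ℂ, ∃ K : ℂ, K ≠ 0 ∧ ∀ x y : ℂ, x ≠ 0 → y ≠ 0 →
      K * (ellTheta p (x * y) * ellTheta p (x / y)) = x * (A x * B y - B x * A y) := by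
  -- The bilateral series needs `p ≠ 0`. For `p = 0` one has `θ(u) = 1 - u` and the determinant is
  -- explicit.
  by_cases hp0 : p = 0
  · subst hp0
    refine ⟨fun x => x + 1 / x, fun _ => 1, 1, one_ne_zero, fun x y hx hy => ?_⟩
    rw [ellTheta_zero, ellTheta_zero]
    field_simp
    ring
  let T : ℂ → ℂ → ℂ := fun p u => ∑' n : ℤ, thetaTerm p u n
  have hp2 : ‖p ^ 2‖ < 1 := by
    rw [norm_pow]; exact pow_lt_one₀ (norm_nonneg _) hp two_ne_zero
  have hp20 : p ^ 2 ≠ 0 := pow_ne_zero 2 hp0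
  -- The two functions are theta series of nome `p²` in `x²`; the even and odd classes of the double
  -- series give the two products in the determinant.
  refine ⟨fun x => x * T (p ^ 2) (-(p ^ 2 * x ^ 2)), fun x => T (p ^ 2) (-(p * x ^ 2)),
    qPochInf p p ^ 2, pow_ne_zero 2 (qPochInf_self_ne_zero hp), fun x y hx hy => ?_⟩
  have hxy : x * y ≠ 0 := mul_ne_zero hx hy
  have hxy' : x / y ≠ 0 := div_ne_zero hx hy
  have hs1 := summable_thetaTerm hp hp0 hxy
  have hs2 := summable_thetaTerm hp hp0 hxy'
  have hprod : qPochInf p p ^ 2 * (ellTheta p (x * y) * ellTheta p (x / y))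
      = ∑' z : ℤ × ℤ, thetaTerm p (x * y) z.1 * thetaTerm p (x / y) z.2 := by
    rw [← tsum_mul_tsum_of_summable_norm hs1 hs2, ← qPochInf_mul_ellTheta hp hp0 hxy,
      ← qPochInf_mul_ellTheta hp hp0 hxy']
    ring
  rw [hprod, tsum_int_prod_eq_add (summable_mul_of_summable_norm hs1 hs2)]
  have hmul : ∀ u v : ℂ, u ≠ 0 → v ≠ 0 →
      T (p ^ 2) u * T (p ^ 2) v
        = ∑' z : ℤ × ℤ, thetaTerm (p ^ 2) u z.1 * thetaTerm (p ^ 2) v z.2 := fun u v hu hv =>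
    tsum_mul_tsum_of_summable_norm (summable_thetaTerm hp2 hp20 hu) (summable_thetaTerm hp2 hp20 hv)
  have n1 : (-1 : ℂ) ≠ 0 := by norm_num
  have nx : ∀ w : ℂ, w ≠ 0 → -(p * w ^ 2) ≠ 0 := fun w hw =>
    neg_ne_zero.2 (mul_ne_zero hp0 (pow_ne_zero 2 hw))
  have nx2 : ∀ w : ℂ, w ≠ 0 → -(p ^ 2 * w ^ 2) ≠ 0 := fun w hw =>
    neg_ne_zero.2 (mul_ne_zero hp20 (pow_ne_zero 2 hw))
  have hE : ∀ (w : ℂ), w ≠ 0 → ∀ a : ℤ, thetaTerm (p ^ 2) (-(p * w ^ 2)) a = p ^ (a * a) * w ^ (2 * a) := by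
    intro w hw a
    unfold thetaTerm
    rw [neg_eq_neg_one_mul (p * w ^ 2), mul_zpow, mul_zpow, ← zpow_natCast p 2,
      ← zpow_natCast w 2, ← zpow_mul, ← zpow_mul]
    have e := even_tri a
    have : a * a = (2 : ℕ) * (a * (a - 1) / 2) + a := by push_cast; linarith
    rw [this, zpow_add₀ hp0]
    have : ((-1 : ℂ) ^ a) * (-1) ^ a = 1 := by rw [← mul_zpow]; norm_num
    push_cast
    linear_combination (p ^ (2 * (a * (a - 1) / 2)) * p ^ a * w ^ (2 * a)) * this
  have hO : ∀ (w : ℂ), w ≠ 0 → ∀ a : ℤ, thetaTerm (p ^ 2) (-(p ^ 2 * w ^ 2)) a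
      = p ^ (a * a + a) * w ^ (2 * a) := by
    intro w hw a
    unfold thetaTerm
    rw [neg_eq_neg_one_mul (p ^ 2 * w ^ 2), mul_zpow, mul_zpow, ← zpow_natCast p 2,
      ← zpow_natCast w 2, ← zpow_mul,
      ← zpow_mul, ← zpow_mul]
    have e := even_tri a
    have : a * a + a = (2 : ℕ) * (a * (a - 1) / 2) + (2 : ℕ) * a := by push_cast; linarith
    rw [this, zpow_add₀ hp0]
    have : ((-1 : ℂ) ^ a) * (-1) ^ a = 1 := by rw [← mul_zpow]; norm_num
    push_cast
    linear_combination (p ^ (2 * (a * (a - 1) / 2)) * p ^ (2 * a) * w ^ (2 * a)) * this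
  have hG : ∀ m n : ℤ, thetaTerm p (x * y) m * thetaTerm p (x / y) n
      = (-1) ^ (m + n) * p ^ (m * (m - 1) / 2 + n * (n - 1) / 2) * x ^ (m + n) * y ^ (m - n) := by
    intro m n
    unfold thetaTerm
    rw [zpow_add₀ n1, zpow_add₀ hp0, zpow_add₀ hx, zpow_sub₀ hy, mul_zpow, div_zpow]
    ring
  have hEven : (∑' z : ℤ × ℤ, thetaTerm p (x * y) (z.1 + z.2) * thetaTerm p (x / y) (z.1 - z.2))
      = x ^ 2 * (T (p ^ 2) (-(p ^ 2 * x ^ 2)) * T (p ^ 2) (-(p * y ^ 2))) := by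
    rw [hmul _ _ (nx2 x hx) (nx y hy), ← tsum_mul_left]
    -- On the even class the exponent of `p` is `a² - a + b²`. Shifting `a` by one makes it `a² + a
    -- + b²`, as in the series at `-p² x²`, at the cost of `x²`.
    rw [← (Equiv.prodCongr (Equiv.addRight (1 : ℤ)) (Equiv.refl ℤ)).tsum_eq]
    refine tsum_congr ?_
    rintro ⟨a, b⟩
    simp only [Equiv.prodCongr_apply, Prod.map, Equiv.coe_addRight, Equiv.refl_apply]
    rw [hG, hO x hx, hE y hy]
    have e1 := even_tri (a + 1 + b)
    have e2 := even_tri (a + 1 - b)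
    rw [show (a + 1 + b) * (a + 1 + b - 1) / 2 + (a + 1 - b) * (a + 1 - b - 1) / 2
      = (a * a + a) + b * b by linarith,
      show a + 1 + b + (a + 1 - b) = 2 * a + 2 by ring,
      show a + 1 + b - (a + 1 - b) = 2 * b by ring, zpow_add₀ hp0, zpow_add₀ hx,
      show (2 * a + 2 : ℤ) = 2 * (a + 1) by ring, zpow_mul (-1 : ℂ)]
    norm_num
    norm_cast
    ring
  have hOdd : (∑' z : ℤ × ℤ, thetaTerm p (x * y) (z.1 + z.2 + 1) * thetaTerm p (x / y) (z.1 - z.2))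
      = -(x * y * (T (p ^ 2) (-(p * x ^ 2)) * T (p ^ 2) (-(p ^ 2 * y ^ 2)))) := by
    rw [hmul _ _ (nx x hx) (nx2 y hy), ← tsum_mul_left, ← tsum_neg]
    refine tsum_congr ?_
    rintro ⟨a, b⟩
    rw [hG, hO y hy, hE x hx]
    have e1 := even_tri (a + b + 1)
    have e2 := even_tri (a - b)
    simp only
    rw [show (a + b + 1) * (a + b + 1 - 1) / 2 + (a - b) * (a - b - 1) / 2
      = a * a + (b * b + b) by linarith,
      show a + b + 1 + (a - b) = 2 * a + 1 by ring,
      show a + b + 1 - (a - b) = 2 * b + 1 by ring, zpow_add₀ hp0, zpow_add₀ hx, zpow_add₀ hy,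
      zpow_add₀ n1, zpow_mul (-1 : ℂ)]
    norm_num
    ring
  rw [hEven, hOdd]
  ring

/-- For fixed `c`, the functions `u ↦ θ(w/u) θ(wu/c)` span a two-dimensional space. -/
theorem ellTheta_interpolation {p : ℂ} (hp : ‖p‖ < 1) {u v₁ v₂ c : ℂ} (hu : u ≠ 0) (h1 : v₁ ≠ 0)
    (h2 : v₂ ≠ 0) (hc : c ≠ 0) (h12 : ellTheta p (v₂ / v₁) ≠ 0)
    (hcc : ellTheta p (v₁ * v₂ / c) ≠ 0) :
    ∃ K₁ K₂ : ℂ, ∀ w : ℂ, w ≠ 0 → ellTheta p (w / u) * ellTheta p (w * u / c)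
      = K₁ * (ellTheta p (w / v₁) * ellTheta p (w * v₁ / c))
        + K₂ * (ellTheta p (w / v₂) * ellTheta p (w * v₂ / c)) := by
  obtain ⟨A, B, K, hK, hdet⟩ := exists_ellTheta_det hp
  -- With a square root of `c`, the arguments `w/v` and `wv/c` become the quotient and product of
  -- `w/γ` and `v/γ`.
  obtain ⟨γ, rfl⟩ : ∃ γ : ℂ, c = γ ^ 2 := by
    obtain ⟨γ, h⟩ := IsAlgClosed.exists_pow_nat_eq c (n := 2) two_pos
    exact ⟨γ, h.symm⟩
  have hγ : γ ≠ 0 := by rintro rfl; simp at hc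
  have hf : ∀ w v : ℂ, w ≠ 0 → v ≠ 0 → K * (ellTheta p (w / v) * ellTheta p (w * v / γ ^ 2))
      = w / γ * (A (w / γ) * B (v / γ) - B (w / γ) * A (v / γ)) := by
    intro w v hw hv
    rw [← hdet _ _ (div_ne_zero hw hγ) (div_ne_zero hv hγ),
      show w / γ * (v / γ) = w * v / γ ^ 2 by ring, show w / γ / (v / γ) = w / v by field_simp]
    ring
  set D := A (v₂ / γ) * B (v₁ / γ) - B (v₂ / γ) * A (v₁ / γ) with hD
  have hD0 : D ≠ 0 := by
    intro h0
    have := hf v₂ v₁ h2 h1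
    rw [← hD, h0, mul_zero] at this
    rcases mul_eq_zero.1 this with h | h
    · exact hK h
    · rcases mul_eq_zero.1 h with h | h
      · exact h12 h
      · rw [mul_comm v₂] at h; exact hcc h
  -- Cramer's rule; the determinant `D` of the system is non-zero by the two genericity hypotheses.
  refine ⟨(A (v₂ / γ) * B (u / γ) - B (v₂ / γ) * A (u / γ)) / D,
    (A (u / γ) * B (v₁ / γ) - B (u / γ) * A (v₁ / γ)) / D, fun w hw => ?_⟩
  have e0 := hf w u hw hu
  have e1 := hf w v₁ hw h1
  have e2 := hf w v₂ hw h2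
  apply mul_left_cancel₀ hK
  rw [e0, mul_add, ← mul_assoc K, mul_comm K, mul_assoc, e1, ← mul_assoc K, mul_comm K, mul_assoc,
    e2]
  field_simp
  rw [hD]
  ring

/-! ### Partial fractions of types `A` and `D` -/

theorem ContinuousAt.ellTheta {p : ℂ} (hp : ‖p‖ < 1) {f : ℂ → ℂ} {s : ℂ} (hf : ContinuousAt f s)
    (h : f s ≠ 0) : ContinuousAt (fun s => ellTheta p (f s)) s :=
  ContinuousAt.comp (g := _root_.ellTheta p) (continuousAt_ellTheta hp h) hf

/-- Partial fractions of type `A`. -/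
theorem sum_ellTheta_div_eq_zero {p : ℂ} (hp : ‖p‖ < 1) {ι : Type*} [DecidableEq ι] (a : ι → ℂ)
    (m : ℕ) : ∀ (L : List ℂ) (s : Finset ι), L.length = m → s.card = m → (∀ i ∈ s, a i ≠ 0) →
      (∀ b ∈ L, b ≠ 0) → L.prod = ∏ i ∈ s, a i →
      (∀ i ∈ s, ∀ j ∈ s, i ≠ j → ellTheta p (a i / a j) ≠ 0) →
      ∑ i ∈ s, (L.map fun b => ellTheta p (a i / b)).prod
        / ∏ j ∈ s.erase i, ellTheta p (a i / a j) = 0 := by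
  induction m with
  | zero =>
    intro L s _ hs _ _ _ _
    rw [Finset.card_eq_zero.1 hs]; simp
  | succ m ih =>
    intro L s hL hs ha hb hprod hne
    match L, hL with
    | [b], hL =>
      have hm : s.card = 1 := by simpa [← hL] using hs
      obtain ⟨i, rfl⟩ := Finset.card_eq_one.1 hm
      have hbi : b = a i := by simpa using hprod
      have := ha i (by simp)
      simp [hbi, div_self this, ellTheta_one hp]
    | [b₁, b₂], hL =>
      have hm : s.card = 2 := by simpa [← hL] using hs
      obtain ⟨i, j, hij, rfl⟩ := Finset.card_eq_two.1 hm
      have h1 : a i ≠ 0 := ha i (by simp)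
      have h2 : a j ≠ 0 := ha j (by simp)
      have hb1 : b₁ ≠ 0 := hb b₁ (by simp)
      have hb2 : b₂ ≠ 0 := hb b₂ (by simp)
      have hpr : b₁ * b₂ = a i * a j := by simpa [Finset.prod_pair hij] using hprod
      have hn : ellTheta p (a i / a j) ≠ 0 := hne i (by simp) j (by simp) hij
      have e1 : ({i, j} : Finset ι).erase i = {j} := by
        ext k; simp only [Finset.mem_erase, Finset.mem_insert, Finset.mem_singleton]; grind
      have e2 : ({i, j} : Finset ι).erase j = {i} := by
        ext k; simp only [Finset.mem_erase, Finset.mem_insert, Finset.mem_singleton]; grind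
      rw [Finset.sum_pair hij, e1, e2]
      simp only [List.map_cons, List.map_nil, List.prod_cons, List.prod_nil, mul_one,
        Finset.prod_singleton]
      have t1 : a j / b₁ = (a i / b₂)⁻¹ := by
        field_simp; linear_combination -hpr
      have t2 : a j / b₂ = (a i / b₁)⁻¹ := by
        field_simp; linear_combination -hpr
      have t3 : a j / a i = (a i / a j)⁻¹ := by field_simp
      rw [t1, t2, t3, ellTheta_inv hp (div_ne_zero h1 hb2), ellTheta_inv hp (div_ne_zero h1 hb1),
        ellTheta_inv hp (div_ne_zero h1 h2)]
      field_simp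
      linear_combination (-(ellTheta p (a i / b₁) * ellTheta p (a i / b₂))) * hpr
    -- As a function of `a i`, the pair of factors with `b₁`, `b₂` is interpolated at the nodes `a
    -- i₁` and `a i₂`. In each part, the term at the chosen node vanishes and its theta factor
    -- cancels from the other denominators, which leaves an instance with one point fewer.
    | b₁ :: b₂ :: b₃ :: L, hL =>
      have hb1 : b₁ ≠ 0 := hb b₁ (by simp)
      have hb2 : b₂ ≠ 0 := hb b₂ (by simp)
      have hb3 : b₃ ≠ 0 := hb b₃ (by simp)
      have hbL : ∀ b ∈ L, b ≠ 0 := fun b h => hb b (by simp [h])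
      obtain ⟨i₁, hi1, i₂, hi2, h12⟩ := Finset.one_lt_card.1
        (show 1 < s.card by rw [hs, ← hL]; simp)
      have ha1 := ha i₁ hi1
      have ha2 := ha i₂ hi2
      -- Trading `t` between `b₁` and `b₃` keeps the balancing condition and moves `a i₁ a i₂ / (b₁
      -- b₂)` off the zeros of `θ`, as the interpolation requires.
      set E : ℂ → ℂ := fun t => ∑ i ∈ s, ellTheta p (a i / (b₁ / t)) * (ellTheta p (a i / b₂) *
        (ellTheta p (a i / (b₃ * t)) * (L.map fun b => ellTheta p (a i / b)).prod))
        / ∏ j ∈ s.erase i, ellTheta p (a i / a j) with hEdef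
      have hgoal : E 1 = 0 := by
        refine eq_zero_of_countable ?_ (countable_ellTheta_const_mul hp
          (div_ne_zero (mul_ne_zero ha1 ha2) (mul_ne_zero hb1 hb2))) ?_
        · refine tendsto_finsetSum _ fun i hi => ?_
          have hai := ha i hi
          refine ContinuousAt.div_const (ContinuousAt.mul ?_
            (continuousAt_const.mul (ContinuousAt.mul ?_ continuousAt_const))) _
          · refine ContinuousAt.ellTheta hp ?_ (by simp [hai, hb1])
            exact continuousAt_const.div (continuousAt_const.div continuousAt_id one_ne_zero)
              (by simp [hb1])
          · refine ContinuousAt.ellTheta hp ?_ (by simp [hai, hb3])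
            exact continuousAt_const.div (continuousAt_const.mul continuousAt_id) (by simp [hb3])
        · intro t ht hgen
          have hgen' : ellTheta p (a i₁ * a i₂ / (b₁ / t * b₂)) ≠ 0 := by
            intro h0
            refine hgen ⟨ht, ?_⟩
            rw [← h0]; congr 1; field_simp
          have hb1t : b₁ / t ≠ 0 := div_ne_zero hb1 ht
          have hb3t : b₃ * t ≠ 0 := mul_ne_zero hb3 ht
          obtain ⟨K₁, K₂, hK⟩ := ellTheta_interpolation hp hb1t ha1 ha2 (mul_ne_zero hb1t hb2)
            (hne i₂ hi2 i₁ hi1 h12.symm) hgen'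
          have key : ∀ i₁ ∈ s, ∑ i ∈ s, (ellTheta p (a i / a i₁)
              * ellTheta p (a i * a i₁ / (b₁ / t * b₂))) * (ellTheta p (a i / (b₃ * t))
                * (L.map fun b => ellTheta p (a i / b)).prod)
              / ∏ j ∈ s.erase i, ellTheta p (a i / a j) = 0 := by
            intro i₁ hi1
            have ha1 := ha i₁ hi1
            rw [← Finset.add_sum_erase s _ hi1, div_self ha1, ellTheta_one hp]
            have := ih ((b₁ / t * b₂ / a i₁) :: (b₃ * t) :: L) (s.erase i₁)
              (by simpa using hL) (by rw [Finset.card_erase_of_mem hi1, hs]; simp)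
              (fun i hi => ha i (Finset.mem_of_mem_erase hi))
              (by
                intro b hbm
                rcases List.mem_cons.1 hbm with rfl | hbm
                · exact div_ne_zero (mul_ne_zero hb1t hb2) ha1
                rcases List.mem_cons.1 hbm with rfl | hbm
                · exact hb3t
                · exact hbL b hbm)
              (by
                rw [← Finset.mul_prod_erase s _ hi1] at hprod
                simp only [List.prod_cons] at hprod ⊢
                field_simp
                linear_combination hprod)
              (fun i hi j hj hij => hne i (Finset.mem_of_mem_erase hi) j
                (Finset.mem_of_mem_erase hj) hij)
            rw [zero_mul, zero_mul, zero_div, zero_add, ← this]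
            refine Finset.sum_congr rfl fun i hi => ?_
            have hii := Finset.mem_erase.1 hi
            have hne1 := hne i hii.2 i₁ hi1 hii.1
            rw [← Finset.mul_prod_erase (s.erase i) _
              (Finset.mem_erase.2 ⟨hii.1.symm, hi1⟩), Finset.erase_right_comm]
            simp only [List.map_cons, List.prod_cons]
            rw [show a i / (b₁ / t * b₂ / a i₁) = a i * a i₁ / (b₁ / t * b₂) by field_simp,
              mul_assoc (ellTheta p (a i / a i₁)), mul_div_mul_left _ _ hne1]
          have hsplit : E t = K₁ * (∑ i ∈ s, (ellTheta p (a i / a i₁)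
                * ellTheta p (a i * a i₁ / (b₁ / t * b₂))) * (ellTheta p (a i / (b₃ * t))
                  * (L.map fun b => ellTheta p (a i / b)).prod)
                / ∏ j ∈ s.erase i, ellTheta p (a i / a j))
              + K₂ * (∑ i ∈ s, (ellTheta p (a i / a i₂)
                * ellTheta p (a i * a i₂ / (b₁ / t * b₂))) * (ellTheta p (a i / (b₃ * t))
                  * (L.map fun b => ellTheta p (a i / b)).prod)
                / ∏ j ∈ s.erase i, ellTheta p (a i / a j)) := by
            rw [Finset.mul_sum, Finset.mul_sum, ← Finset.sum_add_distrib]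
            refine Finset.sum_congr rfl fun i hi => ?_
            have := hK (a i) (ha i hi)
            rw [show a i * (b₁ / t) / (b₁ / t * b₂) = a i / b₂ by field_simp] at this
            rw [← mul_assoc (ellTheta p (a i / (b₁ / t))), this]
            ring
          rw [hsplit, key i₁ hi1, key i₂ hi2]
          ring
      simpa [hEdef] using hgoal

/-- Right-hand side of the type `D` partial fraction identity. -/
def typeDValue (p : ℂ) (n : ℕ) (b₁ b₂ b₃ b₄ Z : ℂ) : ℂ :=
  if Odd n then
    ellTheta p (b₁ * Z) * ellTheta p (b₂ * Z) * ellTheta p (b₃ * Z) * ellTheta p (b₄ * Z) / Z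
  else
    ellTheta p Z * ellTheta p (b₁ * b₂ * Z) * ellTheta p (b₁ * b₃ * Z) * ellTheta p (b₁ * b₄ * Z)
      / (b₁ * Z)

/-- Partial fractions of type `D`. -/
theorem sum_ellTheta_typeD {p : ℂ} (hp : ‖p‖ < 1) {ι : Type*} [DecidableEq ι] (z : ι → ℂ)
    (m : ℕ) : ∀ (s : Finset ι) (b₁ b₂ b₃ b₄ : ℂ), s.card = m → (∀ i ∈ s, z i ≠ 0) →
      b₁ * b₂ * b₃ * b₄ * (∏ i ∈ s, z i) ^ 2 = 1 →
      (∀ i ∈ s, ∀ j ∈ s, i ≠ j → ellTheta p (z i / z j) ≠ 0) →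
      ∑ i ∈ s, ellTheta p (b₁ * z i) * ellTheta p (b₂ * z i) * ellTheta p (b₃ * z i)
          * ellTheta p (b₄ * z i) / z i
          * ∏ j ∈ s.erase i, (ellTheta p (z i * z j) / ellTheta p (z i / z j))
        = typeDValue p m b₁ b₂ b₃ b₄ (∏ i ∈ s, z i) := by
  induction m with
  | zero =>
    intro s b₁ b₂ b₃ b₄ hs _ _ _
    rw [Finset.card_eq_zero.1 hs]; simp [typeDValue, ellTheta_one hp]
  | succ m ih =>
    intro s b₁ b₂ b₃ b₄ hs hz hbal hne
    rcases Nat.eq_zero_or_pos m with rfl | hm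
    · obtain ⟨i, rfl⟩ := Finset.card_eq_one.1 hs
      simp [typeDValue]
    obtain ⟨i₁, hi1, i₂, hi2, h12⟩ := Finset.one_lt_card.1 (show 1 < s.card by omega)
    have hz1 := hz i₁ hi1
    have hz2 := hz i₂ hi2
    set Z := ∏ i ∈ s, z i with hZdef
    have hZ : Z ≠ 0 := Finset.prod_ne_zero_iff.2 hz
    have hb : b₁ ≠ 0 ∧ b₂ ≠ 0 ∧ b₃ ≠ 0 ∧ b₄ ≠ 0 := by
      refine ⟨?_, ?_, ?_, ?_⟩ <;> rintro rfl <;> simp at hbal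
    obtain ⟨hb1, hb2, hb3, hb4⟩ := hb
    -- The deformation trades `t` between `b₂` and `b₃`; it makes `θ(b₁ b₂ z_{i₁} z_{i₂})` non-zero,
    -- so that the pair with `b₁`, `b₂` can be interpolated at `z i₁` and `z i₂`.
    set E : ℂ → ℂ := fun t => ∑ i ∈ s, ellTheta p (b₁ * z i) * ellTheta p (b₂ * t * z i)
          * ellTheta p (b₃ / t * z i) * ellTheta p (b₄ * z i) / z i
          * ∏ j ∈ s.erase i, (ellTheta p (z i * z j) / ellTheta p (z i / z j))
        - typeDValue p (m + 1) b₁ (b₂ * t) (b₃ / t) b₄ Z with hEdef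
    have hgoal : E 1 = 0 := by
      have c1 : ∀ c d : ℂ, c ≠ 0 → d ≠ 0 → ContinuousAt (fun t => ellTheta p (c * t * d)) 1 :=
        fun c d hc hd => ContinuousAt.ellTheta hp (by fun_prop) (by simp [hc, hd])
      have c2 : ∀ c d : ℂ, c ≠ 0 → d ≠ 0 → ContinuousAt (fun t => ellTheta p (c / t * d)) 1 :=
        fun c d hc hd => ContinuousAt.ellTheta hp
          ((continuousAt_const.div continuousAt_id one_ne_zero).mul continuousAt_const)
          (by simp [hc, hd])
      refine eq_zero_of_countable ?_ (countable_ellTheta_const_mul hp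
          (mul_ne_zero (mul_ne_zero hz1 hz2) (mul_ne_zero hb1 hb2))) ?_
      · refine ContinuousAt.sub (tendsto_finsetSum _ fun i hi => ?_) ?_
        · have hzi := hz i hi
          exact ((((continuousAt_const.mul (c1 _ _ hb2 hzi)).mul (c2 _ _ hb3 hzi)).mul
            continuousAt_const).div_const _).mul continuousAt_const
        · unfold typeDValue
          split_ifs
          · exact (((continuousAt_const.mul (c1 _ _ hb2 hZ)).mul (c2 _ _ hb3 hZ)).mul
              continuousAt_const).div_const _
          · refine (((continuousAt_const.mul ?_).mul ?_).mul continuousAt_const).div_const _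
            · simpa only [← mul_assoc] using c1 _ _ (mul_ne_zero hb1 hb2) hZ
            · simpa only [← mul_div_assoc] using c2 _ _ (mul_ne_zero hb1 hb3) hZ
      · intro t ht hgen
        have hbal' : b₁ * (b₂ * t) * (b₃ / t) * b₄ * Z ^ 2 = 1 := by
          rw [← hbal]; field_simp
        have hbt : b₂ * t ≠ 0 := mul_ne_zero hb2 ht
        have hb3t : b₃ / t ≠ 0 := div_ne_zero hb3 ht
        have hgen' : ellTheta p (z i₁ * z i₂ / (1 / (b₁ * (b₂ * t)))) ≠ 0 := by
          intro h0
          refine hgen ⟨ht, ?_⟩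
          rw [← h0]; congr 1; field_simp
        simp only [hEdef]
        generalize b₂ * t = b₂' at hbal' hbt hgen' ⊢
        generalize b₃ / t = b₃' at hbal' hb3t hgen' ⊢
        have hc : 1 / (b₁ * b₂') ≠ 0 := one_div_ne_zero (mul_ne_zero hb1 hbt)
        obtain ⟨K₁, K₂, hK⟩ := ellTheta_interpolation hp (one_div_ne_zero hb1) hz1 hz2 hc
            (hne i₂ hi2 i₁ hi1 h12.symm) hgen'
        have hK' : ∀ w : ℂ, w ≠ 0 → ellTheta p (b₁ * w) * ellTheta p (b₂' * w)
            = K₁ * (ellTheta p (w / z i₁) * ellTheta p (b₁ * b₂' * z i₁ * w))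
              + K₂ * (ellTheta p (w / z i₂) * ellTheta p (b₁ * b₂' * z i₂ * w)) := by
          intro w hw
          have := hK w hw
          rw [show w / (1 / b₁) = b₁ * w by field_simp,
            show w * (1 / b₁) / (1 / (b₁ * b₂')) = b₂' * w by field_simp,
            show w * z i₁ / (1 / (b₁ * b₂')) = b₁ * b₂' * z i₁ * w by field_simp,
            show w * z i₂ / (1 / (b₁ * b₂')) = b₁ * b₂' * z i₂ * w by field_simp] at this
          exact this
        -- The factor `θ(z_i/z_{i₁})` cancels a denominator and removes the point `i₁`, while the
        -- leftover `θ(z_i z_{i₁})` acts as a new parameter `b₁ = z_{i₁}`. This is why the value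
        -- alternates with the parity.
        have key : ∀ i₁ ∈ s, ∑ i ∈ s, (ellTheta p (z i / z i₁)
            * ellTheta p (b₁ * b₂' * z i₁ * z i)) * (ellTheta p (b₃' * z i)
              * ellTheta p (b₄ * z i)) / z i
            * ∏ j ∈ s.erase i, (ellTheta p (z i * z j) / ellTheta p (z i / z j))
            = typeDValue p m (z i₁) (b₁ * b₂' * z i₁) b₃' b₄ (Z / z i₁) := by
          intro i₁ hi1
          have hz1 := hz i₁ hi1
          have hZ' : ∏ i ∈ s.erase i₁, z i = Z / z i₁ := by
            rw [hZdef, ← Finset.mul_prod_erase s _ hi1]; field_simp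
          have := ih (s.erase i₁) (z i₁) (b₁ * b₂' * z i₁) b₃' b₄
            (by rw [Finset.card_erase_of_mem hi1, hs]; simp)
            (fun i hi => hz i (Finset.mem_of_mem_erase hi))
            (by rw [hZ', ← hbal']; field_simp)
            (fun i hi j hj hij => hne i (Finset.mem_of_mem_erase hi) j
                (Finset.mem_of_mem_erase hj) hij)
          rw [← Finset.add_sum_erase s _ hi1, div_self hz1, ellTheta_one hp, ← hZ', ← this]
          rw [zero_mul, zero_mul, zero_div, zero_mul, zero_add]
          refine Finset.sum_congr rfl fun i hi => ?_
          have hii := Finset.mem_erase.1 hi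
          have hne1 := hne i hii.2 i₁ hi1 hii.1
          rw [← Finset.mul_prod_erase (s.erase i) _
            (Finset.mem_erase.2 ⟨hii.1.symm, hi1⟩), Finset.erase_right_comm,
            mul_comm (z i₁) (z i)]
          field_simp
        have hsplit : ∑ i ∈ s, ellTheta p (b₁ * z i) * ellTheta p (b₂' * z i)
              * ellTheta p (b₃' * z i) * ellTheta p (b₄ * z i) / z i
              * ∏ j ∈ s.erase i, (ellTheta p (z i * z j) / ellTheta p (z i / z j))
            = K₁ * typeDValue p m (z i₁) (b₁ * b₂' * z i₁) b₃' b₄ (Z / z i₁)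
              + K₂ * typeDValue p m (z i₂) (b₁ * b₂' * z i₂) b₃' b₄ (Z / z i₂) := by
          rw [← key i₁ hi1, ← key i₂ hi2, Finset.mul_sum, Finset.mul_sum,
            ← Finset.sum_add_distrib]
          refine Finset.sum_congr rfl fun i hi => ?_
          rw [hK' (z i) (hz i hi)]
          ring
        rw [hsplit, sub_eq_zero]
        -- The two values of size `m` have a common factor. What remains is the right side of the
        -- same interpolation formula, at `w = b₃' Z` for odd `m` and at `w = Z` for even `m`.
        by_cases hodd : Odd m
        · have hodd' : ¬ Odd (m + 1) := by
            rw [Nat.not_odd_iff_even]; exact hodd.add_one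
          simp only [typeDValue, if_pos hodd, if_neg hodd']
          set V := b₃' * Z with hV
          have hV0 : V ≠ 0 := mul_ne_zero hb3t hZ
          have hv : ∀ v, v ≠ 0 → ellTheta p (v * (Z / v)) * ellTheta p (b₁ * b₂' * v * (Z / v))
              * ellTheta p (b₃' * (Z / v)) * ellTheta p (b₄ * (Z / v)) / (Z / v)
            = -(ellTheta p Z * ellTheta p (b₁ * b₂' * Z) / (b₁ * b₂' * V * Z))
              * (ellTheta p (V / v) * ellTheta p (b₁ * b₂' * v * V)) := by
            intro v hv
            have e : b₄ * (Z / v) = (b₁ * b₂' * v * V)⁻¹ := by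
              rw [hV]; field_simp; linear_combination hbal'
            rw [e, ellTheta_inv hp (by positivity), hV,
              show v * (Z / v) = Z by field_simp,
              show b₁ * b₂' * v * (Z / v) = b₁ * b₂' * Z by field_simp]
            field_simp
          rw [hv _ hz1, hv _ hz2]
          have e : b₁ * b₄ * Z = (b₂' * V)⁻¹ := by
            rw [hV]; field_simp; linear_combination hbal'
          rw [e, ellTheta_inv hp (mul_ne_zero hbt hV0), mul_assoc b₁ b₃' Z, ← hV]
          have := hK' V hV0
          clear_value V
          linear_combination (ellTheta p Z * ellTheta p (b₁ * b₂' * Z) / (b₁ * b₂' * V * Z)) * this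
        · have hodd' : Odd (m + 1) := (Nat.not_odd_iff_even.1 hodd).add_one
          simp only [typeDValue, if_neg hodd, if_pos hodd']
          have hv : ∀ v, v ≠ 0 → ellTheta p (Z / v) * ellTheta p (v * (b₁ * b₂' * v) * (Z / v))
              * ellTheta p (v * b₃' * (Z / v)) * ellTheta p (v * b₄ * (Z / v)) / (v * (Z / v))
            = (ellTheta p (Z / v) * ellTheta p (b₁ * b₂' * v * Z))
              * (ellTheta p (b₃' * Z) * ellTheta p (b₄ * Z) / Z) := by
            intro v hv
            rw [show v * (b₁ * b₂' * v) * (Z / v) = b₁ * b₂' * v * Z by field_simp,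
              show v * b₃' * (Z / v) = b₃' * Z by field_simp,
              show v * b₄ * (Z / v) = b₄ * Z by field_simp, show v * (Z / v) = Z by field_simp]
            ring
          rw [hv _ hz1, hv _ hz2, hK' Z hZ]
          ring
    simpa [hEdef, sub_eq_zero] using hgoal

/-! ### Elliptic shifted factorials -/

theorem ellPoch_succ (p q u : ℂ) (m : ℕ) :
    ellPoch p q u (m + 1) = ellPoch p q u m * ellTheta p (q ^ m * u) :=
  Finset.prod_range_succ _ _

theorem ellPoch_zero (p q u : ℂ) : ellPoch p q u 0 = 1 := rfl

theorem ellPoch_ne_zero_iff {p q u : ℂ} {m : ℕ} :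
    ellPoch p q u m ≠ 0 ↔ ∀ l < m, ellTheta p (q ^ l * u) ≠ 0 := by
  simp [ellPoch, Finset.prod_ne_zero_iff]

theorem ellPoch_ne_zero_mono {p q u : ℂ} {m N : ℕ} (h : ellPoch p q u N ≠ 0) (hm : m ≤ N) :
    ellPoch p q u m ≠ 0 :=
  ellPoch_ne_zero_iff.2 fun l hl => ellPoch_ne_zero_iff.1 h l (hl.trans_le hm)

theorem ellPoch_add (p q u : ℂ) (m l : ℕ) :
    ellPoch p q u (m + l) = ellPoch p q u m * ellPoch p q (u * q ^ m) l := by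
  unfold ellPoch
  rw [Finset.prod_range_add]
  congr 1
  exact Finset.prod_congr rfl fun i _ => by rw [pow_add]; congr 1; ring

theorem ellPoch_shift {q : ℂ} (hq : q ≠ 0) (p u : ℂ) (m : ℕ) :
    ellPoch p q u m * ellTheta p (u / q) = ellPoch p q (u / q) m * ellTheta p (q ^ m * u / q) := by
  have h1 := ellPoch_succ p q (u / q) m
  have h2 : ellPoch p q (u / q) (m + 1) = ellTheta p (u / q) * ellPoch p q u m := by
    rw [add_comm, ellPoch_add]
    simp [ellPoch, hq]
  rw [mul_comm, ← h2, h1, mul_div_assoc]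

theorem ContinuousAt.ellPoch {p q : ℂ} (hp : ‖p‖ < 1) (hq : q ≠ 0) {f : ℂ → ℂ} {s : ℂ}
    (hf : ContinuousAt f s) (h : f s ≠ 0) (m : ℕ) :
    ContinuousAt (fun s => ellPoch p q (f s) m) s := by
  unfold _root_.ellPoch
  exact tendsto_finsetProd _ fun i _ =>
    ContinuousAt.ellTheta hp (continuousAt_const.mul hf) (mul_ne_zero (pow_ne_zero _ hq) h)

/-! ### Type `D` terms and the effect of raising one index -/

/-- If a function of pairs changes only on the pairs containing `i`, its product over all pairs
changes by the product of these changes. -/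
theorem prod_pairs_change {n : ℕ} (i : Fin n) (φ ψ : Fin n → Fin n → ℂ) (ρ : Fin n → ℂ)
    (h1 : ∀ a b, a < b → a ≠ i → b ≠ i → φ a b = ψ a b)
    (h2 : ∀ b, i < b → φ i b = ψ i b * ρ b) (h3 : ∀ a, a < i → φ a i = ψ a i * ρ a) :
    ∏ a, ∏ b ∈ Finset.Ioi a, φ a b
      = (∏ a, ∏ b ∈ Finset.Ioi a, ψ a b) * ∏ j ∈ Finset.univ.erase i, ρ j := by
  have hφ : ∀ a, ∀ b ∈ Finset.Ioi a, φ a b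
      = ψ a b * (if a = i then ρ b else if b = i then ρ a else 1) := by
    intro a b hb
    have hb := Finset.mem_Ioi.1 hb
    by_cases ha : a = i
    · subst ha; simp [h2 b hb]
    · by_cases hb' : b = i
      · subst hb'; simp [ha, h3 a hb]
      · simp [ha, hb', h1 a b hb ha hb']
  have hin : ∀ a, ∏ b ∈ Finset.Ioi a, (if a = i then ρ b else if b = i then ρ a else 1)
      = if a = i then ∏ b ∈ Finset.Ioi i, ρ b else if a < i then ρ a else 1 := by
    intro a
    by_cases ha : a = i
    · subst ha; simp
    · simp [ha, Finset.prod_ite_eq']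
  rw [Finset.prod_congr rfl fun a _ => Finset.prod_congr rfl (hφ a)]
  simp only [Finset.prod_mul_distrib, hin]
  congr 1
  rw [← Finset.mul_prod_erase Finset.univ _ (Finset.mem_univ i), if_pos rfl]
  have hd : (Finset.univ.erase i : Finset (Fin n)) = Finset.Ioi i ∪ Finset.Iio i := by
    ext j
    simp only [Finset.mem_erase, Finset.mem_univ, and_true, Finset.mem_union, Finset.mem_Ioi,
      Finset.mem_Iio]
    constructor
    · intro h; exact (lt_or_gt_of_ne h).symm
    · rintro (h | h)
      · exact h.ne'
      · exact h.ne
  have hdis : Disjoint (Finset.Ioi i) (Finset.Iio i) := by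
    rw [Finset.disjoint_left]; intro j h1 h2
    exact absurd (Finset.mem_Ioi.1 h1) (not_lt.2 (Finset.mem_Iio.1 h2).le)
  rw [hd, Finset.prod_union hdis, Finset.prod_union hdis]
  congr 1
  have hone : ∏ x ∈ Finset.Ioi i,
      (if x = i then ∏ b ∈ Finset.Ioi i, ρ b else if x < i then ρ x else 1) = 1 :=
    Finset.prod_eq_one fun j hj => by
      have := Finset.mem_Ioi.1 hj
      simp [this.ne', this.not_gt]
  rw [hone, one_mul]
  exact Finset.prod_congr rfl fun j hj => by
    have := Finset.mem_Iio.1 hj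
    simp [this.ne, this]

/-- The quotients `q^m z_i / z_j` with `|m| ≤ N` are not zeros of `θ`, except for `i = j, m = 0`. -/
def IsGeneric (p q : ℂ) {n : ℕ} (z : Fin n → ℂ) (N : ℕ) : Prop :=
  (∀ i, z i ≠ 0) ∧ ∀ i j, ∀ m : ℤ, m.natAbs ≤ N → (i ≠ j ∨ m ≠ 0) →
    ellTheta p (q ^ m * (z i / z j)) ≠ 0

theorem IsGeneric.mono {p q : ℂ} {n : ℕ} {z : Fin n → ℂ} {N M : ℕ} (h : IsGeneric p q z N)
    (hM : M ≤ N) : IsGeneric p q z M :=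
  ⟨h.1, fun i j m hm => h.2 i j m (hm.trans hM)⟩

/-- For pairs in which `i` comes first, both thetas are inverted; this produces `1/q`, absorbed by
the extra power of `q` in the definition. Hence the change has the same form for indices before and
after `i`. -/
theorem deltaRatio_update {p q : ℂ} (hp : ‖p‖ < 1) (hq : q ≠ 0) {n N : ℕ} {z : Fin n → ℂ}
    (hz : IsGeneric p q z N) (y : Fin n → ℕ) (hy : ∀ i, y i ≤ N) (i : Fin n) :
    deltaRatio p q z (Function.update y i (y i + 1))
      = deltaRatio p q z y * ∏ j ∈ Finset.univ.erase i,
        (ellTheta p (q * (z i * q ^ y i) / (z j * q ^ y j))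
          / ellTheta p (z i * q ^ y i / (z j * q ^ y j))) := by
  unfold deltaRatio
  have hne : ∀ j, j ≠ i → ellTheta p (z i * q ^ y i / (z j * q ^ y j)) ≠ 0 := by
    intro j hj
    have := hz.2 i j ((y i : ℤ) - y j) (by have := hy i; have := hy j; omega) (Or.inl hj.symm)
    rw [zpow_sub₀ hq, zpow_natCast, zpow_natCast] at this
    convert this using 2
    ring
  have hz0 := hz.1
  refine prod_pairs_change i _ _ _ ?_ ?_ ?_
  · intro a b _ ha hb
    simp [Function.update_of_ne ha, Function.update_of_ne hb]
  · intro b hb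
    have hbi : b ≠ i := hb.ne'
    have hzi := hz0 i; have hzb := hz0 b
    rw [Function.update_self, Function.update_of_ne hbi]
    have hu0 : z i * q ^ y i / (z b * q ^ y b) ≠ 0 := div_ne_zero
      (mul_ne_zero hzi (pow_ne_zero _ hq)) (mul_ne_zero hzb (pow_ne_zero _ hq))
    have e1 : q ^ ((y b : ℤ) - ((y i + 1 : ℕ) : ℤ)) * z b / z i
        = (q * (z i * q ^ y i / (z b * q ^ y b)))⁻¹ := by
      rw [zpow_sub₀ hq, zpow_natCast, zpow_natCast, pow_succ]; field_simp
    have e2 : q ^ ((y b : ℤ) - (y i : ℤ)) * z b / z i = (z i * q ^ y i / (z b * q ^ y b))⁻¹ := by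
      rw [zpow_sub₀ hq, zpow_natCast, zpow_natCast]; field_simp
    have hnb := hne b hbi
    rw [e1, e2, ellTheta_inv hp (mul_ne_zero hq hu0), ellTheta_inv hp hu0, mul_div_assoc q]
    generalize z i * q ^ y i / (z b * q ^ y b) = u at *
    rw [pow_succ]
    field_simp
  · intro a ha
    have hai : a ≠ i := ha.ne
    rw [Function.update_self, Function.update_of_ne hai]
    have hza := hz0 a
    have e1 : q ^ (((y i + 1 : ℕ) : ℤ) - (y a : ℤ)) * z i / z a
        = q * (z i * q ^ y i) / (z a * q ^ y a) := by
      rw [zpow_sub₀ hq, zpow_natCast, zpow_natCast, pow_succ]; field_simp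
    have e2 : q ^ ((y i : ℤ) - (y a : ℤ)) * z i / z a = z i * q ^ y i / (z a * q ^ y a) := by
      rw [zpow_sub₀ hq, zpow_natCast, zpow_natCast]; field_simp
    have hna := hne a hai
    rw [e1, e2]
    generalize ellTheta p (z i * q ^ y i / (z a * q ^ y a)) = u at *
    field_simp

/-- The one-variable factor of `dTerm`. -/
def dFactor (p q : ℂ) {n : ℕ} (z : Fin n → ℂ) (f g h η X Y : ℂ) (i : Fin n) (m : ℕ) : ℂ :=
  ellPoch p q (f * z i) m * ellPoch p q (g * z i) m * ellPoch p q (h * z i) m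
    * (ellPoch p q (X * z i) m * ellPoch p q (Y * z i) m)
    / (ellPoch p q (η * z i) m * (z i ^ m * q ^ (m.choose 2))
      * ∏ j, ellPoch p q (q * (z i / z j)) m)

/-- The general term of the type `D` sums over simplices. -/
def dTerm (p q : ℂ) {n : ℕ} (z : Fin n → ℂ) (f g h η X Y : ℂ) (x : Fin n → ℕ) : ℂ :=
  deltaRatio p q z x * (∏ i, ∏ j ∈ Finset.Ioi i, ellPoch p q (z i * z j) (x i + x j))
    * ∏ i, dFactor p q z f g h η X Y i (x i)

theorem dFactor_succ {p q : ℂ} (hq : q ≠ 0) {n N : ℕ} {z : Fin n → ℂ}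
    (hz : IsGeneric p q z N) {f g h η X Y : ℂ} (hη : ∀ i, ellPoch p q (η * z i) N ≠ 0)
    (i : Fin n) {m : ℕ} (hm : m < N) :
    dFactor p q z f g h η X Y i (m + 1)
        * ((∏ j, ellTheta p (q * (z i * q ^ m) / z j)) * ellTheta p (η * (z i * q ^ m)))
      = dFactor p q z f g h η X Y i m * (ellTheta p (f * (z i * q ^ m))
        * ellTheta p (g * (z i * q ^ m)) * ellTheta p (h * (z i * q ^ m))
        * (ellTheta p (X * (z i * q ^ m)) * ellTheta p (Y * (z i * q ^ m))) / (z i * q ^ m)) := by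
  unfold dFactor
  have hzi := hz.1 i
  have hηi := ellPoch_ne_zero_iff.1 (hη i) m hm
  have hηm := ellPoch_ne_zero_mono (hη i) hm.le
  have e : ∀ u : ℂ, ellTheta p (q ^ m * (u * z i)) = ellTheta p (u * (z i * q ^ m)) :=
    fun u => by congr 1; ring
  have hP : ∀ j, ellTheta p (q ^ m * (q * (z i / z j))) = ellTheta p (q * (z i * q ^ m) / z j) :=
    fun j => by congr 1; ring
  have hPn : ∏ j, ellTheta p (q * (z i * q ^ m) / z j) ≠ 0 :=
    Finset.prod_ne_zero_iff.2 fun j _ => by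
      have := hz.2 i j ((m : ℤ) + 1) (by omega) (Or.inr (by omega))
      rw [zpow_add₀ hq, zpow_natCast, zpow_one] at this
      convert this using 2
      ring
  rw [e] at hηi
  simp only [ellPoch_succ, e, hP, Finset.prod_mul_distrib, Nat.choose_succ_succ' m 1,
    Nat.choose_one_right, pow_add, pow_one]
  have aux : ∀ a₁ a₂ a₃ a₄ a₅ b₁ b₂ b₃ b₄ b₅ A t c d w w' Q P : ℂ, P ≠ 0 → t ≠ 0 →
      a₁ * b₁ * (a₂ * b₂) * (a₃ * b₃) * (a₄ * b₄ * (a₅ * b₅))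
        / (A * t * (c * w * (w' * d)) * (Q * P)) * (P * t)
      = a₁ * a₂ * a₃ * (a₄ * a₅) / (A * (c * d) * Q)
        * (b₁ * b₂ * b₃ * (b₄ * b₅) / (w * w')) := by
    intro a₁ a₂ a₃ a₄ a₅ b₁ b₂ b₃ b₄ b₅ A t c d w w' Q P hP ht
    rw [div_mul_div_comm, div_mul_eq_mul_div, ← mul_div_mul_right _ (A * (c * d) * Q * (w * w'))
      (mul_ne_zero hP ht)]
    congr 1 <;> ring
  exact aux _ _ _ _ _ _ _ _ _ _ _ _ _ _ _ _ _ _ hPn hηi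

theorem dTerm_update {p q : ℂ} (hp : ‖p‖ < 1) (hq : q ≠ 0) {n N : ℕ} {z : Fin n → ℂ}
    (hz : IsGeneric p q z N) {f g h η X Y : ℂ} (hη : ∀ i, ellPoch p q (η * z i) N ≠ 0)
    (y : Fin n → ℕ) (hy : ∀ i, y i < N) (i : Fin n) :
    dTerm p q z f g h η X Y (Function.update y i (y i + 1))
        * ((∏ j, ellTheta p (q * (z i * q ^ y i) / z j)) * ellTheta p (η * (z i * q ^ y i)))
      = dTerm p q z f g h η X Y y
        * ((∏ j ∈ Finset.univ.erase i,
          (ellTheta p (q * (z i * q ^ y i) / (z j * q ^ y j))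
            / ellTheta p (z i * q ^ y i / (z j * q ^ y j))))
          * ∏ j ∈ Finset.univ.erase i, ellTheta p (z i * q ^ y i * (z j * q ^ y j)))
        * (ellTheta p (f * (z i * q ^ y i))
        * ellTheta p (g * (z i * q ^ y i)) * ellTheta p (h * (z i * q ^ y i))
        * (ellTheta p (X * (z i * q ^ y i)) * ellTheta p (Y * (z i * q ^ y i)))
          / (z i * q ^ y i)) := by
  unfold dTerm
  rw [deltaRatio_update hp hq hz y (fun i => (hy i).le) i]
  have hB : ∏ a, ∏ b ∈ Finset.Ioi a, ellPoch p q (z a * z b)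
        (Function.update y i (y i + 1) a + Function.update y i (y i + 1) b)
      = (∏ a, ∏ b ∈ Finset.Ioi a, ellPoch p q (z a * z b) (y a + y b))
        * ∏ j ∈ Finset.univ.erase i, ellTheta p (z i * q ^ y i * (z j * q ^ y j)) := by
    refine prod_pairs_change i _ _ _ ?_ ?_ ?_
    · intro a b _ ha hb
      simp [Function.update_of_ne ha, Function.update_of_ne hb]
    · intro b hb
      rw [Function.update_self, Function.update_of_ne hb.ne',
        show y i + 1 + y b = (y i + y b) + 1 by ring, ellPoch_succ, pow_add]
      congr 2; ring
    · intro a ha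
      rw [Function.update_self, Function.update_of_ne ha.ne, ← add_assoc, ellPoch_succ, pow_add]
      congr 2; ring
  have hC : ∀ x : Fin n → ℕ, ∏ a, dFactor p q z f g h η X Y a (x a)
      = dFactor p q z f g h η X Y i (x i)
        * ∏ a ∈ Finset.univ.erase i, dFactor p q z f g h η X Y a (x a) := fun x =>
    (Finset.mul_prod_erase _ _ (Finset.mem_univ i)).symm
  have hC' : ∏ a ∈ Finset.univ.erase i,
        dFactor p q z f g h η X Y a (Function.update y i (y i + 1) a)
      = ∏ a ∈ Finset.univ.erase i, dFactor p q z f g h η X Y a (y a) :=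
    Finset.prod_congr rfl fun a ha => by
      rw [Function.update_of_ne (Finset.ne_of_mem_erase ha)]
  have hs := dFactor_succ hq hz (f := f) (g := g) (h := h) (X := X) (Y := Y) hη i (hy i)
  rw [hB, hC, hC y, hC', Function.update_self]
  linear_combination (deltaRatio p q z y * (∏ j ∈ Finset.univ.erase i,
          (ellTheta p (q * (z i * q ^ y i) / (z j * q ^ y j))
            / ellTheta p (z i * q ^ y i / (z j * q ^ y j))))
    * ((∏ a, ∏ b ∈ Finset.Ioi a, ellPoch p q (z a * z b) (y a + y b))
        * ∏ j ∈ Finset.univ.erase i, ellTheta p (z i * q ^ y i * (z j * q ^ y j)))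
    * ∏ a ∈ Finset.univ.erase i, dFactor p q z f g h η X Y a (y a)) * hs

/-- The sum of `dTerm` over the simplex `|x| = k`. -/
def dSum (p q : ℂ) {n : ℕ} (z : Fin n → ℂ) (f g h η : ℂ) (k : ℕ) (X Y : ℂ) : ℂ :=
  ∑ x ∈ Finset.piAntidiag Finset.univ k, dTerm p q z f g h η X Y x

theorem mem_simplex {n k : ℕ} {x : Fin n → ℕ} :
    x ∈ Finset.piAntidiag (Finset.univ : Finset (Fin n)) k ↔ ∑ i, x i = k := by
  simp [Finset.mem_piAntidiag]

theorem le_of_mem_simplex {n k : ℕ} {x : Fin n → ℕ}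
    (h : x ∈ Finset.piAntidiag (Finset.univ : Finset (Fin n)) k) (i : Fin n) : x i ≤ k := by
  rw [← mem_simplex.1 h]
  exact Finset.single_le_sum (fun _ _ => Nat.zero_le _) (Finset.mem_univ i)

/-- Points of the larger simplex with `x i > 0` are uniquely `y` plus the `i`-th unit vector. The
others contribute nothing by `hG`. -/
theorem sum_simplex_succ {n : ℕ} (k : ℕ) (i : Fin n) (G : (Fin n → ℕ) → ℂ)
    (hG : ∀ x, x i = 0 → G x = 0) :
    ∑ x ∈ Finset.piAntidiag Finset.univ (k + 1), G x
      = ∑ y ∈ Finset.piAntidiag Finset.univ k, G (Function.update y i (y i + 1)) := by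
  symm
  refine Finset.sum_of_injOn (fun y => Function.update y i (y i + 1)) ?_ ?_ ?_ (fun _ _ => rfl)
  · intro y _ y' _ h
    ext j
    have := congrFun h j
    by_cases hj : j = i
    · subst hj; simpa using this
    · simpa [Function.update_of_ne hj] using this
  · intro y hy
    have hy := mem_simplex.1 (Finset.mem_coe.1 hy)
    refine Finset.mem_coe.2 (mem_simplex.2 ?_)
    rw [← hy, Finset.sum_update_of_mem (Finset.mem_univ i),
      ← Finset.add_sum_erase Finset.univ _ (Finset.mem_univ i), Finset.sdiff_singleton_eq_erase]
    ring
  · intro x hx hnot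
    refine hG x ?_
    by_contra h0
    refine hnot ⟨Function.update x i (x i - 1), ?_, ?_⟩
    · refine Finset.mem_coe.2 (mem_simplex.2 ?_)
      have hx := mem_simplex.1 hx
      rw [Finset.sum_update_of_mem (Finset.mem_univ i), Finset.sdiff_singleton_eq_erase]
      rw [← Finset.add_sum_erase Finset.univ _ (Finset.mem_univ i)] at hx
      omega
    · ext j
      by_cases hj : j = i
      · subst hj; simp; omega
      · simp [Function.update_of_ne hj]

/-! ### The contiguous relation -/

theorem ellTheta_inv_ne_zero {p : ℂ} (hp : ‖p‖ < 1) {u : ℂ} (hu : u ≠ 0) (h : ellTheta p u ≠ 0) :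
    ellTheta p u⁻¹ ≠ 0 := by
  rw [ellTheta_inv hp hu]
  exact neg_ne_zero.2 (mul_ne_zero (inv_ne_zero hu) h)

theorem prod_erase_eq_ite {ι : Type*} [Fintype ι] [DecidableEq ι] (i : ι) (f : ι → ℂ) :
    ∏ j ∈ Finset.univ.erase i, f j = ∏ j, if j = i then 1 else f j := by
  rw [← Finset.mul_prod_erase Finset.univ (fun j => if j = i then 1 else f j) (Finset.mem_univ i),
    if_pos rfl, one_mul]
  exact Finset.prod_congr rfl fun j hj => by rw [if_neg (Finset.ne_of_mem_erase hj)]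

/-- Partial fractions of type `A` with two distinguished points. -/
theorem sum_ellTheta_div_add_two {p : ℂ} (hp : ‖p‖ < 1) {n : ℕ} (v z : Fin n → ℂ) {α β s t : ℂ}
    (hv : ∀ i, v i ≠ 0) (hz : ∀ i, z i ≠ 0) (hα : α ≠ 0) (hβ : β ≠ 0) (hs : s ≠ 0) (ht : t ≠ 0)
    (hbal : s * t * ∏ i, z i = α * β * ∏ i, v i)
    (hvv : ∀ i j, i ≠ j → ellTheta p (v i / v j) ≠ 0)
    (hvα : ∀ i, ellTheta p (v i / α) ≠ 0) (hvβ : ∀ i, ellTheta p (v i / β) ≠ 0)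
    (hαβ : ellTheta p (α / β) ≠ 0) :
    (∑ i, (∏ j, ellTheta p (v i / z j)) / (∏ j ∈ Finset.univ.erase i, ellTheta p (v i / v j))
        * (ellTheta p (v i / s) * ellTheta p (v i / t)
          / (ellTheta p (v i / α) * ellTheta p (v i / β))))
      + ((∏ j, ellTheta p (α / z j)) / (∏ j, ellTheta p (α / v j))
        * (ellTheta p (α / s) * ellTheta p (α / t) / ellTheta p (α / β))
      + (∏ j, ellTheta p (β / z j)) / (∏ j, ellTheta p (β / v j))
        * (ellTheta p (β / s) * ellTheta p (β / t) / ellTheta p (β / α))) = 0 := by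
  -- The nodes are the `v i` together with `α` and `β`, and the numerator parameters are the `z i`
  -- together with `s` and `t`.
  let a : Fin n ⊕ Bool → ℂ := Sum.elim v (fun b => if b then α else β)
  have inv : ∀ x y : ℂ, x ≠ 0 → y ≠ 0 → ellTheta p (x / y) ≠ 0 → ellTheta p (y / x) ≠ 0 := by
    intro x y hx hy h
    rw [← inv_div]
    exact ellTheta_inv_ne_zero hp (div_ne_zero hx hy) h
  have h := sum_ellTheta_div_eq_zero hp a (n + 2) (s :: t :: List.ofFn z) Finset.univ (by simp)
    (by simp)
    (by rintro (i | b) _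
        · exact hv i
        · cases b
          · exact hβ
          · exact hα)
    (by
      intro b hb
      rcases List.mem_cons.1 hb with rfl | hb
      · exact hs
      rcases List.mem_cons.1 hb with rfl | hb
      · exact ht
      · obtain ⟨i, rfl⟩ := (List.mem_ofFn' z b).1 hb
        exact hz i)
    (by
      simp only [List.prod_cons, List.prod_ofFn, Fintype.prod_sum_type, a, Sum.elim_inl,
        Sum.elim_inr, Fintype.prod_bool, if_true, Bool.false_eq_true, if_false]
      linear_combination hbal)
    (by
      rintro (i | b) _ (j | b') _ hij
      · exact hvv i j fun h => hij (congrArg _ h)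
      · cases b'
        · exact hvβ i
        · exact hvα i
      · cases b
        · exact inv _ _ (hv j) hβ (hvβ j)
        · exact inv _ _ (hv j) hα (hvα j)
      · cases b <;> cases b'
        · exact absurd rfl hij
        · exact inv _ _ hα hβ hαβ
        · exact hαβ
        · exact absurd rfl hij)
  rw [← h]
  simp only [prod_erase_eq_ite, Fintype.sum_sum_type, Fintype.prod_sum_type, a, Sum.elim_inl,
        Sum.elim_inr, Fintype.prod_bool, Fintype.sum_bool, if_true, Bool.false_eq_true, if_false,
        List.map_cons, List.prod_cons, List.map_ofFn, List.prod_ofFn, Sum.inl.injEq, Sum.inr.injEq,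
        reduceCtorEq, Function.comp_apply, Bool.true_eq_false, one_mul, mul_one]
  congr 1
  · refine Finset.sum_congr rfl fun i _ => ?_
    rw [div_mul_div_comm]
    congr 1
    ring
  · rw [div_mul_div_comm, div_mul_div_comm]
    congr 2 <;> ring

theorem ellTheta_ratio_inv {p : ℂ} (hp : ‖p‖ < 1) {u v : ℂ} (hu : u ≠ 0) (hv : v ≠ 0) :
    ellTheta p u⁻¹ / ellTheta p v⁻¹ = v / u * (ellTheta p u / ellTheta p v) := by
  rw [ellTheta_inv hp hu, ellTheta_inv hp hv, neg_div_neg_eq, mul_div_mul_comm]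
  congr 1
  field_simp

theorem dFactor_shift_left {p q : ℂ} (hq : q ≠ 0) {n : ℕ} {z : Fin n → ℂ}
    {f g h η X Y : ℂ} (i : Fin n) (m : ℕ) (hX : ellTheta p (X * (z i * q ^ m) / q) ≠ 0) :
    dFactor p q z f g h η X Y i m
        * (ellTheta p (X * z i / q) / ellTheta p (X * (z i * q ^ m) / q))
      = dFactor p q z f g h η (X / q) Y i m := by
  have h1 := ellPoch_shift hq p (X * z i) m
  rw [show q ^ m * (X * z i) / q = X * (z i * q ^ m) / q by ring] at h1
  unfold dFactor
  rw [show X / q * z i = X * z i / q by ring]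
  rw [mul_div_assoc', div_eq_iff hX]
  linear_combination (ellPoch p q (f * z i) m * ellPoch p q (g * z i) m * ellPoch p q (h * z i) m
    * ellPoch p q (Y * z i) m / (ellPoch p q (η * z i) m * (z i ^ m * q ^ (m.choose 2))
      * ∏ j, ellPoch p q (q * (z i / z j)) m)) * h1

theorem dTerm_swap (p q : ℂ) {n : ℕ} (z : Fin n → ℂ) (f g h η X Y : ℂ) (x : Fin n → ℕ) :
    dTerm p q z f g h η X Y x = dTerm p q z f g h η Y X x := by
  unfold dTerm dFactor
  congr 1
  refine Finset.prod_congr rfl fun i _ => ?_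
  rw [mul_comm (ellPoch p q (X * z i) _)]

theorem dSum_swap (p q : ℂ) {n : ℕ} (z : Fin n → ℂ) (f g h η : ℂ) (k : ℕ) (X Y : ℂ) :
    dSum p q z f g h η k X Y = dSum p q z f g h η k Y X :=
  Finset.sum_congr rfl fun _ _ => dTerm_swap _ _ _ _ _ _ _ _ _ _

/-- Replacing `X` by `X/q` changes each one-variable factor by a quotient of two thetas. Inverting
their arguments gives the coefficient at the node `q/X` in the type `A` partial fractions, and one
factor `q^(x_i)` for each `i`. -/
theorem dTerm_shift_left {p q : ℂ} (hp : ‖p‖ < 1) (hq : q ≠ 0) {n k : ℕ} {z : Fin n → ℂ}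
    (hz : ∀ i, z i ≠ 0) {f g h η X Y : ℂ} (hX0 : X ≠ 0) {x : Fin n → ℕ} (hx : ∑ i, x i = k)
    (hX : ∀ i, ellTheta p (X * (z i * q ^ x i) / q) ≠ 0) :
    dTerm p q z f g h η X Y x
        * ((∏ j, ellTheta p (q / X / z j)) / ∏ j, ellTheta p (q / X / (z j * q ^ x j)))
      = q ^ k * dTerm p q z f g h η (X / q) Y x := by
  have h1 : (∏ j, ellTheta p (q / X / z j)) / ∏ j, ellTheta p (q / X / (z j * q ^ x j))
      = q ^ k * ∏ j, (ellTheta p (X * z j / q) / ellTheta p (X * (z j * q ^ x j) / q)) := by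
    rw [← hx, ← Finset.prod_pow_eq_pow_sum, ← Finset.prod_mul_distrib, ← Finset.prod_div_distrib]
    refine Finset.prod_congr rfl fun j _ => ?_
    have hzj := hz j
    have hpj := pow_ne_zero (x j) hq
    rw [show q / X / z j = (X * z j / q)⁻¹ by field_simp,
      show q / X / (z j * q ^ x j) = (X * (z j * q ^ x j) / q)⁻¹ by field_simp,
      ellTheta_ratio_inv hp (by simp [*]) (by simp [*])]
    congr 1
    field_simp
  rw [h1]
  unfold dTerm
  have h2 : ∏ i, dFactor p q z f g h η (X / q) Y i (x i)
      = (∏ i, dFactor p q z f g h η X Y i (x i))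
        * ∏ j, (ellTheta p (X * z j / q) / ellTheta p (X * (z j * q ^ x j) / q)) := by
    rw [← Finset.prod_mul_distrib]
    exact Finset.prod_congr rfl fun i _ => (dFactor_shift_left hq i (x i) (hX i)).symm
  rw [h2]
  ring

/-- A double sum of `G x i` over `|x| = k + 1` and `i` is evaluated in two ways. For fixed `i`, put
`x` equal to `y` plus the `i`-th unit vector; the sum over `i` is then a type `D` partial fraction
sum in the points `z_i q^(y_i)`. For fixed `x`, the sum over `i` is a type `A` sum lacking the two
nodes `q/X` and `q/Y`, whose contributions are the two terms on the right. -/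
theorem dSum_relation_generic {p q : ℂ} (hp : ‖p‖ < 1) (hq : q ≠ 0) {n k : ℕ} {z : Fin n → ℂ}
    (hz : IsGeneric p q z (k + 1)) {f g h t η X Y : ℂ}
    (hη : ∀ i, ellPoch p q (η * z i) (k + 1) ≠ 0) (hη0 : η ≠ 0)
    (hX0 : X ≠ 0) (hY0 : Y ≠ 0) (hbal : f * g * h * t * ((∏ i, z i) * q ^ k) ^ 2 = 1)
    (ht : t * η * q ^ (k + 1) = X * Y) (hXY : ellTheta p (X / Y) ≠ 0)
    (hX : ∀ i, ∀ m ≤ k + 1, ellTheta p (X * (z i * q ^ m) / q) ≠ 0)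
    (hY : ∀ i, ∀ m ≤ k + 1, ellTheta p (Y * (z i * q ^ m) / q) ≠ 0) :
    typeDValue p n f g h t ((∏ i, z i) * q ^ k) * dSum p q z f g h η k X Y
      = -q ^ (k + 1) * (ellTheta p (t / X) * ellTheta p (η / X) / ellTheta p (Y / X)
          * dSum p q z f g h η (k + 1) (X / q) Y
        + ellTheta p (t / Y) * ellTheta p (η / Y) / ellTheta p (X / Y)
          * dSum p q z f g h η (k + 1) X (Y / q)) := by
  have hz0 := hz.1
  have ht0 : t ≠ 0 := by rintro rfl; simp at hbal
  have hYX : ellTheta p (Y / X) ≠ 0 := by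
    rw [← inv_div]; exact ellTheta_inv_ne_zero hp (div_ne_zero hX0 hY0) hXY
  have hsep : ∀ (M : ℕ) (x : Fin n → ℕ), M ≤ k + 1 → (∀ i, x i ≤ M) → ∀ i j, i ≠ j →
      ellTheta p (z i * q ^ x i / (z j * q ^ x j)) ≠ 0 := by
    intro M x hM hx i j hij
    have := hz.2 i j ((x i : ℤ) - x j) (by have := hx i; have := hx j; omega) (Or.inl hij)
    rw [zpow_sub₀ hq, zpow_natCast, zpow_natCast] at this
    convert this using 2
    ring
  let G : (Fin n → ℕ) → Fin n → ℂ := fun x i => dTerm p q z f g h η X Y x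
    * ((∏ j, ellTheta p (z i * q ^ x i / z j))
        / (∏ j ∈ Finset.univ.erase i, ellTheta p (z i * q ^ x i / (z j * q ^ x j)))
      * (ellTheta p (z i * q ^ x i / (q / t)) * ellTheta p (z i * q ^ x i / (q / η))
          / (ellTheta p (z i * q ^ x i / (q / X)) * ellTheta p (z i * q ^ x i / (q / Y)))))
  have hstep : ∀ y ∈ Finset.piAntidiag (Finset.univ : Finset (Fin n)) k, ∀ i,
      G (Function.update y i (y i + 1)) i = dTerm p q z f g h η X Y y
        * (ellTheta p (f * (z i * q ^ y i)) * ellTheta p (g * (z i * q ^ y i))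
          * ellTheta p (h * (z i * q ^ y i)) * ellTheta p (t * (z i * q ^ y i)) / (z i * q ^ y i)
          * ∏ j ∈ Finset.univ.erase i, (ellTheta p (z i * q ^ y i * (z j * q ^ y j))
            / ellTheta p (z i * q ^ y i / (z j * q ^ y j)))) := by
    intro y hy i
    have hyk := le_of_mem_simplex hy
    have hu := dTerm_update hp hq hz (f := f) (g := g) (h := h) (X := X) (Y := Y) hη y
      (fun i => Nat.lt_succ_of_le (hyk i)) i
    have hn1 : ∏ j ∈ Finset.univ.erase i, ellTheta p (q * (z i * q ^ y i) / (z j * q ^ y j)) ≠ 0 := by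
      refine Finset.prod_ne_zero_iff.2 fun j hj => ?_
      have hji := Finset.ne_of_mem_erase hj
      have := hz.2 i j ((y i : ℤ) + 1 - y j) (by have := hyk i; have := hyk j; omega)
        (Or.inl hji.symm)
      rw [zpow_sub₀ hq, zpow_add₀ hq, zpow_natCast, zpow_natCast, zpow_one] at this
      convert this using 2
      ring
    have hX1 := hX i (y i + 1) (by have := hyk i; omega)
    have hY1 := hY i (y i + 1) (by have := hyk i; omega)
    have e1 : ∀ u : ℂ, u * (z i * q ^ (y i + 1)) / q = u * (z i * q ^ y i) := fun u => by
      rw [pow_succ]; field_simp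
    rw [e1] at hX1 hY1
    have e2 : ∀ u : ℂ, z i * q ^ (y i + 1) / (q / u) = u * (z i * q ^ y i) := fun u => by
      rw [← e1]; field_simp
    have e3 : z i * q ^ (y i + 1) = q * (z i * q ^ y i) := by rw [pow_succ]; ring
    have e4 : ∏ j ∈ Finset.univ.erase i, ellTheta p (z i * q ^ (y i + 1)
          / (z j * q ^ Function.update y i (y i + 1) j))
        = ∏ j ∈ Finset.univ.erase i, ellTheta p (q * (z i * q ^ y i) / (z j * q ^ y j)) :=
      Finset.prod_congr rfl fun j hj => by
        rw [Function.update_of_ne (Finset.ne_of_mem_erase hj), e3]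
    simp only [G, Function.update_self]
    rw [e4]
    simp only [e2]
    rw [e3]
    simp only [Finset.prod_div_distrib] at hu ⊢
    have aux : ∀ T' T P E Q S D fgh X₁ Y₁ w t₁ : ℂ, Q ≠ 0 → X₁ ≠ 0 → Y₁ ≠ 0 →
        T' * (P * E) = T * (Q / S * D) * (fgh * (X₁ * Y₁) / w) →
        T' * (P / Q * (t₁ * E / (X₁ * Y₁))) = T * (fgh * t₁ / w * (D / S)) := by
      intro T' T P E Q S D fgh X₁ Y₁ w t₁ hQ hX hY h
      have : T' * (P / Q * (t₁ * E / (X₁ * Y₁))) = T' * (P * E) * (t₁ / (Q * (X₁ * Y₁))) := by ring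
      rw [this, h]
      field_simp
    exact aux _ _ _ _ _ _ _ _ _ _ _ _ hn1 hX1 hY1 hu
  have hL : typeDValue p n f g h t ((∏ i, z i) * q ^ k) * dSum p q z f g h η k X Y
      = ∑ x ∈ Finset.piAntidiag Finset.univ (k + 1), ∑ i, G x i := by
    rw [Finset.sum_comm]
    have h1 : ∀ i, ∑ x ∈ Finset.piAntidiag Finset.univ (k + 1), G x i
        = ∑ y ∈ Finset.piAntidiag Finset.univ k, G (Function.update y i (y i + 1)) i := by
      intro i
      -- For `x i = 0` the factor `j = i` of the numerator is `θ(1) = 0`.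
      refine sum_simplex_succ k i (G · i) fun x hx => ?_
      have : ∏ j, ellTheta p (z i * q ^ x i / z j) = 0 :=
        Finset.prod_eq_zero (Finset.mem_univ i) (by
          rw [hx, pow_zero, mul_one, div_self (hz0 i), ellTheta_one hp])
      simp only [G, this, zero_div, zero_mul, mul_zero]
    simp only [h1]
    rw [Finset.sum_comm, dSum, Finset.mul_sum]
    refine Finset.sum_congr rfl fun y hy => ?_
    rw [Finset.sum_congr rfl fun i _ => hstep y hy i, ← Finset.mul_sum]
    have hprod : ∏ i, (z i * q ^ y i) = (∏ i, z i) * q ^ k := by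
      rw [Finset.prod_mul_distrib, Finset.prod_pow_eq_pow_sum, mem_simplex.1 hy]
    have := sum_ellTheta_typeD hp (fun i => z i * q ^ y i) n Finset.univ f g h t (by simp)
      (fun i _ => mul_ne_zero (hz0 i) (pow_ne_zero _ hq)) (by rw [hprod]; exact hbal)
      (fun i _ j _ hij => hsep k y (by omega) (le_of_mem_simplex hy) i j hij)
    rw [hprod] at this
    rw [← this]
    ring
  have hR : ∀ x ∈ Finset.piAntidiag (Finset.univ : Finset (Fin n)) (k + 1), ∑ i, G x i
      = -q ^ (k + 1) * (ellTheta p (t / X) * ellTheta p (η / X) / ellTheta p (Y / X)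
          * dTerm p q z f g h η (X / q) Y x
        + ellTheta p (t / Y) * ellTheta p (η / Y) / ellTheta p (X / Y)
          * dTerm p q z f g h η X (Y / q) x) := by
    intro x hx
    have hxs := mem_simplex.1 hx
    have hxk := le_of_mem_simplex hx
    have e1 : ∀ (u v : ℂ), v / (q / u) = u * v / q := fun u v => by rw [div_div_eq_mul_div]; ring
    have hpf := sum_ellTheta_div_add_two hp (fun i => z i * q ^ x i) z (α := q / X) (β := q / Y)
      (s := q / t) (t := q / η) (fun i => mul_ne_zero (hz0 i) (pow_ne_zero _ hq)) hz0
      (div_ne_zero hq hX0) (div_ne_zero hq hY0) (div_ne_zero hq ht0) (div_ne_zero hq hη0)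
      (by
        rw [Finset.prod_mul_distrib, Finset.prod_pow_eq_pow_sum, hxs]
        field_simp
        linear_combination (-∏ i, z i) * ht)
      (fun i j hij => hsep (k + 1) x le_rfl hxk i j hij)
      (fun i => by rw [e1]; exact hX i (x i) (hxk i))
      (fun i => by rw [e1]; exact hY i (x i) (hxk i))
      (by rwa [show q / X / (q / Y) = Y / X by field_simp])
    have sX := dTerm_shift_left hp hq hz0 (f := f) (g := g) (h := h) (η := η) (Y := Y) hX0 hxs
      (fun i => hX i (x i) (hxk i))
    have sY := dTerm_shift_left hp hq hz0 (f := f) (g := g) (h := h) (η := η) (Y := X) hY0 hxs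
      (fun i => hY i (x i) (hxk i))
    rw [dTerm_swap, dTerm_swap p q z f g h η (Y / q)] at sY
    simp only [G]
    rw [← Finset.mul_sum, eq_neg_of_add_eq_zero_left hpf,
      show q / X / (q / t) = t / X by field_simp, show q / X / (q / η) = η / X by field_simp,
      show q / X / (q / Y) = Y / X by field_simp, show q / Y / (q / X) = X / Y by field_simp,
      show q / Y / (q / t) = t / Y by field_simp, show q / Y / (q / η) = η / Y by field_simp]
    linear_combination (-(ellTheta p (t / X) * ellTheta p (η / X) / ellTheta p (Y / X))) * sX
      + (-(ellTheta p (t / Y) * ellTheta p (η / Y) / ellTheta p (X / Y))) * sY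
  rw [hL, Finset.sum_congr rfl hR, ← Finset.mul_sum, Finset.sum_add_distrib, ← Finset.mul_sum,
    ← Finset.mul_sum]
  rfl

theorem ContinuousAt.dSum {p q : ℂ} (hp : ‖p‖ < 1) (hq : q ≠ 0) {n : ℕ} {z : Fin n → ℂ}
    (hz : ∀ i, z i ≠ 0) (η : ℂ) (k : ℕ) {f g h X Y : ℂ → ℂ} {s : ℂ} (hf : ContinuousAt f s)
    (hf0 : f s ≠ 0) (hg : ContinuousAt g s) (hg0 : g s ≠ 0) (hh : ContinuousAt h s)
    (hh0 : h s ≠ 0) (hX : ContinuousAt X s) (hX0 : X s ≠ 0) (hY : ContinuousAt Y s)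
    (hY0 : Y s ≠ 0) :
    ContinuousAt (fun s => dSum p q z (f s) (g s) (h s) η k (X s) (Y s)) s := by
  unfold _root_.dSum dTerm dFactor
  refine tendsto_finsetSum _ fun x _ => ContinuousAt.mul continuousAt_const
    (tendsto_finsetProd _ fun i _ => ContinuousAt.div_const ?_ _)
  have key : ∀ {F : ℂ → ℂ}, ContinuousAt F s → F s ≠ 0 →
      ContinuousAt (fun s => _root_.ellPoch p q (F s * z i) (x i)) s := fun hF hF0 =>
    ContinuousAt.ellPoch hp hq (hF.mul continuousAt_const) (mul_ne_zero hF0 (hz i)) _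
  exact (((key hf hf0).mul (key hg hg0)).mul (key hh hh0)).mul ((key hX hX0).mul (key hY hY0))

theorem ContinuousAt.typeDValue {p : ℂ} (hp : ‖p‖ < 1) (n : ℕ) {b₁ b₂ b₃ b₄ : ℂ → ℂ} {Z s : ℂ}
    (hZ : Z ≠ 0) (h1 : ContinuousAt b₁ s) (h10 : b₁ s ≠ 0) (h2 : ContinuousAt b₂ s)
    (h20 : b₂ s ≠ 0) (h3 : ContinuousAt b₃ s) (h30 : b₃ s ≠ 0) (h4 : ContinuousAt b₄ s)
    (h40 : b₄ s ≠ 0) :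
    ContinuousAt (fun s => typeDValue p n (b₁ s) (b₂ s) (b₃ s) (b₄ s) Z) s := by
  unfold _root_.typeDValue
  have key : ∀ {F : ℂ → ℂ}, ContinuousAt F s → F s ≠ 0 →
      ContinuousAt (fun s => _root_.ellTheta p (F s * Z)) s := fun hF hF0 =>
    ContinuousAt.ellTheta hp (hF.mul continuousAt_const) (mul_ne_zero hF0 hZ)
  split_ifs
  · exact ((((key h1 h10).mul (key h2 h20)).mul (key h3 h30)).mul (key h4 h40)).div_const _
  · exact (((continuousAt_const.mul (key (h1.mul h2) (mul_ne_zero h10 h20))).mul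
      (key (h1.mul h3) (mul_ne_zero h10 h30))).mul (key (h1.mul h4) (mul_ne_zero h10 h40))).div
      (h1.mul continuousAt_const) (mul_ne_zero h10 hZ)

/-- The contiguous relation for `dSum`. -/
theorem dSum_relation {p q : ℂ} (hp : ‖p‖ < 1) (hq : q ≠ 0) {n k : ℕ} {z : Fin n → ℂ}
    (hz : IsGeneric p q z (k + 1)) {f g h t η X Y : ℂ}
    (hη : ∀ i, ellPoch p q (η * z i) (k + 1) ≠ 0) (hη0 : η ≠ 0)
    (hX0 : X ≠ 0) (hY0 : Y ≠ 0) (hbal : f * g * h * t * ((∏ i, z i) * q ^ k) ^ 2 = 1)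
    (ht : t * η * q ^ (k + 1) = X * Y) (hXY : ellTheta p (X / Y) ≠ 0) :
    typeDValue p n f g h t ((∏ i, z i) * q ^ k) * dSum p q z f g h η k X Y
      = -q ^ (k + 1) * (ellTheta p (t / X) * ellTheta p (η / X) / ellTheta p (Y / X)
          * dSum p q z f g h η (k + 1) (X / q) Y
        + ellTheta p (t / Y) * ellTheta p (η / Y) / ellTheta p (X / Y)
          * dSum p q z f g h η (k + 1) X (Y / q)) := by
  have hz0 := hz.1
  have hZ : (∏ i, z i) * q ^ k ≠ 0 :=
    mul_ne_zero (Finset.prod_ne_zero_iff.2 fun i _ => hz0 i) (pow_ne_zero _ hq)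
  have hf0 : f ≠ 0 := by rintro rfl; simp at hbal
  have hg0 : g ≠ 0 := by rintro rfl; simp at hbal
  have hh0 : h ≠ 0 := by rintro rfl; simp at hbal
  have ht0 : t ≠ 0 := by rintro rfl; simp at hbal
  -- Scaling `X, Y` by `s`, `t` by `s²` and `h` by `s⁻²` preserves both balancing conditions and
  -- `X/Y`, and avoids the zeros excluded in the generic version.
  let E : ℂ → ℂ := fun s =>
    typeDValue p n f g (h / s ^ 2) (t * s ^ 2) ((∏ i, z i) * q ^ k)
        * dSum p q z f g (h / s ^ 2) η k (X * s) (Y * s)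
      - -q ^ (k + 1) * (ellTheta p (t * s / X) * ellTheta p (η / (X * s)) / ellTheta p (Y / X)
          * dSum p q z f g (h / s ^ 2) η (k + 1) (X * s / q) (Y * s)
        + ellTheta p (t * s / Y) * ellTheta p (η / (Y * s)) / ellTheta p (X / Y)
          * dSum p q z f g (h / s ^ 2) η (k + 1) (X * s) (Y * s / q))
  have hE : E 1 = 0 := by
    have hc : ∀ c : ℂ, ContinuousAt (fun s : ℂ => c * s) 1 := fun c => by fun_prop
    have hc' : ∀ c : ℂ, ContinuousAt (fun s : ℂ => c * s / q) 1 := fun c => by fun_prop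
    have hcf : ∀ c : ℂ, ContinuousAt (fun _ : ℂ => c) 1 := fun c => continuousAt_const
    have hch : ContinuousAt (fun s : ℂ => h / s ^ 2) 1 :=
      continuousAt_const.div (by fun_prop) (by simp)
    have hct : ContinuousAt (fun s : ℂ => t * s ^ 2) 1 := by fun_prop
    have hth : ∀ c : ℂ, c ≠ 0 → ContinuousAt (fun s : ℂ => ellTheta p (t * s / c)) 1 := fun c hc =>
      ContinuousAt.ellTheta hp (by fun_prop) (by simp [ht0, hc])
    have hth2 : ∀ c : ℂ, c ≠ 0 → ContinuousAt (fun s : ℂ => ellTheta p (η / (c * s))) 1 :=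
      fun c hc => ContinuousAt.ellTheta hp (continuousAt_const.div (by fun_prop) (by simp [hc]))
        (by simp [hη0, hc])
    refine eq_zero_of_countable (E := E) (S := ⋃ i : Fin n, ⋃ m : ℕ,
        {s : ℂ | s ≠ 0 ∧ ellTheta p (X * (z i * q ^ m) / q * s) = 0}
          ∪ {s : ℂ | s ≠ 0 ∧ ellTheta p (Y * (z i * q ^ m) / q * s) = 0}) ?_ ?_ ?_
    · refine ContinuousAt.sub (ContinuousAt.mul ?_ ?_) (ContinuousAt.mul continuousAt_const
        (ContinuousAt.add (ContinuousAt.mul ?_ ?_) (ContinuousAt.mul ?_ ?_)))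
      · exact ContinuousAt.typeDValue hp n hZ (hcf f) hf0 (hcf g) hg0 hch (by simpa) hct (by simpa)
      · exact ContinuousAt.dSum hp hq hz0 η k (hcf f) hf0 (hcf g) hg0 hch (by simpa) (hc X)
          (by simpa) (hc Y) (by simpa)
      · exact ((hth X hX0).mul (hth2 X hX0)).div_const _
      · exact ContinuousAt.dSum hp hq hz0 η _ (hcf f) hf0 (hcf g) hg0 hch (by simpa) (hc' X)
          (by simp [hX0, hq]) (hc Y) (by simpa)
      · exact ((hth Y hY0).mul (hth2 Y hY0)).div_const _
      · exact ContinuousAt.dSum hp hq hz0 η _ (hcf f) hf0 (hcf g) hg0 hch (by simpa) (hc X)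
          (by simpa) (hc' Y) (by simp [hY0, hq])
    · refine Set.countable_iUnion fun i => Set.countable_iUnion fun m => ?_
      have : z i * q ^ m ≠ 0 := mul_ne_zero (hz0 i) (pow_ne_zero _ hq)
      exact (countable_ellTheta_const_mul hp (div_ne_zero (mul_ne_zero hX0 this) hq)).union
        (countable_ellTheta_const_mul hp (div_ne_zero (mul_ne_zero hY0 this) hq))
    · intro s hs hgen
      simp only [Set.mem_iUnion, not_exists, Set.mem_union, Set.mem_ofPred_eq, not_or, not_and] at hgen
      have h1 := dSum_relation_generic hp hq hz (f := f) (g := g) (h := h / s ^ 2) (t := t * s ^ 2)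
        (X := X * s) (Y := Y * s) hη hη0 (mul_ne_zero hX0 hs) (mul_ne_zero hY0 hs)
        (by rw [← hbal]; field_simp) (by linear_combination s ^ 2 * ht)
        (by rwa [mul_div_mul_right _ _ hs])
        (fun i m _ h0 => (hgen i m).1 hs (by rw [← h0]; congr 1; ring))
        (fun i m _ h0 => (hgen i m).2 hs (by rw [← h0]; congr 1; ring))
      rw [mul_div_mul_right _ _ hs, mul_div_mul_right _ _ hs,
        show t * s ^ 2 / (X * s) = t * s / X by field_simp,
        show t * s ^ 2 / (Y * s) = t * s / Y by field_simp] at h1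
      exact sub_eq_zero.2 h1
  have := sub_eq_zero.1 hE
  simpa using this

/-! ### Binary forms and their zeros -/

/-- Binary forms of degree `m` in two functions `a, b`. -/
def binaryForms {τ : Type*} (a b : τ → ℂ) (m : ℕ) : Submodule ℂ (τ → ℂ) :=
  Submodule.span ℂ (Set.range fun i : Fin (m + 1) => a ^ (i : ℕ) * b ^ (m - i))

theorem pow_mul_pow_mem_binaryForms {τ : Type*} (a b : τ → ℂ) {i j m : ℕ} (h : i + j = m) :
    a ^ i * b ^ j ∈ binaryForms a b m :=
  Submodule.subset_span ⟨⟨i, by omega⟩, by simp [← h]⟩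

theorem mul_mem_binaryForms {τ : Type*} {a b f g : τ → ℂ} {m l : ℕ} (hf : f ∈ binaryForms a b m)
    (hg : g ∈ binaryForms a b l) : f * g ∈ binaryForms a b (m + l) := by
  have h := Submodule.mul_mem_mul hf hg
  rw [binaryForms, binaryForms, Submodule.span_mul_span] at h
  refine Submodule.span_le.2 ?_ h
  rintro _ ⟨_, ⟨i, rfl⟩, _, ⟨j, rfl⟩, rfl⟩
  have : a ^ (i : ℕ) * b ^ (m - i) * (a ^ (j : ℕ) * b ^ (l - j))
      = a ^ ((i : ℕ) + j) * b ^ ((m - i) + (l - j)) := by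
    rw [pow_add, pow_add]; ring
  simp only [this]
  exact pow_mul_pow_mem_binaryForms a b (by omega)

theorem prod_mem_binaryForms {τ ι : Type*} {a b : τ → ℂ} (s : Finset ι) (f : ι → τ → ℂ)
    (m : ι → ℕ) (h : ∀ i ∈ s, f i ∈ binaryForms a b (m i)) :
    ∏ i ∈ s, f i ∈ binaryForms a b (∑ i ∈ s, m i) := by
  classical
  induction s using Finset.induction_on with
  | empty => simpa using pow_mul_pow_mem_binaryForms a b (i := 0) (j := 0) rfl
  | insert i s hi ih =>
    rw [Finset.prod_insert hi, Finset.sum_insert hi]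
    exact mul_mem_binaryForms (h i (by simp)) (ih fun j hj => h j (by simp [hj]))

/-- A binary form of degree `m` with `m + 1` different zeros vanishes. -/
theorem eq_zero_of_mem_binaryForms {τ : Type*} {a b f : τ → ℂ} {m : ℕ}
    (hf : f ∈ binaryForms a b m) (P : Fin (m + 1) → τ)
    (hP : ∀ i j, i < j → a (P j) * b (P i) - a (P i) * b (P j) ≠ 0) (h0 : ∀ i, f (P i) = 0) :
    f = 0 := by
  obtain ⟨c, rfl⟩ := (Submodule.mem_span_range_iff_exists_fun ℂ).1 hf
  have hc : c = 0 := by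
    -- The coefficient vector is in the kernel of a projective Vandermonde matrix, whose determinant
    -- is the product of the `2 × 2` minors in `hP`.
    refine Matrix.eq_zero_of_mulVec_eq_zero
      (M := Matrix.projVandermonde (fun i => a (P i)) (fun i => b (P i))) ?_ ?_
    · rw [Matrix.det_projVandermonde]
      exact Finset.prod_ne_zero_iff.2 fun i _ => Finset.prod_ne_zero_iff.2 fun j hj =>
        hP i j (Finset.mem_Ioi.1 hj)
    · ext i
      have := h0 i
      simp only [Finset.sum_apply, Pi.smul_apply, Pi.mul_apply, Pi.pow_apply, smul_eq_mul] at this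
      rw [Matrix.mulVec, dotProduct, Pi.zero_apply, ← this]
      refine Finset.sum_congr rfl fun j _ => ?_
      rw [Matrix.projVandermonde_apply, mul_comm]
      congr 3
      rw [Fin.val_rev]
      omega
  simp [hc]

/-- The functions `X ↦ θ(uX) θ(uρ/X)` are linear forms in two functions which separate the points
`X` up to `X ↦ ρ/X`. -/
theorem exists_linear_forms {p : ℂ} (hp : ‖p‖ < 1) {ρ : ℂ} (hρ : ρ ≠ 0) :
    ∃ a b : ℂˣ → ℂ,
      (∀ u : ℂ, u ≠ 0 → (fun X : ℂˣ => ellTheta p (u * X) * ellTheta p (u * (ρ / X)))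
        ∈ binaryForms a b 1) ∧
      ∀ X Y : ℂˣ, ellTheta p (X / Y) ≠ 0 → ellTheta p (X * Y / ρ) ≠ 0 →
        a X * b Y - a Y * b X ≠ 0 := by
  obtain ⟨A, B, K, hK, hdet⟩ := exists_ellTheta_det hp
  obtain ⟨γ, rfl⟩ : ∃ γ : ℂ, ρ = γ ^ 2 := by
    obtain ⟨γ, h⟩ := IsAlgClosed.exists_pow_nat_eq ρ (n := 2) two_pos
    exact ⟨γ, h.symm⟩
  have hγ : γ ≠ 0 := by rintro rfl; simp at hρ
  refine ⟨fun X => A (X / γ), fun X => B (X / γ), fun u hu => ?_, fun X Y h1 h2 h => ?_⟩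
  · have : (fun X : ℂˣ => ellTheta p (u * X) * ellTheta p (u * (γ ^ 2 / X)))
        = (u * γ / K * A (u * γ)) • (fun X : ℂˣ => B (X / γ))
          + (-(u * γ / K * B (u * γ))) • (fun X : ℂˣ => A (X / γ)) := by
      funext X
      have := hdet (u * γ) (X / γ) (mul_ne_zero hu hγ) (div_ne_zero X.ne_zero hγ)
      rw [show u * γ * (X / γ) = u * X by field_simp,
        show u * γ / (X / γ) = u * (γ ^ 2 / X) by field_simp] at this
      simp only [Pi.add_apply, Pi.smul_apply, smul_eq_mul]
      apply mul_left_cancel₀ hK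
      rw [this]
      field_simp
      ring
    rw [this]
    refine Submodule.add_mem _ (Submodule.smul_mem _ _ ?_) (Submodule.smul_mem _ _ ?_)
    · simpa using pow_mul_pow_mem_binaryForms (fun X : ℂˣ => A (X / γ))
        (fun X : ℂˣ => B (X / γ)) (i := 0) (j := 1) rfl
    · simpa using pow_mul_pow_mem_binaryForms (fun X : ℂˣ => A (X / γ))
        (fun X : ℂˣ => B (X / γ)) (i := 1) (j := 0) rfl
  · have := hdet (X / γ) (Y / γ) (div_ne_zero X.ne_zero hγ) (div_ne_zero Y.ne_zero hγ)
    have hY := Y.ne_zero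
    rw [show (X : ℂ) / γ * (Y / γ) = X * Y / γ ^ 2 by field_simp,
      show (X : ℂ) / γ / (Y / γ) = X / Y by field_simp,
      show A (X / γ) * B (Y / γ) - B (X / γ) * A (Y / γ) = 0 by linear_combination h] at this
    rw [mul_zero] at this
    exact mul_ne_zero hK (mul_ne_zero h2 h1) this

theorem ellPoch_mul_mem_binaryForms {p q : ℂ} (hq : q ≠ 0) {ρ : ℂ} {a b : ℂˣ → ℂ}
    (hab : ∀ u : ℂ, u ≠ 0 → (fun X : ℂˣ => ellTheta p (u * X) * ellTheta p (u * (ρ / X)))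
        ∈ binaryForms a b 1) {u : ℂ} (hu : u ≠ 0) (m : ℕ) :
    (fun X : ℂˣ => ellPoch p q (u * X) m * ellPoch p q (u * (ρ / X)) m) ∈ binaryForms a b m := by
  have h := prod_mem_binaryForms (a := a) (b := b) (Finset.range m)
    (fun l X => ellTheta p (q ^ l * u * X) * ellTheta p (q ^ l * u * (ρ / X))) (fun _ => 1)
    (fun l _ => hab _ (mul_ne_zero (pow_ne_zero _ hq) hu))
  simp only [Finset.sum_const, Finset.card_range, smul_eq_mul, mul_one] at h
  convert h using 1
  funext X
  simp only [Finset.prod_apply, ellPoch, ← Finset.prod_mul_distrib, mul_assoc]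

/-- For each `x`, the dependence on `X` is a product over `i` of `x_i` pairs `θ(uX) θ(uρ/X)`, each a
linear form, so the degree is `|x| = k`. -/
theorem dSum_mem_binaryForms {p q : ℂ} (hq : q ≠ 0) {ρ : ℂ} {a b : ℂˣ → ℂ}
    (hab : ∀ u : ℂ, u ≠ 0 → (fun X : ℂˣ => ellTheta p (u * X) * ellTheta p (u * (ρ / X)))
        ∈ binaryForms a b 1) {n : ℕ} {z : Fin n → ℂ} (hz : ∀ i, z i ≠ 0) (f g h η : ℂ) (k : ℕ) :
    (fun X : ℂˣ => dSum p q z f g h η k X (ρ / X)) ∈ binaryForms a b k := by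
  have : (fun X : ℂˣ => dSum p q z f g h η k X (ρ / X))
      = ∑ x ∈ Finset.piAntidiag (Finset.univ : Finset (Fin n)) k,
        (deltaRatio p q z x * (∏ i, ∏ j ∈ Finset.Ioi i, ellPoch p q (z i * z j) (x i + x j))
        * ∏ i, (ellPoch p q (f * z i) (x i) * ellPoch p q (g * z i) (x i)
          * ellPoch p q (h * z i) (x i) / (ellPoch p q (η * z i) (x i)
            * (z i ^ (x i) * q ^ ((x i).choose 2)) * ∏ j, ellPoch p q (q * (z i / z j)) (x i))))
        • ∏ i, (fun X : ℂˣ => ellPoch p q (z i * X) (x i) * ellPoch p q (z i * (ρ / X)) (x i)) := by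
    funext X
    simp only [dSum, dTerm, dFactor, Finset.sum_apply, Pi.smul_apply, smul_eq_mul,
      Finset.prod_apply]
    refine Finset.sum_congr rfl fun x _ => ?_
    rw [mul_assoc (deltaRatio p q z x * _) (∏ i, _) (∏ i, _), ← Finset.prod_mul_distrib]
    congr 1
    refine Finset.prod_congr rfl fun i _ => ?_
    rw [mul_comm (X : ℂ), mul_comm (ρ / (X : ℂ))]
    ring
  rw [this]
  refine Submodule.sum_mem _ fun x hx => Submodule.smul_mem _ _ ?_
  rw [← mem_simplex.1 hx]
  exact prod_mem_binaryForms _ _ _ fun i _ => ellPoch_mul_mem_binaryForms hq hab (hz i) (x i)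

/-! ### Three-term relation and recurrences for the expansion -/

/-- The three-term relation. -/
theorem ellTheta_three_term {p : ℂ} (hp : ‖p‖ < 1) {X Y r s u v : ℂ} (hX : X ≠ 0) (hY : Y ≠ 0)
    (hs : s ≠ 0) (hu : u ≠ 0) (hv : v ≠ 0) (hr : u * v * s = r) :
    ellTheta p (Y * u) * ellTheta p (Y * s) * (ellTheta p (v / X) * ellTheta p (X * r))
      - Y / X * (ellTheta p (X * u) * ellTheta p (X * s) * (ellTheta p (v / Y) * ellTheta p (Y * r)))
      = ellTheta p (Y / X) * ellTheta p (u * v) * ellTheta p (v * s)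
        * ellTheta p (X * Y * r / v) := by
  obtain ⟨A, B, K, hK, hdet⟩ := exists_ellTheta_det hp
  -- With `γ² = us`, all six theta pairs are determinants formed from the four points `Yγ`, `Xγ`,
  -- `u/γ`, `1/(vγ)`.
  obtain ⟨γ, hγ⟩ := IsAlgClosed.exists_pow_nat_eq (u * s) (n := 2) two_pos
  have hγ0 : γ ≠ 0 := by
    rintro rfl
    exact mul_ne_zero hu hs (by rw [← hγ]; simp)
  have hs' : s = γ ^ 2 / u := by rw [hγ]; field_simp
  subst hs'
  have hr' : r = v * γ ^ 2 := by rw [← hr]; field_simp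
  subst hr'
  have e1 := hdet (Y * γ) (u / γ) (mul_ne_zero hY hγ0) (div_ne_zero hu hγ0)
  have e2 := hdet (X * γ) (1 / (v * γ)) (mul_ne_zero hX hγ0)
    (one_div_ne_zero (mul_ne_zero hv hγ0))
  have e3 := hdet (X * γ) (u / γ) (mul_ne_zero hX hγ0) (div_ne_zero hu hγ0)
  have e4 := hdet (Y * γ) (1 / (v * γ)) (mul_ne_zero hY hγ0)
    (one_div_ne_zero (mul_ne_zero hv hγ0))
  have e5 := hdet (Y * γ) (X * γ) (mul_ne_zero hY hγ0) (mul_ne_zero hX hγ0)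
  have e6 := hdet (u / γ) (1 / (v * γ)) (div_ne_zero hu hγ0)
    (one_div_ne_zero (mul_ne_zero hv hγ0))
  rw [show Y * γ * (u / γ) = Y * u by field_simp,
    show Y * γ / (u / γ) = Y * (γ ^ 2 / u) by field_simp] at e1
  rw [show X * γ * (1 / (v * γ)) = X / v by field_simp,
    show X * γ / (1 / (v * γ)) = X * (v * γ ^ 2) by field_simp] at e2
  rw [show X * γ * (u / γ) = X * u by field_simp,
    show X * γ / (u / γ) = X * (γ ^ 2 / u) by field_simp] at e3
  rw [show Y * γ * (1 / (v * γ)) = Y / v by field_simp,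
    show Y * γ / (1 / (v * γ)) = Y * (v * γ ^ 2) by field_simp] at e4
  rw [show Y * γ * (X * γ) = X * Y * (v * γ ^ 2) / v by field_simp,
    show Y * γ / (X * γ) = Y / X by field_simp] at e5
  rw [show u / γ * (1 / (v * γ)) = (v * (γ ^ 2 / u))⁻¹ by field_simp,
    show u / γ / (1 / (v * γ)) = u * v by field_simp,
    ellTheta_inv hp (mul_ne_zero hv hs)] at e6
  rw [show v / X = (X / v)⁻¹ by rw [inv_div], show v / Y = (Y / v)⁻¹ by rw [inv_div],
    ellTheta_inv hp (div_ne_zero hX hv), ellTheta_inv hp (div_ne_zero hY hv)]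
  generalize ellTheta p (Y * u) = t1 at *
  generalize ellTheta p (Y * (γ ^ 2 / u)) = t2 at *
  generalize ellTheta p (X / v) = t3 at *
  generalize ellTheta p (X * (v * γ ^ 2)) = t4 at *
  generalize ellTheta p (X * u) = t5 at *
  generalize ellTheta p (X * (γ ^ 2 / u)) = t6 at *
  generalize ellTheta p (Y / v) = t7 at *
  generalize ellTheta p (Y * (v * γ ^ 2)) = t8 at *
  generalize ellTheta p (X * Y * (v * γ ^ 2) / v) = t9 at *
  generalize ellTheta p (Y / X) = t10 at *
  generalize ellTheta p (v * (γ ^ 2 / u)) = t11 at *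
  generalize ellTheta p (u * v) = t12 at *
  generalize A (Y * γ) = a1 at *
  generalize B (Y * γ) = b1 at *
  generalize A (X * γ) = a2 at *
  generalize B (X * γ) = b2 at *
  generalize A (u / γ) = a3 at *
  generalize B (u / γ) = b3 at *
  generalize A (1 / (v * γ)) = a4 at *
  generalize B (1 / (v * γ)) = b4 at *
  -- The Plücker relation for four vectors in the plane; the remaining steps collect the monomials
  -- from inversions.
  have f1 : (K * (t1 * t2)) * (K * (t3 * t4)) - (K * (t5 * t6)) * (K * (t7 * t8))
      = X * γ / (u / γ) * ((K * (t9 * t10)) * (K * (-((v * (γ ^ 2 / u))⁻¹ * t11) * t12))) := by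
    rw [e1, e2, e3, e4, e5, e6]
    field_simp
    ring
  have f2 : t1 * t2 * (t3 * t4) - t5 * t6 * (t7 * t8)
      = X * γ / (u / γ) * (t9 * t10 * (-((v * (γ ^ 2 / u))⁻¹ * t11) * t12)) := by
    apply mul_left_cancel₀ (mul_ne_zero hK hK)
    linear_combination f1
  have f3 : X * γ / (u / γ) * (v * (γ ^ 2 / u))⁻¹ = X / v := by field_simp
  have f4 : Y / X * (Y / v)⁻¹ = v / X := by field_simp
  have f5 : (X / v)⁻¹ = v / X := inv_div _ _
  have f6 : v / X * (X / v) = 1 := by field_simp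
  rw [f5]
  linear_combination (-(v / X)) * f2 + (t9 * t10 * t11 * t12 * (v / X)) * f3
    + (t5 * t6 * t7 * t8) * f4 + (t9 * t10 * t11 * t12) * f6

theorem ellPoch_succ' (p q u : ℂ) (m : ℕ) :
    ellPoch p q u (m + 1) = ellTheta p u * ellPoch p q (u * q) m := by
  rw [add_comm, ellPoch_add]
  simp [ellPoch]

theorem ellPoch_one {p : ℂ} (hp : ‖p‖ < 1) (q : ℂ) {m : ℕ} (hm : 0 < m) : ellPoch p q 1 m = 0 := by
  obtain ⟨m, rfl⟩ := Nat.exists_eq_succ_of_ne_zero hm.ne'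
  rw [Nat.succ_eq_add_one, ellPoch_succ', ellTheta_one hp, zero_mul]

/-- The value of the type `D` partial fraction sum with one parameter eliminated. -/
def stepValue (p q : ℂ) (n : ℕ) (f g h Z : ℂ) (m : ℕ) : ℂ :=
  typeDValue p n f g h (1 / (f * g * h * (Z * q ^ m) ^ 2)) (Z * q ^ m)

/-- The coefficients in the expansion `dSum_connection`. -/
def connCoeff (p q : ℂ) (n : ℕ) (f g h Z lam : ℂ) (k j : ℕ) : ℂ :=
  (∏ m ∈ Finset.Ico j k, -(lam * q ^ (m + 1) * stepValue p q n f g h Z m))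
    / (ellPoch p q (lam * q ^ j) j * ellPoch p q q (k - j) * ellPoch p q (lam * q ^ (2 * j + 1)) (k - j))

/-- Going from `k` to `k + 1` adds one step value to the product and one factor to each of the two
shifted factorials depending on `k`. This is the recurrence that `connSum_relation` assumes of `C`
and `C'`. -/
theorem connCoeff_succ {p q : ℂ} (n : ℕ) (f g h Z lam : ℂ) {k j : ℕ} (hj : j ≤ k)
    (h1 : ellTheta p (q ^ (k - j + 1)) ≠ 0) (h2 : ellTheta p (lam * q ^ (k + j + 1)) ≠ 0) :
    connCoeff p q n f g h Z lam (k + 1) j * (ellTheta p (q ^ (k - j + 1))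
        * ellTheta p (lam * q ^ (k + j + 1)))
      = -(lam * q ^ (k + 1) * stepValue p q n f g h Z k) * connCoeff p q n f g h Z lam k j := by
  unfold connCoeff
  rw [Finset.prod_Ico_succ_top hj, show k + 1 - j = k - j + 1 by omega, ellPoch_succ, ellPoch_succ,
    show q ^ (k - j) * q = q ^ (k - j + 1) by rw [pow_succ],
    show q ^ (k - j) * (lam * q ^ (2 * j + 1)) = lam * q ^ (k + j + 1) by
      rw [show k + j + 1 = (k - j) + (2 * j + 1) by omega, pow_add]; ring]
  have aux : ∀ P s A B C x y : ℂ, x ≠ 0 → y ≠ 0 →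
      P * s / (A * (B * x) * (C * y)) * (x * y) = s * (P / (A * B * C)) := by
    intro P s A B C x y hx hy
    rw [div_mul_eq_mul_div, mul_div_assoc', ← mul_div_mul_right _ (A * B * C) (mul_ne_zero hx hy)]
    congr 1 <;> ring
  exact aux _ _ _ _ _ _ _ h1 h2

/-- The right-hand side of `dSum_connection`. -/
def connSum (p q η σ : ℂ) (C G : ℕ → ℂ) (k : ℕ) (X Y : ℂ) : ℂ :=
  ∑ j ∈ Finset.range (k + 1), C j * G j * ((ellPoch p q (η / X) j * ellPoch p q (η / Y) j)
    * (ellPoch p q (σ * X) (k - j) * ellPoch p q (σ * Y) (k - j)))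

/-- For each `j ≤ k` the relation reduces to the three-term theta relation together with the
recurrence `hC`. The terms `j = k + 1`, present only on the right, cancel each other. The form
matches the contiguous relation for the type `D` sum. -/
theorem connSum_relation {p q : ℂ} (hp : ‖p‖ < 1) (hq : q ≠ 0) {η σ lam t X Y : ℂ} {k : ℕ}
    {C C' : ℕ → ℂ} (G : ℕ → ℂ) {V : ℂ} (hη : η ≠ 0) (hσ : σ ≠ 0) (hlam : lam ≠ 0) (hX : X ≠ 0)
    (hY : Y ≠ 0) (hXYη : X * Y * (σ * lam * q ^ k) = η) (ht : t * η * q ^ (k + 1) = X * Y)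
    (hC : ∀ j ≤ k, C' j * (ellTheta p (q ^ (k - j + 1)) * ellTheta p (lam * q ^ (k + j + 1)))
      = -(lam * q ^ (k + 1) * V) * C j) (hXY : ellTheta p (X / Y) ≠ 0) :
    V * ellTheta p (η * σ * q ^ k) * connSum p q η σ C G k X Y
      = -q ^ (k + 1) * (ellTheta p (t / X) * ellTheta p (η / X) / ellTheta p (Y / X)
          * connSum p q η σ C' G (k + 1) (X / q) Y
        + ellTheta p (t / Y) * ellTheta p (η / Y) / ellTheta p (X / Y)
          * connSum p q η σ C' G (k + 1) X (Y / q)) := by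
  have hYX : ellTheta p (Y / X) ≠ 0 := by
    rw [← inv_div]; exact ellTheta_inv_ne_zero hp (div_ne_zero hX hY) hXY
  have hqk := pow_ne_zero (k + 1) hq
  have et1 : t / X = Y * (1 / (η * q ^ (k + 1))) := by
    field_simp; linear_combination ht
  have et2 : t / Y = X * (1 / (η * q ^ (k + 1))) := by
    field_simp; linear_combination ht
  have exy : ellTheta p (X / Y) = -(X / Y * ellTheta p (Y / X)) := by
    rw [← inv_div, ellTheta_inv hp (div_ne_zero hY hX), inv_div]
  have ht0 : t ≠ 0 := by
    rintro rfl; exact mul_ne_zero hX hY (by rw [← ht]; ring)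
  unfold connSum
  rw [Finset.sum_range_succ _ (k + 1), Finset.sum_range_succ _ (k + 1), mul_add (_ / _),
    mul_add (_ / _)]
  -- For `j = k + 1` the condition `ht` makes `q^(k+1) η/X` the inverse of `t/Y`, and likewise with
  -- `X` and `Y` exchanged; the two products then agree up to sign.
  have hlast : ∀ c : ℂ, ellTheta p (t / X) * ellTheta p (η / X) / ellTheta p (Y / X)
        * (c * ((ellPoch p q (η / (X / q)) (k + 1) * ellPoch p q (η / Y) (k + 1))
          * (ellPoch p q (σ * (X / q)) (k + 1 - (k + 1)) * ellPoch p q (σ * Y) (k + 1 - (k + 1)))))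
      + ellTheta p (t / Y) * ellTheta p (η / Y) / ellTheta p (X / Y)
        * (c * ((ellPoch p q (η / X) (k + 1) * ellPoch p q (η / (Y / q)) (k + 1))
          * (ellPoch p q (σ * X) (k + 1 - (k + 1)) * ellPoch p q (σ * (Y / q)) (k + 1 - (k + 1)))))
      = 0 := by
    intro c
    simp only [Nat.sub_self, ellPoch_zero, mul_one]
    have p1 : ∀ u : ℂ, u ≠ 0 → ellTheta p (η / u) * ellPoch p q (η / (u / q)) (k + 1)
        = ellPoch p q (η / u) (k + 1) * ellTheta p (q ^ (k + 1) * (η / u)) := fun u hu => by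
      rw [← ellPoch_succ, ellPoch_succ' p q (η / u), div_div_eq_mul_div, div_mul_eq_mul_div]
    have p2 : ellTheta p (q ^ (k + 1) * (η / X)) = -(Y / t * ellTheta p (t / Y)) := by
      rw [show q ^ (k + 1) * (η / X) = (t / Y)⁻¹ by field_simp; linear_combination ht,
        ellTheta_inv hp (div_ne_zero ht0 hY), inv_div]
    have p3 : ellTheta p (q ^ (k + 1) * (η / Y)) = -(X / t * ellTheta p (t / X)) := by
      rw [show q ^ (k + 1) * (η / Y) = (t / X)⁻¹ by field_simp; linear_combination ht,
        ellTheta_inv hp (div_ne_zero ht0 hX), inv_div]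
    have q1 := p1 X hX
    have q2 := p1 Y hY
    rw [p2] at q1
    rw [p3] at q2
    rw [exy]
    generalize ellTheta p (Y / X) = D at *
    generalize ellPoch p q (η / (X / q)) (k + 1) = a1 at *
    generalize ellPoch p q (η / (Y / q)) (k + 1) = a2 at *
    generalize ellPoch p q (η / X) (k + 1) = a3 at *
    generalize ellPoch p q (η / Y) (k + 1) = a4 at *
    generalize ellTheta p (t / X) = s1 at *
    generalize ellTheta p (t / Y) = s2 at *
    generalize ellTheta p (η / X) = s3 at *
    generalize ellTheta p (η / Y) = s4 at *
    have e1 : s1 * s3 / D * (c * (a1 * a4)) = s1 / D * c * a4 * (s3 * a1) := by ring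
    have e2 : s2 * s4 / -(X / Y * D) * (c * (a3 * a2)) = -(s2 * (Y / X) / D * c * a3 * (s4 * a2)) := by
      field_simp
    rw [e1, e2, q1, q2]
    field_simp
    ring
  have hterm : ∀ j ∈ Finset.range (k + 1), V * ellTheta p (η * σ * q ^ k)
        * (C j * G j * ((ellPoch p q (η / X) j * ellPoch p q (η / Y) j)
          * (ellPoch p q (σ * X) (k - j) * ellPoch p q (σ * Y) (k - j))))
      = -q ^ (k + 1) * (ellTheta p (t / X) * ellTheta p (η / X) / ellTheta p (Y / X)
          * (C' j * G j * ((ellPoch p q (η / (X / q)) j * ellPoch p q (η / Y) j)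
          * (ellPoch p q (σ * (X / q)) (k + 1 - j) * ellPoch p q (σ * Y) (k + 1 - j))))
        + ellTheta p (t / Y) * ellTheta p (η / Y) / ellTheta p (X / Y)
          * (C' j * G j * ((ellPoch p q (η / X) j * ellPoch p q (η / (Y / q)) j)
          * (ellPoch p q (σ * X) (k + 1 - j) * ellPoch p q (σ * (Y / q)) (k + 1 - j))))) := by
    intro j hj
    have hjk : j ≤ k := Nat.lt_succ_iff.1 (Finset.mem_range.1 hj)
    obtain ⟨l, rfl⟩ := Nat.exists_eq_add_of_le hjk
    have hCj := hC j hjk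
    rw [show j + l + 1 - j = l + 1 by omega, show j + l - j = l by omega] at *
    have p1 : ∀ u : ℂ, ellTheta p (η / u) * ellPoch p q (η / (u / q)) j
        = ellPoch p q (η / u) j * ellTheta p (η * q ^ j / u) := fun u => by
      rw [show η * q ^ j / u = q ^ j * (η / u) by ring, ← ellPoch_succ, ellPoch_succ',
        div_div_eq_mul_div, div_mul_eq_mul_div]
    have p2 : ∀ u : ℂ, ellPoch p q (σ * (u / q)) (l + 1)
        = ellTheta p (u * (σ / q)) * ellPoch p q (σ * u) l := fun u => by
      rw [ellPoch_succ', show σ * (u / q) * q = σ * u by field_simp]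
      congr 2; ring
    have p3 : ∀ u : ℂ, ellPoch p q (σ * u) (l + 1)
        = ellPoch p q (σ * u) l * ellTheta p (u * (σ * q ^ l)) := fun u => by
      rw [ellPoch_succ]; congr 2; ring
    -- The parameters are chosen so that `θ(Xu) = θ(t/Y)`, `θ(Yu) = θ(t/X)`, and the other factors
    -- are the ones by which the shifted factorials grow.
    have tt := ellTheta_three_term hp (X := X) (Y := Y) (r := σ / q) (s := σ * q ^ l)
      (u := 1 / (η * q ^ (j + l + 1))) (v := η * q ^ j) hX hY (mul_ne_zero hσ (pow_ne_zero _ hq))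
      (one_div_ne_zero (mul_ne_zero hη hqk)) (mul_ne_zero hη (pow_ne_zero _ hq))
      (by rw [pow_succ, pow_add]; field_simp)
    rw [show 1 / (η * q ^ (j + l + 1)) * (η * q ^ j) = (q ^ (l + 1))⁻¹ by
        rw [pow_succ, pow_add, pow_succ]; field_simp,
      show X * Y * (σ / q) / (η * q ^ j) = (lam * q ^ (j + l + j + 1))⁻¹ by
        have hq1 := pow_ne_zero j hq
        have hq2 := pow_ne_zero l hq
        rw [← hXYη]
        field_simp
        ring,
      show η * q ^ j * (σ * q ^ l) = η * σ * q ^ (j + l) by rw [pow_add]; ring,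
      ellTheta_inv hp (pow_ne_zero _ hq),
      ellTheta_inv hp (mul_ne_zero hlam (pow_ne_zero _ hq)), ← et1, ← et2] at tt
    rw [p2, p2, p3, p3, exy]
    have p1X := p1 X
    have p1Y := p1 Y
    generalize ellTheta p (Y / X) = D at *
    generalize ellPoch p q (η / (X / q)) j = a1 at *
    generalize ellPoch p q (η / (Y / q)) j = a2 at *
    generalize ellPoch p q (η / X) j = a3 at *
    generalize ellPoch p q (η / Y) j = a4 at *
    generalize ellTheta p (t / X) = s1 at *
    generalize ellTheta p (t / Y) = s2 at *
    generalize ellTheta p (η / X) = s3 at *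
    generalize ellTheta p (η / Y) = s4 at *
    generalize ellPoch p q (σ * X) l = b1 at *
    generalize ellPoch p q (σ * Y) l = b2 at *
    generalize ellTheta p (X * (σ / q)) = c1 at *
    generalize ellTheta p (Y * (σ / q)) = c2 at *
    generalize ellTheta p (X * (σ * q ^ l)) = c3 at *
    generalize ellTheta p (Y * (σ * q ^ l)) = c4 at *
    generalize ellTheta p (η * q ^ j / X) = d1 at *
    generalize ellTheta p (η * q ^ j / Y) = d2 at *
    generalize ellTheta p (η * σ * q ^ (j + l)) = w at *
    generalize ellTheta p (q ^ (l + 1)) = w1 at *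
    generalize ellTheta p (lam * q ^ (j + l + j + 1)) = w2 at *
    have e1 : s1 * s3 / D * (C' j * G j * (a1 * a4 * (c1 * b1 * (b2 * c4))))
          + s2 * s4 / -(X / Y * D) * (C' j * G j * (a3 * a2 * (b1 * c3 * (c2 * b2))))
        = C' j * G j * (b1 * b2) / D * (s1 * c4 * c1 * a4 * (s3 * a1)
          - Y / X * (s2 * c3 * c2 * a3 * (s4 * a2))) := by
      field_simp
      ring
    rw [e1, p1X, p1Y]
    have e2 : s1 * c4 * c1 * a4 * (a3 * d1) - Y / X * (s2 * c3 * c2 * a3 * (a4 * d2))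
        = a3 * a4 * (D * -((q ^ (l + 1))⁻¹ * w1) * w * -((lam * q ^ (j + l + j + 1))⁻¹ * w2)) := by
      rw [← tt]; ring
    rw [e2]
    have e3 : C' j * G j * (b1 * b2) / D
          * (a3 * a4 * (D * -((q ^ (l + 1))⁻¹ * w1) * w * -((lam * q ^ (j + l + j + 1))⁻¹ * w2)))
        = (C' j * (w1 * w2)) * (G j * (b1 * b2) * (a3 * a4) * w
          * ((q ^ (l + 1))⁻¹ * (lam * q ^ (j + l + j + 1))⁻¹)) := by
      field_simp
    rw [e3, hCj]
    have e4 : q ^ (j + l + 1) * (lam * q ^ (j + l + 1)) * ((q ^ (l + 1))⁻¹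
        * (lam * q ^ (j + l + j + 1))⁻¹) = 1 := by
      have h1 := pow_ne_zero (l + 1) hq
      have h2 := pow_ne_zero (j + l + j + 1) hq
      have : q ^ (j + l + 1) * q ^ (j + l + 1) = q ^ (l + 1) * q ^ (j + l + j + 1) := by
        rw [← pow_add, ← pow_add]; congr 1; omega
      field_simp
      linear_combination this
    linear_combination (-(V * C j * G j * (b1 * b2) * (a3 * a4) * w)) * e4
  rw [Finset.mul_sum, Finset.sum_congr rfl hterm, ← Finset.mul_sum, Finset.sum_add_distrib,
    ← Finset.mul_sum, ← Finset.mul_sum]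
  have := hlast (C' (k + 1) * G (k + 1))
  linear_combination q ^ (k + 1) * this

theorem connSum_mem_binaryForms {p q : ℂ} (hq : q ≠ 0) {ρ : ℂ} {a b : ℂˣ → ℂ} (hρ : ρ ≠ 0)
    (hab : ∀ u : ℂ, u ≠ 0 → (fun X : ℂˣ => ellTheta p (u * X) * ellTheta p (u * (ρ / X)))
        ∈ binaryForms a b 1) {η σ : ℂ} (hη : η ≠ 0) (hσ : σ ≠ 0) (C G : ℕ → ℂ) (k : ℕ) :
    (fun X : ℂˣ => connSum p q η σ C G k X (ρ / X)) ∈ binaryForms a b k := by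
  have : (fun X : ℂˣ => connSum p q η σ C G k X (ρ / X)) = ∑ j ∈ Finset.range (k + 1),
      (C j * G j) • ((fun X : ℂˣ => ellPoch p q (η / ρ * X) j * ellPoch p q (η / ρ * (ρ / X)) j)
        * fun X : ℂˣ => ellPoch p q (σ * X) (k - j) * ellPoch p q (σ * (ρ / X)) (k - j)) := by
    funext X
    have hX := X.ne_zero
    simp only [connSum, Finset.sum_apply, Pi.smul_apply, Pi.mul_apply, smul_eq_mul]
    refine Finset.sum_congr rfl fun j _ => ?_
    rw [show η / ρ * X = η / (ρ / X) by field_simp, show η / ρ * (ρ / X) = η / X by field_simp]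
    ring
  rw [this]
  refine Submodule.sum_mem _ fun j hj => Submodule.smul_mem _ _ ?_
  have hj : j ≤ k := Nat.lt_succ_iff.1 (Finset.mem_range.1 hj)
  have := mul_mem_binaryForms (ellPoch_mul_mem_binaryForms hq hab (div_ne_zero hη hρ) j)
    (ellPoch_mul_mem_binaryForms hq hab hσ (k - j))
  rwa [Nat.add_sub_cancel' hj] at this

/-! ### The connection formula -/

/-- Induction on `k`. On `XY = ρ` the difference `F` of the two sides at level `k + 1` is a binary
form of degree `k + 1`, and it is shown to vanish at the `k + 2` points `σρq^m`. The first zero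
holds by the choice of coefficients. The contiguous relations, combined with level `k`, carry a zero
from each point to the next. -/
theorem dSum_connection_generic {p q : ℂ} (hp : ‖p‖ < 1) (hq : q ≠ 0) {n N : ℕ} {z : Fin n → ℂ}
    (hz : IsGeneric p q z N) {f g h η σ lam : ℂ} (hη0 : η ≠ 0)
    (hη : ∀ i, ellPoch p q (η * z i) N ≠ 0) (hqN : ellPoch p q q N ≠ 0)
    (hσ : σ * lam * q = f * g * h * (∏ i, z i) ^ 2) (hσ0 : σ * lam ≠ 0)
    (hlam : ∀ m, 1 ≤ m → m ≤ 2 * N → ellTheta p (lam * q ^ m) ≠ 0)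
    (hg1 : ∀ l : ℤ, ellTheta p (η * q ^ l * σ) ≠ 0)
    (hg2 : ∀ l : ℤ, ellTheta p (η / lam * q ^ l * σ) ≠ 0) (k : ℕ) (hk : k ≤ N) :
    ∀ X Y : ℂ, X ≠ 0 → Y ≠ 0 → X * Y * (σ * lam * q ^ k) = η →
      ellPoch p q (η * σ) k * dSum p q z f g h η k X Y
        = connSum p q η σ (connCoeff p q n f g h (∏ i, z i) lam k)
          (fun j => dSum p q z f g h η j (η / (lam * q ^ j)) (1 / σ)) k X Y := by
  have hσ1 : σ ≠ 0 := left_ne_zero_of_mul hσ0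
  have hlam0 : lam ≠ 0 := right_ne_zero_of_mul hσ0
  have hz0 := hz.1
  set Z := ∏ i, z i with hZdef
  have hfghZ : f * g * h * Z ^ 2 ≠ 0 := by rw [← hσ]; exact mul_ne_zero hσ0 hq
  have hfgh : f * g * h ≠ 0 := left_ne_zero_of_mul hfghZ
  have hZ : Z ≠ 0 := Finset.prod_ne_zero_iff.2 fun i _ => hz0 i
  have hq' : ∀ m, 1 ≤ m → m ≤ N → ellTheta p (q ^ m) ≠ 0 := by
    intro m h1 h2
    have := ellPoch_ne_zero_iff.1 hqN (m - 1) (by omega)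
    rwa [← pow_succ, Nat.sub_add_cancel h1] at this
  induction k with
  | zero =>
    intro X Y _ _ _
    simp [connSum, connCoeff, ellPoch_zero, dSum, dTerm, dFactor]
  | succ k ih =>
    intro X Y hX hY hXY
    have ih := ih (by omega)
    set G : ℕ → ℂ := fun j => dSum p q z f g h η j (η / (lam * q ^ j)) (1 / σ) with hG
    set C := connCoeff p q n f g h Z lam (k + 1) with hCdef
    obtain ⟨ρ, hρ⟩ : ∃ ρ, ρ = η / (σ * lam * q ^ (k + 1)) := ⟨_, rfl⟩
    have hqk := fun m : ℕ => pow_ne_zero m hq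
    have hρ0 : ρ ≠ 0 := by rw [hρ]; exact div_ne_zero hη0 (mul_ne_zero hσ0 (hqk _))
    obtain ⟨a, b, hab, hsep⟩ := exists_linear_forms hp hρ0
    let F : ℂˣ → ℂ := fun X => ellPoch p q (η * σ) (k + 1) * dSum p q z f g h η (k + 1) X (ρ / X)
      - connSum p q η σ C G (k + 1) X (ρ / X)
    have hF : F ∈ binaryForms a b (k + 1) := by
      have h1 := Submodule.smul_mem _ (ellPoch p q (η * σ) (k + 1))
        (dSum_mem_binaryForms hq hab hz0 f g h η (k + 1))
      exact Submodule.sub_mem _ h1 (connSum_mem_binaryForms hq hρ0 hab hη0 hσ1 C G (k + 1))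
    have hPne : ∀ m : ℕ, σ * ρ * q ^ m ≠ 0 := fun m => mul_ne_zero (mul_ne_zero hσ1 hρ0) (hqk m)
    let P : ℕ → ℂˣ := fun m => Units.mk0 (σ * ρ * q ^ m) (hPne m)
    have hPv : ∀ m, ((P m : ℂˣ) : ℂ) = σ * ρ * q ^ m := fun m => rfl
    have hzero : ∀ m ≤ k + 1, F (P m) = 0 := by
      intro m
      induction m with
      | zero =>
        intro _
        simp only [F, hPv, pow_zero, mul_one]
        -- At `m = 0` one has `σY = 1`, so `(σY)_{k+1-j} = 0` unless `j = k + 1`. Since `σρ =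
        -- η/(λq^(k+1))`, the surviving term contains the sum on the left.
        rw [show ρ / (σ * ρ) = 1 / σ by field_simp, connSum, Finset.sum_range_succ,
          Finset.sum_eq_zero, zero_add]
        · have hl : ellPoch p q (lam * q ^ (k + 1)) (k + 1) ≠ 0 :=
            ellPoch_ne_zero_iff.2 fun l hl => by
              have := hlam (l + (k + 1)) (by omega) (by omega)
              rw [pow_add] at this
              convert this using 2; ring
          have e1 : σ * ρ = η / (lam * q ^ (k + 1)) := by
            rw [hρ]; have := hqk (k + 1); field_simp
          have e2 : η / (η / (lam * q ^ (k + 1))) = lam * q ^ (k + 1) := by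
            field_simp
          rw [e1, e2]
          simp only [hCdef, connCoeff, Finset.Ico_self, Finset.prod_empty, Nat.sub_self,
            ellPoch_zero, mul_one, hG, div_div_eq_mul_div, div_one]
          field_simp
          ring
        · intro j hj
          have hj := Finset.mem_range.1 hj
          rw [show σ * (1 / σ) = 1 by field_simp, ellPoch_one hp q (by omega : 0 < k + 1 - j)]
          ring
      | succ m ihm =>
        intro hm
        have h0 := ihm (by omega)
        have hX0 : σ * ρ * q ^ (m + 1) ≠ 0 := hPne _
        have hY0 : 1 / (σ * q ^ m) ≠ 0 := one_div_ne_zero (mul_ne_zero hσ1 (hqk m))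
        -- Here `XY = ρq`, the constraint of level `k`. Lowering `X` by `q` gives the point `P m`,
        -- and lowering `Y` gives `P (m + 1)`.
        obtain ⟨X, hXd⟩ : ∃ X, X = σ * ρ * q ^ (m + 1) := ⟨_, rfl⟩
        obtain ⟨Y, hYd⟩ : ∃ Y, Y = 1 / (σ * q ^ m) := ⟨_, rfl⟩
        rw [← hXd] at hX0
        rw [← hYd] at hY0
        have hXYρ : X * Y = ρ * q := by
          rw [hXd, hYd, pow_succ]; have := hqk m; field_simp
        have hXYη : X * Y * (σ * lam * q ^ k) = η := by
          rw [hXYρ, hρ, pow_succ]; have := hqk k; field_simp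
        obtain ⟨t, htd⟩ : ∃ t, t = 1 / (f * g * h * (Z * q ^ k) ^ 2) := ⟨_, rfl⟩
        have hbal : f * g * h * t * (Z * q ^ k) ^ 2 = 1 := by
          rw [htd]
          have : (f * g * h * (Z * q ^ k) ^ 2) ≠ 0 :=
            mul_ne_zero hfgh (pow_ne_zero _ (mul_ne_zero hZ (hqk k)))
          rw [mul_right_comm, mul_one_div, div_self this]
        have ht : t * η * q ^ (k + 1) = X * Y := by
          rw [← hXYη, htd, show (f * g * h * (Z * q ^ k) ^ 2) = σ * lam * q * q ^ k * q ^ k by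
            rw [hσ]; ring, pow_succ]
          have := hqk k
          field_simp
        have eXY : X / Y = η / lam * q ^ ((2 * m : ℤ) - k) * σ := by
          rw [hXd, hYd, hρ, zpow_sub₀ hq, pow_succ, pow_succ, two_mul, zpow_add₀ hq, zpow_natCast,
            zpow_natCast]
          have := hqk k; have := hqk m
          field_simp
        have hXYne : ellTheta p (X / Y) ≠ 0 := by rw [eXY]; exact hg2 _
        have r1 := dSum_relation hp hq (hz.mono hk) (f := f) (g := g) (h := h) (t := t)
          (fun i => ellPoch_ne_zero_mono (hη i) hk) hη0 hX0 hY0 hbal ht hXYne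
        have r2 := connSum_relation hp hq (C := connCoeff p q n f g h Z lam k) (C' := C)
          G (V := typeDValue p n f g h t (Z * q ^ k)) hη0 hσ1 hlam0 hX0 hY0 hXYη ht
          (by
            intro j hj
            have := connCoeff_succ (p := p) (q := q) n f g h Z lam hj
              (hq' _ (by omega) (by omega)) (hlam _ (by omega) (by omega))
            rw [stepValue, ← htd] at this
            exact this) hXYne
        rw [← ih X Y hX0 hY0 hXYη] at r2
        have hXq : X / q = P m := by rw [hPv, hXd, pow_succ]; field_simp
        have hYq : Y = ρ / P m := by rw [hPv, hYd]; have := hqk m; field_simp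
        have hX1 : X = P (m + 1) := by rw [hPv, hXd]
        have hY1 : Y / q = ρ / P (m + 1) := by
          rw [hPv, hYd, pow_succ]; have := hqk m; field_simp
        have hs : ellPoch p q (η * σ) (k + 1)
            = ellPoch p q (η * σ) k * ellTheta p (η * σ * q ^ k) := by
          rw [ellPoch_succ]; congr 2; ring
        have comb : ellTheta p (t / X) * ellTheta p (η / X) / ellTheta p (Y / X) * F (P m)
            + ellTheta p (t / Y) * ellTheta p (η / Y) / ellTheta p (X / Y) * F (P (m + 1)) = 0 := by
          simp only [F]
          rw [← hY1, ← hX1, ← hYq, ← hXq, hs]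
          apply mul_left_cancel₀ (neg_ne_zero.2 (hqk (k + 1)))
          linear_combination r2 - ellPoch p q (η * σ) k * ellTheta p (η * σ * q ^ k) * r1
        rw [h0, mul_zero, zero_add] at comb
        -- The coefficient of `F (P (m + 1))` is non-zero: up to inversion its numerator is
        -- `θ(λq^(2k+1-m)) θ(ησq^m)`.
        refine (mul_eq_zero.1 comb).resolve_left (div_ne_zero (mul_ne_zero ?_ ?_) hXYne)
        · have e : t / Y = (lam * q ^ (2 * k + 1 - m))⁻¹ := by
            have e1 : t / Y = X / (η * q ^ (k + 1)) := by
              have := hqk (k + 1)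
              field_simp; linear_combination ht
            have e2 : q ^ (2 * k + 1 - m) * q ^ (m + 1) = q ^ (k + 1) * q ^ (k + 1) := by
              rw [← pow_add, ← pow_add]; congr 1; omega
            rw [e1, hXd, hρ]
            have := hqk (k + 1); have := hqk (2 * k + 1 - m); have := hqk (m + 1)
            field_simp
            linear_combination e2
          rw [e]
          exact ellTheta_inv_ne_zero hp (mul_ne_zero hlam0 (hqk _)) (hlam _ (by omega) (by omega))
        · have := hg1 m
          rw [zpow_natCast] at this
          rw [hYd]
          convert this using 2
          field_simp
    have hF0 : F = 0 := by
      refine eq_zero_of_mem_binaryForms hF (fun i => P i) ?_ fun i => hzero i (by omega)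
      intro i j hij
      refine hsep (P j) (P i) ?_ ?_
      · have e : ((P j : ℂˣ) : ℂ) / (P i : ℂˣ) = q ^ ((j : ℕ) - (i : ℕ)) := by
          rw [hPv, hPv, pow_sub₀ q hq (by exact_mod_cast hij.le)]
          have := hqk i
          field_simp
        rw [e]
        have : (i : ℕ) < j := hij
        exact hq' _ (by omega) (by omega)
      · have e : ((P j : ℂˣ) : ℂ) * (P i : ℂˣ) / ρ
            = η / lam * q ^ ((j : ℤ) + i - (k + 1)) * σ := by
          rw [hPv, hPv, zpow_sub₀ hq, zpow_add₀ hq]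
          rw [show ((k : ℤ) + 1) = ((k + 1 : ℕ) : ℤ) by push_cast; rfl]
          simp only [zpow_natCast]
          have e1 : σ * ρ * q ^ (j : ℕ) * (σ * ρ * q ^ (i : ℕ)) / ρ
              = σ * σ * ρ * q ^ (j : ℕ) * q ^ (i : ℕ) := by field_simp
          rw [e1, hρ]
          have := hqk (k + 1)
          field_simp
        rw [e]
        exact hg2 _
    have hfin := congrFun hF0 (Units.mk0 X hX)
    have eY : ρ / X = Y := by
      rw [hρ, ← hXY]
      have := hqk (k + 1)
      field_simp
    simp only [F, Units.val_mk0, eY, Pi.zero_apply] at hfin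
    exact sub_eq_zero.1 hfin

theorem ContinuousAt.connCoeff {p q : ℂ} (hp : ‖p‖ < 1) (hq : q ≠ 0) (n : ℕ) {f g h : ℂ → ℂ}
    {Z s : ℂ} (hZ : Z ≠ 0) (hf : ContinuousAt f s) (hf0 : f s ≠ 0) (hg : ContinuousAt g s)
    (hg0 : g s ≠ 0) (hh : ContinuousAt h s) (hh0 : h s ≠ 0) (lam : ℂ) (k j : ℕ) :
    ContinuousAt (fun s => connCoeff p q n (f s) (g s) (h s) Z lam k j) s := by
  unfold _root_.connCoeff stepValue
  refine ContinuousAt.div_const (tendsto_finsetProd _ fun m _ =>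
    (continuousAt_const.mul ?_).neg) _
  have hZm : Z * q ^ m ≠ 0 := mul_ne_zero hZ (pow_ne_zero _ hq)
  have h0 : f s * g s * h s * (Z * q ^ m) ^ 2 ≠ 0 :=
    mul_ne_zero (mul_ne_zero (mul_ne_zero hf0 hg0) hh0) (pow_ne_zero _ hZm)
  exact ContinuousAt.typeDValue hp n hZm hf hf0 hg hg0 hh hh0
    (continuousAt_const.div (((hf.mul hg).mul hh).mul continuousAt_const) h0)
    (one_div_ne_zero h0)

theorem ContinuousAt.connSum {p q : ℂ} (hp : ‖p‖ < 1) (hq : q ≠ 0) {η s : ℂ} (hη : η ≠ 0)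
    {C G : ℂ → ℕ → ℂ} (k : ℕ) {σ X Y : ℂ → ℂ} (hC : ∀ j, ContinuousAt (fun s => C s j) s)
    (hG : ∀ j, ContinuousAt (fun s => G s j) s) (hσ : ContinuousAt σ s) (hσ0 : σ s ≠ 0)
    (hX : ContinuousAt X s) (hX0 : X s ≠ 0) (hY : ContinuousAt Y s) (hY0 : Y s ≠ 0) :
    ContinuousAt (fun s => connSum p q η (σ s) (C s) (G s) k (X s) (Y s)) s := by
  unfold _root_.connSum
  refine tendsto_finsetSum _ fun j _ => ((hC j).mul (hG j)).mul (ContinuousAt.mul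
    (ContinuousAt.mul ?_ ?_) (ContinuousAt.mul ?_ ?_))
  · exact ContinuousAt.ellPoch hp hq (continuousAt_const.div hX hX0) (div_ne_zero hη hX0) _
  · exact ContinuousAt.ellPoch hp hq (continuousAt_const.div hY hY0) (div_ne_zero hη hY0) _
  · exact ContinuousAt.ellPoch hp hq (hσ.mul hX) (mul_ne_zero hσ0 hX0) _
  · exact ContinuousAt.ellPoch hp hq (hσ.mul hY) (mul_ne_zero hσ0 hY0) _

/-- Expansion of the sum over `|x| = k` in `X`, with coefficients its values at special points. -/
theorem dSum_connection {p q : ℂ} (hp : ‖p‖ < 1) (hq : q ≠ 0) {n N : ℕ} {z : Fin n → ℂ}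
    (hz : IsGeneric p q z N) {f g h η σ lam : ℂ} (hη0 : η ≠ 0)
    (hη : ∀ i, ellPoch p q (η * z i) N ≠ 0) (hqN : ellPoch p q q N ≠ 0)
    (hσ : σ * lam * q = f * g * h * (∏ i, z i) ^ 2) (hσ0 : σ * lam ≠ 0)
    (hlam : ∀ m, 1 ≤ m → m ≤ 2 * N → ellTheta p (lam * q ^ m) ≠ 0) {k : ℕ} (hk : k ≤ N)
    {X Y : ℂ} (hX : X ≠ 0) (hY : Y ≠ 0) (hXY : X * Y * (σ * lam * q ^ k) = η) :
    ellPoch p q (η * σ) k * dSum p q z f g h η k X Y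
      = connSum p q η σ (connCoeff p q n f g h (∏ i, z i) lam k)
        (fun j => dSum p q z f g h η j (η / (lam * q ^ j)) (1 / σ)) k X Y := by
  have hσ1 : σ ≠ 0 := left_ne_zero_of_mul hσ0
  have hlam0 : lam ≠ 0 := right_ne_zero_of_mul hσ0
  have hz0 := hz.1
  have hfghZ : f * g * h * (∏ i, z i) ^ 2 ≠ 0 := by rw [← hσ]; exact mul_ne_zero hσ0 hq
  have hfgh : f * g * h ≠ 0 := left_ne_zero_of_mul hfghZ
  have hh : h ≠ 0 := right_ne_zero_of_mul hfgh
  have hf : f ≠ 0 := left_ne_zero_of_mul (left_ne_zero_of_mul hfgh)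
  have hg : g ≠ 0 := right_ne_zero_of_mul (left_ne_zero_of_mul hfgh)
  have hZ : (∏ i, z i) ≠ 0 := Finset.prod_ne_zero_iff.2 fun i _ => hz0 i
  -- Scaling `σ` and `h` by `s` and `X` by `1/s` preserves the constraints and moves `ησ` and `ησ/λ`
  -- away from the excluded values.
  let E : ℂ → ℂ := fun s => ellPoch p q (η * (σ * s)) k
      * dSum p q z f g (h * s) η k (X / s) Y
    - connSum p q η (σ * s) (connCoeff p q n f g (h * s) (∏ i, z i) lam k)
        (fun j => dSum p q z f g (h * s) η j (η / (lam * q ^ j)) (1 / (σ * s))) k (X / s) Y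
  have hid : ContinuousAt (fun s : ℂ => s) 1 := continuousAt_id
  have c1 : ∀ c : ℂ, ContinuousAt (fun s : ℂ => c * s) 1 := fun c => continuousAt_const.mul hid
  have c2 : ContinuousAt (fun s : ℂ => X / s) 1 := continuousAt_const.div hid one_ne_zero
  have c3 : ContinuousAt (fun s : ℂ => 1 / (σ * s)) 1 :=
    continuousAt_const.div (c1 σ) (by simpa using hσ1)
  have hE : ContinuousAt E 1 := by
    refine ContinuousAt.sub (ContinuousAt.mul ?_ ?_) ?_
    · exact ContinuousAt.ellPoch hp hq (continuousAt_const.mul (c1 σ))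
        (by simpa using mul_ne_zero hη0 hσ1) _
    · exact ContinuousAt.dSum hp hq hz0 η k continuousAt_const hf continuousAt_const hg (c1 h)
        (by simpa using hh) c2 (by simpa using hX) continuousAt_const hY
    · refine ContinuousAt.connSum hp hq hη0 k (fun j => ?_) (fun j => ?_) (c1 σ)
        (by simpa using hσ1) c2 (by simpa using hX) continuousAt_const hY
      · exact ContinuousAt.connCoeff hp hq n hZ continuousAt_const hf continuousAt_const hg (c1 h)
          (by simpa using hh) lam k j
      · exact ContinuousAt.dSum hp hq hz0 η j continuousAt_const hf continuousAt_const hg (c1 h)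
          (by simpa using hh) continuousAt_const
          (div_ne_zero hη0 (mul_ne_zero hlam0 (pow_ne_zero _ hq))) c3 (by simpa using hσ1)
  have hS : (⋃ l : ℤ, ({s : ℂ | s ≠ 0 ∧ ellTheta p (η * q ^ l * σ * s) = 0}
      ∪ {s : ℂ | s ≠ 0 ∧ ellTheta p (η / lam * q ^ l * σ * s) = 0})).Countable :=
    Set.countable_iUnion fun l => (countable_ellTheta_const_mul hp
      (mul_ne_zero (mul_ne_zero hη0 (zpow_ne_zero _ hq)) hσ1)).union
      (countable_ellTheta_const_mul hp
        (mul_ne_zero (mul_ne_zero (div_ne_zero hη0 hlam0) (zpow_ne_zero _ hq)) hσ1))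
  have h1 := eq_zero_of_countable hE hS fun s hs hsS => by
    have hsS := fun l : ℤ => not_or.1 (fun h => hsS (Set.mem_iUnion.2 ⟨l, h⟩))
    have := dSum_connection_generic hp hq hz (f := f) (g := g) (h := h * s) (σ := σ * s) hη0 hη hqN
      (by linear_combination s * hσ) (by
        rw [mul_right_comm]; exact mul_ne_zero hσ0 hs) hlam
      (fun l h => (hsS l).1 ⟨hs, by rw [← h]; congr 1; ring⟩)
      (fun l h => (hsS l).2 ⟨hs, by rw [← h]; congr 1; ring⟩) k hk (X / s) Y (div_ne_zero hX hs) hY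
      (by rw [← hXY]; field_simp)
    exact sub_eq_zero.2 this
  simpa [E, sub_eq_zero] using h1

/-! ### Reversal of shifted factorials and the elliptic Jackson sum -/

/-- Apply `θ(v) = -v θ(1/v)` to every factor; the inverted arguments, read backwards, form the
progression starting at `q^(1-j)/w`. -/
theorem ellPoch_reverse {p q : ℂ} (hp : ‖p‖ < 1) (hq : q ≠ 0) {w : ℂ} (hw : w ≠ 0) (j : ℕ) :
    ellPoch p q w j = (-w) ^ j * q ^ (j.choose 2) * ellPoch p q (q / (w * q ^ j)) j := by
  induction j with
  | zero => simp [ellPoch_zero]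
  | succ j ih =>
    have hqj := pow_ne_zero j hq
    rw [ellPoch_succ, ih, ellPoch_succ', Nat.choose_succ_succ' j 1, Nat.choose_one_right,
      show q / (w * q ^ (j + 1)) = (q ^ j * w)⁻¹ by rw [pow_succ]; field_simp,
      ellTheta_inv hp (mul_ne_zero hqj hw),
      show (q ^ j * w)⁻¹ * q = q / (w * q ^ j) by field_simp, pow_add, pow_succ (-w)]
    field_simp
    ring

theorem ellPoch_sub {p q : ℂ} (hp : ‖p‖ < 1) (hq : q ≠ 0) {u : ℂ} (hu : u ≠ 0) {k j : ℕ}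
    (hj : j ≤ k) :
    ellPoch p q u k = ellPoch p q u (k - j)
      * ((-(u * q ^ (k - j))) ^ j * q ^ (j.choose 2) * ellPoch p q (q / (u * q ^ k)) j) := by
  obtain ⟨l, rfl⟩ := Nat.exists_eq_add_of_le' hj
  rw [Nat.add_sub_cancel, ellPoch_add, ellPoch_reverse hp hq (mul_ne_zero hu (pow_ne_zero l hq)),
    mul_assoc u, ← pow_add]

/-- Jackson's sum does not contain `f`, `g`, `h`. They are needed to apply the connection formula
and must be cancelled afterwards, so they are chosen off countably many values. -/
theorem exists_triple_ellPoch_ne_zero {p q : ℂ} (hp : ‖p‖ < 1) (hq : q ≠ 0) {c : ℂ} (hc : c ≠ 0)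
    (N : ℕ) : ∃ f g h : ℂ, f * g * h = c ∧ ellPoch p q f N ≠ 0 ∧ ellPoch p q g N ≠ 0
      ∧ ellPoch p q h N ≠ 0 := by
  have hex : ∀ S : Set ℂ, S.Countable → ∃ s, s ≠ 0 ∧ s ∉ S := by
    intro S hS
    by_contra hne
    exact one_ne_zero (eq_zero_of_countable (E := fun _ => 1) continuousAt_const hS
      fun s h1 h2 => (hne ⟨s, h1, h2⟩).elim)
  have hS1 : (⋃ m : ℕ, {s : ℂ | s ≠ 0 ∧ ellTheta p (q ^ m * s) = 0}).Countable :=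
    Set.countable_iUnion fun m => countable_ellTheta_const_mul hp (pow_ne_zero m hq)
  obtain ⟨g, hg0, hg⟩ := hex _ hS1
  have hS2 : (⋃ m : ℕ, {s : ℂ | s ≠ 0 ∧ ellTheta p (g / (q ^ m * c) * s) = 0}).Countable :=
    Set.countable_iUnion fun m => countable_ellTheta_const_mul hp
      (div_ne_zero hg0 (mul_ne_zero (pow_ne_zero m hq) hc))
  obtain ⟨f, hf0, hf⟩ := hex _ (hS1.union hS2)
  refine ⟨f, g, c / (f * g), by field_simp, ?_, ?_, ?_⟩
  · exact ellPoch_ne_zero_iff.2 fun l _ h =>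
      hf (Or.inl (Set.mem_iUnion.2 ⟨l, hf0, h⟩))
  · exact ellPoch_ne_zero_iff.2 fun l _ h => hg (Set.mem_iUnion.2 ⟨l, hg0, h⟩)
  · refine ellPoch_ne_zero_iff.2 fun l _ h => hf (Or.inr (Set.mem_iUnion.2 ⟨l, hf0, ?_⟩))
    have hql := pow_ne_zero l hq
    by_contra hne
    refine ellTheta_inv_ne_zero hp (mul_ne_zero (div_ne_zero hg0 (mul_ne_zero hql hc)) hf0) hne ?_
    rw [← h]
    congr 1
    field_simp

/-- The general term of Jackson's sum, multiplied by `θ(A)`. -/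
def jacksonTerm (p q A B C D E : ℂ) (N k : ℕ) : ℂ :=
  ellTheta p (A * q ^ (2 * k)) * (ellPoch p q A k * ellPoch p q ((q ^ N)⁻¹) k * ellPoch p q B k
      * ellPoch p q C k * ellPoch p q D k * ellPoch p q E k) * q ^ k
    / (ellPoch p q q k * ellPoch p q (A * q ^ (N + 1)) k * ellPoch p q (A * q / B) k
      * ellPoch p q (A * q / C) k * ellPoch p q (A * q / D) k * ellPoch p q (A * q / E) k)

/-- For one variable equal to `1`, a step value is a product of four thetas divided by `q^m`. The
fourth, after inversion, belongs to `λq/B`, so the product telescopes into shifted factorials. -/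
theorem prod_stepValue_one {p q : ℂ} (hp : ‖p‖ < 1) (hq : q ≠ 0) {f g h lam B : ℂ}
    (hB : B ≠ 0) (hlam : lam ≠ 0) (hfgh : f * g * h = lam * q / B) {j k : ℕ} (hjk : j ≤ k) :
    (∏ m ∈ Finset.Ico j k, -(lam * q ^ (m + 1) * stepValue p q 1 f g h 1 m)) * B ^ j
        * q ^ (k.choose 2) * (ellPoch p q f j * ellPoch p q g j * ellPoch p q h j
          * ellPoch p q (lam * q / B) j)
      = B ^ k * q ^ (j.choose 2) * (ellPoch p q f k * ellPoch p q g k * ellPoch p q h k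
          * ellPoch p q (lam * q / B) k) := by
  induction k, hjk using Nat.le_induction with
  | base => rw [Finset.Ico_self, Finset.prod_empty, one_mul]
  | succ k hk ih =>
    have hqk := pow_ne_zero k hq
    have hfac : -(lam * q ^ (k + 1) * stepValue p q 1 f g h 1 k) * q ^ k
        = B * (ellTheta p (q ^ k * f) * ellTheta p (q ^ k * g) * ellTheta p (q ^ k * h)
          * ellTheta p (q ^ k * (lam * q / B))) := by
      unfold stepValue typeDValue
      rw [if_pos odd_one, hfgh, show 1 / (lam * q / B * (1 * q ^ k) ^ 2) * (1 * q ^ k)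
          = (q ^ k * (lam * q / B))⁻¹ by field_simp,
        ellTheta_inv hp (mul_ne_zero hqk (div_ne_zero (mul_ne_zero hlam hq) hB)), one_mul,
        mul_comm f, mul_comm g, mul_comm h, pow_succ]
      field_simp
    rw [Finset.prod_Ico_succ_top hk, Nat.choose_succ_succ' k 1, Nat.choose_one_right]
    simp only [ellPoch_succ]
    rw [pow_add q k, pow_succ B]
    linear_combination (-(lam * q ^ (k + 1) * stepValue p q 1 f g h 1 k) * q ^ k) * ih
      + (B ^ k * q ^ (j.choose 2) * (ellPoch p q f k * ellPoch p q g k * ellPoch p q h k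
          * ellPoch p q (lam * q / B) k)) * hfac

/-- Positive powers of `q` come from `hqzz`, negative ones by inversion with `i` and `j` exchanged,
and the power zero from `hzz`. -/
theorem isGeneric_of_ne_zero {p q : ℂ} (hp : ‖p‖ < 1) (hq : q ≠ 0) {n N : ℕ} {z : Fin n → ℂ}
    (hz : ∀ i, z i ≠ 0) (hzz : ∀ i j, i < j → ellTheta p (z j / z i) ≠ 0)
    (hqzz : ∀ i j, ellPoch p q (q * z i / z j) N ≠ 0) : IsGeneric p q z N := by
  have hpos : ∀ i j, ∀ m : ℕ, m < N → ellTheta p (q ^ (m + 1) * (z i / z j)) ≠ 0 := by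
    intro i j m hm
    have := ellPoch_ne_zero_iff.1 (hqzz i j) m hm
    rwa [show q ^ m * (q * z i / z j) = q ^ (m + 1) * (z i / z j) by ring] at this
  refine ⟨hz, fun i j m hm hij => ?_⟩
  rcases lt_trichotomy m 0 with h | rfl | h
  · obtain ⟨l, hl⟩ := Int.eq_ofNat_of_zero_le (by omega : 0 ≤ -m - 1)
    obtain rfl : m = -((l + 1 : ℕ) : ℤ) := by push_cast; omega
    have := hpos j i l (by omega)
    have h0 : q ^ (l + 1) * (z j / z i) ≠ 0 :=
      mul_ne_zero (pow_ne_zero _ hq) (div_ne_zero (hz j) (hz i))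
    have := ellTheta_inv_ne_zero hp h0 this
    rwa [mul_inv, inv_div, ← zpow_natCast, ← zpow_neg] at this
  · have hij : i ≠ j := hij.resolve_right (by simp)
    rw [zpow_zero, one_mul]
    rcases lt_or_gt_of_ne hij with h | h
    · rw [← inv_div]
      exact ellTheta_inv_ne_zero hp (div_ne_zero (hz j) (hz i)) (hzz i j h)
    · exact hzz j i h
  · obtain ⟨l, hl⟩ := Int.eq_ofNat_of_zero_le (by omega : 0 ≤ m - 1)
    obtain rfl : m = ((l + 1 : ℕ) : ℤ) := by push_cast; omega
    rw [zpow_natCast]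
    exact hpos i j l (by omega)

theorem dSum_one (p q f g h η : ℂ) (k : ℕ) (X Y : ℂ) :
    dSum p q (fun _ : Fin 1 => 1) f g h η k X Y
      = ellPoch p q f k * ellPoch p q g k * ellPoch p q h k * (ellPoch p q X k * ellPoch p q Y k)
        / (ellPoch p q η k * q ^ (k.choose 2) * ellPoch p q q k) := by
  have hs : Finset.piAntidiag (Finset.univ : Finset (Fin 1)) k = {fun _ => k} := by
    ext x
    rw [mem_simplex, Finset.mem_singleton]
    simp [funext_iff]
  rw [dSum, hs, Finset.sum_singleton]
  simp [dTerm, deltaRatio, dFactor]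

/-- The connection formula for `n = 1` and `k = N`, where every `dSum` is one product. With `σ =
1/B`, `λ = A`, `η = Aq/C`, the points `X = Aq/(CD)`, `Y = Aq/(CE)` satisfy the constraint by the
balancing condition. -/
theorem jackson_generic {p q : ℂ} (hp : ‖p‖ < 1) (hq : q ≠ 0) {A B C D E : ℂ} {N : ℕ}
    (hA0 : A ≠ 0) (hbal : A ^ 2 * q ^ (N + 1) = B * C * D * E) (hqN : ellPoch p q q N ≠ 0)
    (hA : ellPoch p q A (2 * N + 1) ≠ 0) (hB : ellPoch p q (A * q / B) N ≠ 0)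
    (hC : ellPoch p q (A * q / C) N ≠ 0) (hD : ellPoch p q (A * q / D) N ≠ 0)
    (hE : ellPoch p q (A * q / E) N ≠ 0) :
    ∑ k ∈ Finset.range (N + 1), jacksonTerm p q A B C D E N k
      = ellPoch p q A (N + 1) * ellPoch p q (A * q / (B * C)) N * ellPoch p q (A * q / (B * D)) N
          * ellPoch p q (A * q / (C * D)) N
        / (ellPoch p q (A * q / B) N * ellPoch p q (A * q / C) N * ellPoch p q (A * q / D) N
          * ellPoch p q (A * q / (B * C * D)) N) := by
  have hqk := fun m : ℕ => pow_ne_zero m hq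
  have hBCDE : B * C * D * E ≠ 0 := by
    rw [← hbal]; exact mul_ne_zero (pow_ne_zero _ hA0) (hqk _)
  have hE0 : E ≠ 0 := right_ne_zero_of_mul hBCDE
  have hD0 : D ≠ 0 := right_ne_zero_of_mul (left_ne_zero_of_mul hBCDE)
  have hC0 : C ≠ 0 := right_ne_zero_of_mul (left_ne_zero_of_mul (left_ne_zero_of_mul hBCDE))
  have hB0 : B ≠ 0 := left_ne_zero_of_mul (left_ne_zero_of_mul (left_ne_zero_of_mul hBCDE))
  obtain ⟨f, g, h, hfgh, hf, hg, hh⟩ := exists_triple_ellPoch_ne_zero hp hq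
    (div_ne_zero (mul_ne_zero hA0 hq) hB0) N
  have hAm : ∀ m, m < 2 * N + 1 → ellTheta p (A * q ^ m) ≠ 0 := fun m hm => by
    rw [mul_comm]; exact ellPoch_ne_zero_iff.1 hA m hm
  have hz : IsGeneric p q (fun _ : Fin 1 => (1 : ℂ)) N :=
    isGeneric_of_ne_zero hp hq (fun _ => one_ne_zero)
      (fun i j hij => absurd hij (by simp [Subsingleton.elim i j])) (fun i j => by simpa using hqN)
  have key := dSum_connection hp hq hz (f := f) (g := g) (h := h) (η := A * q / C) (σ := 1 / B)
    (lam := A) (X := A * q / (C * D)) (Y := A * q / (C * E))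
    (div_ne_zero (mul_ne_zero hA0 hq) hC0) (fun i => by simpa using hC) hqN
    (by rw [hfgh]; simp; field_simp) (mul_ne_zero (one_div_ne_zero hB0) hA0)
    (fun m _ h2 => hAm m (by omega)) le_rfl (div_ne_zero (mul_ne_zero hA0 hq) (mul_ne_zero hC0 hD0))
    (div_ne_zero (mul_ne_zero hA0 hq) (mul_ne_zero hC0 hE0)) (by
      have := hqk N
      field_simp
      rw [pow_succ] at hbal
      linear_combination hbal)
  simp only [dSum_one, Finset.prod_const_one, connSum] at key
  have eX : 1 / B * (A * q / (C * D)) = E / (A * q ^ N) := by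
    have := hqk N
    field_simp
    rw [pow_succ] at hbal
    linear_combination hbal
  have eY : 1 / B * (A * q / (C * E)) = D / (A * q ^ N) := by
    have := hqk N
    field_simp
    rw [pow_succ] at hbal
    linear_combination hbal
  -- Reversing the factorials of index `N - j` gives Jackson's summand. The step values complete
  -- `(f, g, h)_j` to `(f, g, h)_N`, which is independent of `j` and cancels against the left side.
  have hterm : ∀ j ∈ Finset.range (N + 1), connCoeff p q 1 f g h 1 A N j
        * (ellPoch p q f j * ellPoch p q g j * ellPoch p q h j
          * (ellPoch p q (A * q / C / (A * q ^ j)) j * ellPoch p q (1 / (1 / B)) j)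
          / (ellPoch p q (A * q / C) j * q ^ (j.choose 2) * ellPoch p q q j))
        * ((ellPoch p q (A * q / C / (A * q / (C * D))) j
            * ellPoch p q (A * q / C / (A * q / (C * E))) j)
          * (ellPoch p q (1 / B * (A * q / (C * D))) (N - j)
            * ellPoch p q (1 / B * (A * q / (C * E))) (N - j)))
      = B ^ N * (ellPoch p q f N * ellPoch p q g N * ellPoch p q h N * ellPoch p q (A * q / B) N)
          * (ellPoch p q (E / (A * q ^ N)) N * ellPoch p q (D / (A * q ^ N)) N)
          / (q ^ (N.choose 2) * ellPoch p q q N * ellPoch p q A (N + 1))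
        * jacksonTerm p q A B C D E N j := by
    intro j hj
    have hj : j ≤ N := Nat.lt_succ_iff.1 (Finset.mem_range.1 hj)
    rw [eX, eY, one_div_one_div, show A * q / C / (A * q / (C * D)) = D by field_simp,
      show A * q / C / (A * q / (C * E)) = E by field_simp]
    have hqj := hqk j
    have hqN' := hqk N
    have hqNj := hqk (N - j)
    have eNj : q ^ N = q ^ (N - j) * q ^ j := by rw [← pow_add, Nat.sub_add_cancel hj]
    have r1 := prod_stepValue_one hp hq hB0 hA0 hfgh hj
    have r2 := ellPoch_sub hp hq hq hj
    have r3 := ellPoch_sub hp hq (div_ne_zero hE0 (mul_ne_zero hA0 hqN')) hj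
    have r4 := ellPoch_sub hp hq (div_ne_zero hD0 (mul_ne_zero hA0 hqN')) hj
    have r5 := ellPoch_reverse hp hq (div_ne_zero (div_ne_zero (mul_ne_zero hA0 hq) hC0)
      (mul_ne_zero hA0 hqj)) j
    have r6 : ellPoch p q A (N + 1) * ellPoch p q (A * q ^ (N + 1)) j
        = ellPoch p q A j * ellPoch p q (A * q ^ j) j * (ellTheta p (A * q ^ (2 * j))
          * ellPoch p q (A * q ^ (2 * j + 1)) (N - j)) := by
      rw [← ellPoch_add, ← ellPoch_add, show N + 1 + j = j + j + (N - j + 1) by omega,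
        ellPoch_add p q A (j + j), ellPoch_succ', pow_succ, two_mul, mul_assoc]
    rw [show q / (q * q ^ N) = (q ^ N)⁻¹ by field_simp] at r2
    rw [show q / (E / (A * q ^ N) * q ^ N) = A * q / E by field_simp] at r3
    rw [show q / (D / (A * q ^ N) * q ^ N) = A * q / D by field_simp] at r4
    rw [show q / (A * q / C / (A * q ^ j) * q ^ j) = C by field_simp] at r5
    have hpow : (-(A * q / C / (A * q ^ j))) ^ j * (-(q * q ^ (N - j))) ^ j
        = q ^ j * B ^ j * (-(E / (A * q ^ N) * q ^ (N - j))) ^ j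
          * (-(D / (A * q ^ N) * q ^ (N - j))) ^ j := by
      rw [← mul_pow, ← mul_pow, ← mul_pow, ← mul_pow]
      congr 1
      rw [eNj]
      field_simp
      rw [pow_succ q N, eNj] at hbal
      linear_combination hbal
    have n1 := ellPoch_ne_zero_mono hf hj
    have n2 := ellPoch_ne_zero_mono hg hj
    have n3 := ellPoch_ne_zero_mono hh hj
    have n4 := ellPoch_ne_zero_mono hB hj
    have n5 := ellPoch_ne_zero_mono hC hj
    have n6 := ellPoch_ne_zero_mono hD hj
    have n7 := ellPoch_ne_zero_mono hE hj
    have n8 := ellPoch_ne_zero_mono hqN hj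
    have n9 : ellPoch p q A (N + 1) * ellPoch p q (A * q ^ (N + 1)) j ≠ 0 := by
      rw [← ellPoch_add]; exact ellPoch_ne_zero_mono hA (by omega)
    have n10 : ellPoch p q q (N - j) ≠ 0 := ellPoch_ne_zero_mono hqN (by omega)
    have n11 := r6 ▸ n9
    have hw : ∀ w : ℂ, w ≠ 0 → (-w) ^ j ≠ 0 := fun w hw => pow_ne_zero _ (neg_ne_zero.2 hw)
    have n12 := hw _ (mul_ne_zero hq hqNj)
    have n13 := hw _ (mul_ne_zero (div_ne_zero hE0 (mul_ne_zero hA0 hqN')) hqNj)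
    have n14 := hw _ (mul_ne_zero (div_ne_zero hD0 (mul_ne_zero hA0 hqN')) hqNj)
    have n15 := hqk (j.choose 2)
    have n16 := hqk (N.choose 2)
    have n17 := pow_ne_zero j hB0
    unfold connCoeff jacksonTerm
    rw [r5]
    rw [r3, r4]
    rw [r2] at hqN ⊢
    generalize (∏ m ∈ Finset.Ico j N, -(A * q ^ (m + 1) * stepValue p q 1 f g h 1 m)) = P at *
    generalize ellPoch p q f j = a1 at *
    generalize ellPoch p q g j = a2 at *
    generalize ellPoch p q h j = a3 at *
    generalize ellPoch p q (A * q / B) j = a4 at *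
    generalize ellPoch p q (A * q / C) j = a5 at *
    generalize ellPoch p q (A * q / D) j = a6 at *
    generalize ellPoch p q (A * q / E) j = a7 at *
    generalize ellPoch p q f N = b1 at *
    generalize ellPoch p q g N = b2 at *
    generalize ellPoch p q h N = b3 at *
    generalize ellPoch p q (A * q / B) N = b4 at *
    generalize ellPoch p q q (N - j) = c1 at *
    generalize ellPoch p q (E / (A * q ^ N)) (N - j) = c2 at *
    generalize ellPoch p q (D / (A * q ^ N)) (N - j) = c3 at *
    generalize ellPoch p q A (N + 1) = d1 at *
    generalize ellPoch p q (A * q ^ (N + 1)) j = d2 at *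
    generalize ellPoch p q A j = d3 at *
    generalize ellPoch p q (A * q ^ j) j = d4 at *
    generalize ellTheta p (A * q ^ (2 * j)) = d5 at *
    generalize ellPoch p q (A * q ^ (2 * j + 1)) (N - j) = d6 at *
    generalize ellPoch p q q j = d7 at *
    generalize ellPoch p q (q ^ N)⁻¹ j = d8 at *
    generalize (-(A * q / C / (A * q ^ j))) ^ j = w1 at *
    generalize (-(q * q ^ (N - j))) ^ j = w2 at *
    generalize (-(E / (A * q ^ N) * q ^ (N - j))) ^ j = w3 at *
    generalize (-(D / (A * q ^ N) * q ^ (N - j))) ^ j = w4 at *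
    generalize q ^ j.choose 2 = y1 at *
    generalize q ^ N.choose 2 = y2 at *
    generalize B ^ j = y3 at *
    generalize B ^ N = y4 at *
    generalize q ^ j = y5 at *
    generalize ellPoch p q B j = e1 at *
    generalize ellPoch p q C j = e2 at *
    generalize ellPoch p q D j = e3 at *
    generalize ellPoch p q E j = e4 at *
    clear r2 r3 r4 r5 key hz hAm
    have m1 := left_ne_zero_of_mul n9
    have m2 := right_ne_zero_of_mul n9
    have m3 := right_ne_zero_of_mul hqN
    have m4 : d8 ≠ 0 := right_ne_zero_of_mul m3
    have m5 := left_ne_zero_of_mul (left_ne_zero_of_mul n11)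
    have m6 := right_ne_zero_of_mul (left_ne_zero_of_mul n11)
    have m7 := left_ne_zero_of_mul (right_ne_zero_of_mul n11)
    have m8 := right_ne_zero_of_mul (right_ne_zero_of_mul n11)
    have hP : P = y4 * y1 * (b1 * b2 * b3 * b4) / (y3 * y2 * (a1 * a2 * a3 * a4)) := by
      rw [eq_div_iff (by simp_all)]
      linear_combination r1
    have hd : d6 = d1 * d2 / (d3 * d4 * d5) := by
      rw [eq_div_iff (by simp_all)]
      linear_combination -r6
    have hw1 : w1 = y5 * y3 * w3 * w4 / w2 := by
      rw [eq_div_iff n12]; exact hpow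
    rw [hP, hd, hw1]
    field_simp
  rw [Finset.sum_congr rfl hterm, ← Finset.mul_sum] at key
  have hqN' := hqk N
  have nA : ellPoch p q A (N + 1) ≠ 0 := ellPoch_ne_zero_mono hA (by omega)
  have t1 := ellPoch_reverse hp hq (div_ne_zero hE0 (mul_ne_zero hA0 hqN')) N
  have t2 := ellPoch_reverse hp hq (div_ne_zero hD0 (mul_ne_zero hA0 hqN')) N
  have t3 := ellPoch_reverse hp hq (div_ne_zero (mul_ne_zero hB0 hD0) (mul_ne_zero hA0 hqN')) N
  rw [show q / (E / (A * q ^ N) * q ^ N) = A * q / E by field_simp] at t1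
  rw [show q / (D / (A * q ^ N) * q ^ N) = A * q / D by field_simp] at t2
  rw [show q / (B * D / (A * q ^ N) * q ^ N) = A * q / (B * D) by field_simp,
    show -(B * D / (A * q ^ N)) = B * -(D / (A * q ^ N)) by ring, mul_pow] at t3
  have eE : A * q / (B * C * D) = E / (A * q ^ N) := by
    field_simp
    rw [pow_succ] at hbal
    linear_combination hbal
  have eCE : A * q / (C * E) = B * D / (A * q ^ N) := by
    field_simp
    rw [pow_succ] at hbal
    linear_combination hbal
  rw [show A * q / C * (1 / B) = A * q / (B * C) by field_simp, eCE, t3, t2] at key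
  rw [eE]
  have nw : ∀ w : ℂ, w ≠ 0 → (-w) ^ N ≠ 0 := fun w hw => pow_ne_zero _ (neg_ne_zero.2 hw)
  have n1 := nw _ (div_ne_zero hD0 (mul_ne_zero hA0 hqN'))
  have n2 : ellPoch p q (E / (A * q ^ N)) N ≠ 0 := by
    rw [t1]
    exact mul_ne_zero (mul_ne_zero (nw _ (div_ne_zero hE0 (mul_ne_zero hA0 hqN'))) (hqk _)) hE
  have n3 := hqk (N.choose 2)
  have n4 := pow_ne_zero N hB0
  clear t1 t2 t3 hterm hz
  generalize ellPoch p q (E / (A * q ^ N)) N = a1 at *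
  generalize (-(D / (A * q ^ N))) ^ N = a2 at *
  generalize ellPoch p q f N = a3 at *
  generalize ellPoch p q g N = a4 at *
  generalize ellPoch p q h N = a5 at *
  generalize ellPoch p q (A * q / B) N = a6 at *
  generalize ellPoch p q (A * q / C) N = a7 at *
  generalize ellPoch p q (A * q / D) N = a8 at *
  generalize ellPoch p q A (N + 1) = a9 at *
  generalize ellPoch p q q N = a10 at *
  generalize q ^ (N.choose 2) = a11 at *
  generalize B ^ N = a12 at *
  generalize ∑ k ∈ Finset.range (N + 1), jacksonTerm p q A B C D E N k = S at *
  field_simp at key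
  rw [eq_div_iff (by simp_all)]
  linear_combination -key

/-- Only `(A q^(N+1))_N ≠ 0` is kept from the condition on `A`, because the application has `A = a
q^(2j)` and the rest is not given there. Scaling `A`, `B`, `C` by `s` preserves the balancing and
makes the missing factors non-zero. -/
theorem jackson {p q : ℂ} (hp : ‖p‖ < 1) (hq : q ≠ 0) {A B C D E : ℂ} {N : ℕ}
    (hA0 : A ≠ 0) (hbal : A ^ 2 * q ^ (N + 1) = B * C * D * E) (hqN : ellPoch p q q N ≠ 0)
    (hA : ellPoch p q (A * q ^ (N + 1)) N ≠ 0) (hB : ellPoch p q (A * q / B) N ≠ 0)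
    (hC : ellPoch p q (A * q / C) N ≠ 0) (hD : ellPoch p q (A * q / D) N ≠ 0)
    (hE : ellPoch p q (A * q / E) N ≠ 0) :
    ∑ k ∈ Finset.range (N + 1), jacksonTerm p q A B C D E N k
      = ellPoch p q A (N + 1) * ellPoch p q (A * q / (B * C)) N * ellPoch p q (A * q / (B * D)) N
          * ellPoch p q (A * q / (C * D)) N
        / (ellPoch p q (A * q / B) N * ellPoch p q (A * q / C) N * ellPoch p q (A * q / D) N
          * ellPoch p q (A * q / (B * C * D)) N) := by
  have hqk := fun m : ℕ => pow_ne_zero m hq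
  have hqN' := hqk N
  have hBCDE : B * C * D * E ≠ 0 := by
    rw [← hbal]; exact mul_ne_zero (pow_ne_zero _ hA0) (hqk _)
  have hE0 : E ≠ 0 := right_ne_zero_of_mul hBCDE
  have hD0 : D ≠ 0 := right_ne_zero_of_mul (left_ne_zero_of_mul hBCDE)
  have hC0 : C ≠ 0 := right_ne_zero_of_mul (left_ne_zero_of_mul (left_ne_zero_of_mul hBCDE))
  have hB0 : B ≠ 0 := left_ne_zero_of_mul (left_ne_zero_of_mul (left_ne_zero_of_mul hBCDE))
  have hAq : A * q ≠ 0 := mul_ne_zero hA0 hq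
  have hlast : ellPoch p q (A * q / (B * C * D)) N ≠ 0 := by
    have eE : A * q / (B * C * D) = E / (A * q ^ N) := by
      field_simp
      rw [pow_succ] at hbal
      linear_combination hbal
    rw [eE, ellPoch_reverse hp hq (div_ne_zero hE0 (mul_ne_zero hA0 hqN')) N,
      show q / (E / (A * q ^ N) * q ^ N) = A * q / E by field_simp]
    exact mul_ne_zero (mul_ne_zero (pow_ne_zero _ (neg_ne_zero.2
      (div_ne_zero hE0 (mul_ne_zero hA0 hqN')))) (hqk _)) hE
  let Ef : ℂ → ℂ := fun s =>
    ∑ k ∈ Finset.range (N + 1), jacksonTerm p q (A * s) (B * s) (C * s) D E N k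
      - ellPoch p q (A * s) (N + 1) * ellPoch p q (A * s * q / (B * s * (C * s))) N
          * ellPoch p q (A * s * q / (B * s * D)) N
          * ellPoch p q (A * s * q / (C * s * D)) N
        / (ellPoch p q (A * s * q / (B * s)) N * ellPoch p q (A * s * q / (C * s)) N
          * ellPoch p q (A * s * q / D) N * ellPoch p q (A * s * q / (B * s * (C * s) * D)) N)
  have hid : ContinuousAt (fun s : ℂ => s) 1 := continuousAt_id
  have cc : ∀ c : ℂ, ContinuousAt (fun s : ℂ => c * s) 1 := fun c => continuousAt_const.mul hid
  have cq : ∀ {F : ℂ → ℂ}, ContinuousAt F 1 → F 1 ≠ 0 → ∀ m,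
      ContinuousAt (fun s => ellPoch p q (F s) m) 1 := fun hF h m =>
    ContinuousAt.ellPoch hp hq hF h m
  have ck : ∀ c : ℂ, ContinuousAt (fun _ : ℂ => c) 1 := fun c => continuousAt_const
  have hE1 : ContinuousAt Ef 1 := by
    refine ContinuousAt.sub (tendsto_finsetSum _ fun k hk => ?_) ?_
    · have hk : k ≤ N := Nat.lt_succ_iff.1 (Finset.mem_range.1 hk)
      have m0 := ellPoch_ne_zero_mono hqN hk
      have m1 := ellPoch_ne_zero_mono hA hk
      have m2 := ellPoch_ne_zero_mono hB hk
      have m3 := ellPoch_ne_zero_mono hC hk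
      have m4 := ellPoch_ne_zero_mono hD hk
      have m5 := ellPoch_ne_zero_mono hE hk
      refine ContinuousAt.div (((ContinuousAt.ellTheta hp ((cc A).mul (ck _))
        (by simpa using ⟨hA0, fun h => (hq h).elim⟩)).mul ((((((cq (cc A) ?_ k).mul (ck _)).mul
          (cq (cc B) ?_ k)).mul (cq (cc C) ?_ k)).mul (ck _)).mul (ck _))).mul (ck _))
        ((((((ck _).mul (cq ((cc A).mul (ck _)) ?_ k)).mul
          (cq (((cc A).mul (ck q)).div (cc B) ?_) ?_ k)).mul
          (cq (((cc A).mul (ck q)).div (cc C) ?_) ?_ k)).mul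
          (cq (((cc A).mul (ck q)).div (ck D) ?_) ?_ k)).mul
          (cq (((cc A).mul (ck q)).div (ck E) ?_) ?_ k)) ?_
      all_goals simp_all
    · refine ContinuousAt.div ((((cq (cc A) ?_ _).mul
        (cq (((cc A).mul (ck q)).div ((cc B).mul (cc C)) ?_) ?_ _)).mul
        (cq (((cc A).mul (ck q)).div ((cc B).mul (ck D)) ?_) ?_ _)).mul
        (cq (((cc A).mul (ck q)).div ((cc C).mul (ck D)) ?_) ?_ _))
        ((((cq (((cc A).mul (ck q)).div (cc B) ?_) ?_ _).mul
        (cq (((cc A).mul (ck q)).div (cc C) ?_) ?_ _)).mul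
        (cq (((cc A).mul (ck q)).div (ck D) ?_) ?_ _)).mul
        (cq (((cc A).mul (ck q)).div (((cc B).mul (cc C)).mul (ck D)) ?_) ?_ _)) ?_
      all_goals simp_all
  have hS : (⋃ l : ℕ, (({s : ℂ | s ≠ 0 ∧ ellTheta p (q ^ l * A * s) = 0}
      ∪ {s : ℂ | s ≠ 0 ∧ ellTheta p (q ^ l * (A * q / D) * s) = 0})
      ∪ {s : ℂ | s ≠ 0 ∧ ellTheta p (q ^ l * (A * q / E) * s) = 0})).Countable :=
    Set.countable_iUnion fun l => ((countable_ellTheta_const_mul hp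
      (mul_ne_zero (hqk l) hA0)).union (countable_ellTheta_const_mul hp
        (mul_ne_zero (hqk l) (div_ne_zero hAq hD0)))).union (countable_ellTheta_const_mul hp
        (mul_ne_zero (hqk l) (div_ne_zero hAq hE0)))
  have h1 := eq_zero_of_countable hE1 hS fun s hs hsS => by
    simp only [Set.mem_iUnion, Set.mem_union, Set.mem_ofPred_eq, not_exists, not_or] at hsS
    refine sub_eq_zero.2 (jackson_generic hp hq (mul_ne_zero hA0 hs)
      (by linear_combination s ^ 2 * hbal) hqN ?_ ?_ ?_ ?_ ?_)
    · exact ellPoch_ne_zero_iff.2 fun l _ h => (hsS l).1.1 ⟨hs, by rw [← h]; congr 1; ring⟩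
    · rwa [show A * s * q / (B * s) = A * q / B by field_simp]
    · rwa [show A * s * q / (C * s) = A * q / C by field_simp]
    · exact ellPoch_ne_zero_iff.2 fun l _ h => (hsS l).1.2 ⟨hs, by rw [← h]; congr 1; ring⟩
    · exact ellPoch_ne_zero_iff.2 fun l _ h => (hsS l).2 ⟨hs, by rw [← h]; congr 1; ring⟩
  simpa [Ef, sub_eq_zero] using h1

/-! ### Interchange of summations -/

/-- The factorization `hstep` into four thetas is the only information about the parity of `n` used
in the transformation; with it the product of step values becomes four shifted factorials. -/
theorem prod_stepValue {p q : ℂ} (hq : q ≠ 0) {n : ℕ} {f g h Z lam τ U V s₁ s₂ : ℂ}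
    (hτ : τ * (f * g * h * Z ^ 2) = lam * q)
    (hstep : ∀ m, stepValue p q n f g h Z m * (f * g * h * Z ^ 2 * q ^ (2 * m))
      = -(ellTheta p (q ^ m * U) * ellTheta p (q ^ m * V) * ellTheta p (q ^ m * s₁)
        * ellTheta p (q ^ m * s₂))) (j i : ℕ) :
    (∏ m ∈ Finset.Ico j (j + i), -(lam * q ^ (m + 1) * stepValue p q n f g h Z m))
        * q ^ ((j + i).choose 2)
      = τ ^ i * q ^ (j.choose 2) * (ellPoch p q (U * q ^ j) i * ellPoch p q (V * q ^ j) i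
          * ellPoch p q (s₁ * q ^ j) i * ellPoch p q (s₂ * q ^ j) i) := by
  induction i with
  | zero => simp [ellPoch_zero]
  | succ i ih =>
    have hqm := pow_ne_zero (j + i) hq
    have e : ∀ u : ℂ, ellTheta p (q ^ i * (u * q ^ j)) = ellTheta p (q ^ (j + i) * u) :=
      fun u => by rw [pow_add]; congr 1; ring
    have hfac : -(lam * q ^ (j + i + 1) * stepValue p q n f g h Z (j + i)) * q ^ (j + i)
        = τ * (ellTheta p (q ^ (j + i) * U) * ellTheta p (q ^ (j + i) * V)
          * ellTheta p (q ^ (j + i) * s₁) * ellTheta p (q ^ (j + i) * s₂)) := by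
      have := hstep (j + i)
      rw [two_mul, pow_add q (j + i) (j + i)] at this
      rw [pow_succ q (j + i)]
      linear_combination (-τ) * this + (stepValue p q n f g h Z (j + i) * q ^ (j + i)
        * q ^ (j + i)) * hτ
    rw [← add_assoc, Finset.prod_Ico_succ_top (Nat.le_add_right j i),
      Nat.choose_succ_succ' (j + i) 1, Nat.choose_one_right]
    simp only [ellPoch_succ, e]
    rw [pow_add q (j + i), pow_succ τ]
    linear_combination (-(lam * q ^ (j + i + 1) * stepValue p q n f g h Z (j + i))
      * q ^ (j + i)) * ih + (τ ^ i * q ^ (j.choose 2) * (ellPoch p q (U * q ^ j) i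
        * ellPoch p q (V * q ^ j) i * ellPoch p q (s₁ * q ^ j) i
        * ellPoch p q (s₂ * q ^ j) i)) * hfac

/-- The factor in front of the sum over `|x| = k` on the left-hand side, except for `(d)_k`. -/
def leftWeight (p q a b c d U V s₁ s₂ : ℂ) (N k : ℕ) : ℂ :=
  ellTheta p (a * q ^ (2 * k)) * (ellPoch p q a k * ellPoch p q ((q ^ N)⁻¹) k * ellPoch p q c k)
      * q ^ k * (-(b * q ^ k / q)) ^ k
    / (ellPoch p q (a * q ^ (N + 1)) k * ellPoch p q (a * q / c) k * ellPoch p q (a * q / d) k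
      * (ellPoch p q s₁ k * ellPoch p q s₂ k * ellPoch p q (a * q / U) k
        * ellPoch p q (a * q / V) k))

/-- The factor of the inner sum after interchanging the two summations. -/
def innerWeight (p q a b c d lam U V s₁ s₂ : ℂ) (N j : ℕ) : ℂ :=
  ellPoch p q (lam * d / a) j * (-(b * q ^ j / q)) ^ j * (ellPoch p q a (2 * j)
      * ellPoch p q ((q ^ N)⁻¹) j * ellPoch p q c j) * q ^ j
    / (ellPoch p q (a * q / d) j * (ellPoch p q s₁ j * ellPoch p q s₂ j)
      * ellPoch p q (lam * q ^ j) j * (ellPoch p q (a * q ^ (N + 1)) j * ellPoch p q (a * q / c) j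
      * ellPoch p q (a * q / U) j * ellPoch p q (a * q / V) j))

theorem leftWeight_aux {T a₁ a₂ a₃ a₄ a₅ a₆ a₇ a₈ a₉ a₁₀ b₁ b₂ c₁ c₂ y₁ y₂ y₃ y₄ y₅ w₁ w₂ w₃ w₄ w₅
    D₁ D₂ E₁ E₂ F₁ F₂ H₁ H₂ L₁ L₂ Q u v g₁ g₂ G : ℂ} (h1 : a₁ ≠ 0) (h5 : a₅ ≠ 0) (h6 : a₆ ≠ 0)
    (h2 : y₂ ≠ 0) (h3 : y₃ ≠ 0) (hw : w₁ ≠ 0) (hA : a₇ * a₈ = a₉ * a₁₀)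
    (hpow : y₁ * w₃ * w₅ * w₂ = w₄ * (y₄ * y₅) * w₁) :
    T * (a₇ * (b₁ * b₂) * (c₁ * c₂)) * y₁ * w₃
        / ((D₁ * D₂) * (E₁ * E₂) * a₁ * (a₃ * a₅ * (a₄ * a₆) * (F₁ * F₂) * (H₁ * H₂)))
      * (w₅ * y₃ * (u * v * a₅ * a₆) / y₂ / (L₁ * Q * L₂) * G
        * ((g₁ * a₈) * (g₂ * (w₂ * y₂ * a₁ / (w₁ * y₃ * a₂)))))
    = g₁ * w₄ * (a₉ * b₁ * c₁) * y₄ / (a₂ * (a₃ * a₄) * L₁ * (D₁ * E₁ * F₁ * H₁)) * G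
      * (T * (a₁₀ * b₂ * g₂ * c₂ * u * v) * y₅ / (Q * D₂ * L₂ * E₂ * F₂ * H₂)) := by
  have hk : a₁ * a₅ * a₆ * y₂ * w₁ * y₃ ≠ 0 := by simp_all
  rw [div_div, div_mul_eq_mul_div (_ * _ * _) _ G, mul_div_assoc' g₂, mul_div_assoc' (g₁ * a₈),
    div_mul_div_comm (_ * G), div_mul_div_comm, div_mul_eq_mul_div _ _ G, div_mul_div_comm,
    ← mul_div_mul_right (g₁ * w₄ * (a₉ * b₁ * c₁) * y₄ * G
      * (T * (a₁₀ * b₂ * g₂ * c₂ * u * v) * y₅)) _ hk]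
  congr 1
  · linear_combination (T * b₁ * b₂ * c₁ * c₂ * u * v * g₁ * g₂ * G * y₃ * a₅ * a₆ * y₂ * a₁)
      * (w₄ * (y₄ * y₅) * w₁ * hA + a₇ * a₈ * hpow)
  · ring

/-- With `k = j + i`, shifted factorials of index `j + i` split into index `j` and a shifted one of
index `i`. Those of `s₁`, `s₂` cancel against step values, `(d/(aq^k))_i` is reversed against
`(aq/d)_k`, and what depends on `i` is Jackson's summand with `A = aq^(2j)`. -/
theorem leftWeight_mul_connCoeff {p q : ℂ} (hp : ‖p‖ < 1) (hq : q ≠ 0) {n N : ℕ}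
    {a b c d e f g h Z lam U V s₁ s₂ : ℂ} (ha : a ≠ 0) (hd : d ≠ 0) (hlam : lam ≠ 0)
    (hbde : b * d * e * lam = a ^ 2 * q) (hU : U ≠ 0) (hV : V ≠ 0) (hc : c ≠ 0)
    (hτ : lam * e / a * (f * g * h * Z ^ 2) = lam * q)
    (hstep : ∀ m, stepValue p q n f g h Z m * (f * g * h * Z ^ 2 * q ^ (2 * m))
      = -(ellTheta p (q ^ m * U) * ellTheta p (q ^ m * V) * ellTheta p (q ^ m * s₁)
        * ellTheta p (q ^ m * s₂)))
    (hs₁ : ellPoch p q s₁ N ≠ 0) (hs₂ : ellPoch p q s₂ N ≠ 0)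
    (hadN : ellPoch p q (a * q / d) N ≠ 0) {i j : ℕ} (hij : j + i ≤ N) (G : ℂ) :
    leftWeight p q a b c d U V s₁ s₂ N (j + i) * (connCoeff p q n f g h Z lam (j + i) j * G
      * ((ellPoch p q (lam * d / a) j * ellPoch p q (a * q ^ (j + i)) j)
        * (ellPoch p q (a / lam) i * ellPoch p q (d / (a * q ^ (j + i))) i)))
    = innerWeight p q a b c d lam U V s₁ s₂ N j * G
      * jacksonTerm p q (a * q ^ (2 * j)) (a / lam) (c * q ^ j) (U * q ^ j) (V * q ^ j) (N - j) i
    := by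
  have hqk := fun m : ℕ => pow_ne_zero m hq
  have hqj := hqk j
  have hqi := hqk i
  have hw0 : d / (a * q ^ (j + i)) ≠ 0 := div_ne_zero hd (mul_ne_zero ha (hqk _))
  have r1 := prod_stepValue (p := p) hq hτ hstep j i
  have r2 := ellPoch_sub hp hq hw0 (Nat.le_add_right j i)
  have r3 := ellPoch_reverse hp hq hw0 (j + i)
  rw [Nat.add_sub_cancel_left] at r2
  rw [show q / (d / (a * q ^ (j + i)) * q ^ (j + i)) = a * q / d by
    have := hqk (j + i); field_simp] at r2 r3
  have rA : ellPoch p q a (j + i) * ellPoch p q (a * q ^ (j + i)) j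
      = ellPoch p q a (2 * j) * ellPoch p q (a * q ^ (2 * j)) i := by
    rw [← ellPoch_add, ← ellPoch_add]; congr 1; omega
  have eN : q ^ N = q ^ (N - j) * q ^ j := by rw [← pow_add, Nat.sub_add_cancel (by omega)]
  have e1 : (q ^ N)⁻¹ * q ^ j = (q ^ (N - j))⁻¹ := by
    rw [eN]; have := hqk (N - j); field_simp
  have e2 : a * q ^ (2 * j) * q ^ (N - j + 1) = a * q ^ (N + 1) * q ^ j := by
    rw [pow_succ, pow_succ, eN, two_mul, pow_add]; ring
  have e3 : a * q ^ (2 * j) * q / (a / lam) = lam * q ^ (2 * j + 1) := by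
    rw [pow_succ]; field_simp
  have e4 : ∀ u : ℂ, u ≠ 0 → a * q ^ (2 * j) * q / (u * q ^ j) = a * q / u * q ^ j := by
    intro u hu
    rw [two_mul, pow_add]; field_simp
  have e5 : a * q ^ (2 * j) * q ^ (2 * i) = a * q ^ (2 * (j + i)) := by
    rw [mul_add, pow_add]; ring
  -- The `i`-th powers cancel because `(bd/(aq)) (λe/a) = 1`, which is the definition of `λ`.
  have hpow : q ^ (j + i) * (-(b * q ^ (j + i) / q)) ^ (j + i) * (lam * e / a) ^ i
        * (-(d / (a * q ^ (j + i)))) ^ (j + i)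
      = (-(b * q ^ j / q)) ^ j * (q ^ j * q ^ i) * (-(d / (a * q ^ (j + i)) * q ^ i)) ^ j := by
    have x1 : (-(b * q ^ (j + i) / q)) ^ (j + i) * (-(d / (a * q ^ (j + i)))) ^ (j + i)
        = (b * d / (a * q)) ^ (j + i) := by
      rw [← mul_pow]; congr 1
      have := hqk (j + i)
      field_simp
    have x2 : (-(b * q ^ j / q)) ^ j * (-(d / (a * q ^ (j + i)) * q ^ i)) ^ j
        = (b * d / (a * q)) ^ j := by
      rw [← mul_pow]; congr 1
      rw [pow_add]
      field_simp
    have x3 : (b * d / (a * q)) ^ i * (lam * e / a) ^ i = 1 := by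
      rw [← mul_pow, show b * d / (a * q) * (lam * e / a) = 1 by
        field_simp; linear_combination hbde, one_pow]
    calc _ = q ^ (j + i) * ((-(b * q ^ (j + i) / q)) ^ (j + i)
          * (-(d / (a * q ^ (j + i)))) ^ (j + i)) * (lam * e / a) ^ i := by ring
      _ = q ^ j * q ^ i * (b * d / (a * q)) ^ j
          * ((b * d / (a * q)) ^ i * (lam * e / a) ^ i) := by rw [x1]; ring
      _ = _ := by rw [x3, ← x2]; ring
  have n1 := ellPoch_ne_zero_mono hs₁ hij
  have n2 := ellPoch_ne_zero_mono hs₂ hij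
  have n3 := ellPoch_ne_zero_mono hadN hij
  have n4 : ellPoch p q (a * q / d) j ≠ 0 := ellPoch_ne_zero_mono hadN (by omega)
  unfold leftWeight innerWeight connCoeff jacksonTerm
  rw [Nat.add_sub_cancel_left, e2, e3, e4 c hc, e4 U hU, e4 V hV, e5, ← e1]
  have n5 : (-(d / (a * q ^ (j + i)) * q ^ i)) ^ j ≠ 0 :=
    pow_ne_zero _ (neg_ne_zero.2 (mul_ne_zero hw0 hqi))
  have n6 := hqk (j.choose 2)
  have n7 := hqk ((j + i).choose 2)
  have hP : (∏ m ∈ Finset.Ico j (j + i), -(lam * q ^ (m + 1) * stepValue p q n f g h Z m))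
      = (lam * e / a) ^ i * q ^ (j.choose 2) * (ellPoch p q (U * q ^ j) i
        * ellPoch p q (V * q ^ j) i * ellPoch p q (s₁ * q ^ j) i * ellPoch p q (s₂ * q ^ j) i)
        / q ^ ((j + i).choose 2) := by rw [eq_div_iff n7]; exact r1
  have hW : ellPoch p q (d / (a * q ^ (j + i))) i
      = (-(d / (a * q ^ (j + i)))) ^ (j + i) * q ^ ((j + i).choose 2)
        * ellPoch p q (a * q / d) (j + i)
        / ((-(d / (a * q ^ (j + i)) * q ^ i)) ^ j * q ^ (j.choose 2)
          * ellPoch p q (a * q / d) j) := by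
    rw [eq_div_iff (mul_ne_zero (mul_ne_zero n5 n6) n4), ← r2, r3]
  rw [hP, hW]
  rw [ellPoch_add p q s₁, ellPoch_add p q s₂] at *
  rw [ellPoch_add p q (q ^ N)⁻¹, ellPoch_add p q c, ellPoch_add p q (a * q ^ (N + 1)),
    ellPoch_add p q (a * q / c), ellPoch_add p q (a * q / U), ellPoch_add p q (a * q / V)]
  clear hP hW r1 r2 r3 hstep
  exact leftWeight_aux n3 (right_ne_zero_of_mul n1) (right_ne_zero_of_mul n2) n7 n6 n5 rA hpow

/-- The factor in front of the sum over `|x| = j` on the right-hand side. -/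
def rightWeight (p q a b c d lam U V s₁ s₂ : ℂ) (N j : ℕ) : ℂ :=
  ellTheta p (lam * q ^ (2 * j)) * (ellPoch p q lam j * ellPoch p q ((q ^ N)⁻¹) j * ellPoch p q c j
      * ellPoch p q (lam * d / a) j) * q ^ j * (-(lam * b / a * q ^ j / q)) ^ j
    / (ellPoch p q (lam * q ^ (N + 1)) j * ellPoch p q (lam * q / c) j * ellPoch p q (a * q / d) j
      * (ellPoch p q s₁ j * ellPoch p q s₂ j * ellPoch p q (lam * q / U) j
        * ellPoch p q (lam * q / V) j))

theorem innerWeight_aux {θ g w₄ w₆ a₂ a₃ a₄ a₉ a₁₀ b c y₃ y₄ L₁ L₂ D E₁ E₂ F₁ F₂ H p₀ p₁ t₀ t₁ v₀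
    r₁ r₂ X₁ X₂ A B K T l : ℂ} (hB : B ≠ 0) (hK : K ≠ 0) (hX : X₂ ≠ 0) (hy : y₃ ≠ 0) (hp₀ : p₀ ≠ 0)
    (ht₀ : t₀ ≠ 0) (hv₀ : v₀ ≠ 0) (hL₁ : L₁ ≠ 0) (hL₂ : L₂ ≠ 0) (hD : D ≠ 0)
    (h1 : a₉ * a₁₀ = A * D) (h2 : θ * B * K = l * L₁ * (T * L₂)) (h3 : X₁ * w₆ = X₂ * w₄) :
    θ * (g * w₄ * (a₉ * b * c) * y₄ / (a₂ * (a₃ * a₄) * L₁ * (D * E₁ * F₁ * H))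
        * (a₁₀ * p₁ * t₁ * r₁ / (L₂ * E₂ * F₂ * r₂)))
      = A * (p₀ * p₁) * (r₁ * (X₁ * y₃ * v₀)) * (t₀ * t₁)
          / (B * (E₁ * E₂) * (F₁ * F₂) * (r₂ * (X₂ * y₃ * H)))
        * (T * (l * b * c * g) * y₄ * w₆ / (K * p₀ * a₂ * (a₃ * a₄ * t₀ * v₀))) := by
  have hk1 : B * K * X₂ * y₃ * p₀ * t₀ * v₀ ≠ 0 := by simp_all
  have hk2 : L₁ * D * L₂ ≠ 0 := by simp_all
  rw [div_mul_div_comm, div_mul_div_comm, ← mul_div_assoc, ← mul_div_mul_right _ _ hk1,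
    ← mul_div_mul_right (A * (p₀ * p₁) * (r₁ * (X₁ * y₃ * v₀)) * (t₀ * t₁)
      * (T * (l * b * c * g) * y₄ * w₆)) _ hk2]
  congr 1
  · linear_combination (g * b * c * y₄ * p₁ * t₁ * r₁ * y₃ * p₀ * t₀ * v₀)
      * (θ * B * K * X₂ * w₄ * h1 + A * D * X₂ * w₄ * h2 - A * D * l * L₁ * T * L₂ * h3)
  · ring

theorem ellTheta_ne_zero_of_ellPoch_ne_zero {p q u : ℂ} {N m : ℕ}
    (h1 : ellPoch p q (u * q) N ≠ 0) (h2 : ellPoch p q (u * q ^ (N + 1)) N ≠ 0) (hm : 1 ≤ m)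
    (hm' : m ≤ 2 * N) : ellTheta p (u * q ^ m) ≠ 0 := by
  rcases le_or_gt m N with h | h
  · have := ellPoch_ne_zero_iff.1 h1 (m - 1) (by omega)
    rwa [show q ^ (m - 1) * (u * q) = u * q ^ (m - 1 + 1) by rw [pow_succ]; ring,
      Nat.sub_add_cancel hm] at this
  · have := ellPoch_ne_zero_iff.1 h2 (m - (N + 1)) (by omega)
    rwa [show q ^ (m - (N + 1)) * (u * q ^ (N + 1)) = u * q ^ (m - (N + 1) + (N + 1)) by
      rw [pow_add]; ring, Nat.sub_add_cancel (by omega)] at this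

/-- The inner sum is evaluated by Jackson, whose balancing condition at length `N - j` is `hbal` for
every `j`. Joining the factorials of index `N - j` with those of index `j` separates a prefactor
free of `j`. -/
theorem innerWeight_mul_jackson {p q : ℂ} (hp : ‖p‖ < 1) (hq : q ≠ 0) {N : ℕ}
    {a b c d lam U V : ℂ} (s₁ s₂ : ℂ) (ha : a ≠ 0) (hlam : lam ≠ 0) (hU : U ≠ 0) (hV : V ≠ 0)
    (hc : c ≠ 0) (hbal : a * lam * q ^ (N + 1) = c * U * V) (hqN : ellPoch p q q N ≠ 0)
    (hlamq : ellPoch p q (lam * q) N ≠ 0) (hlamN : ellPoch p q (lam * q ^ (N + 1)) N ≠ 0)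
    (haN : ellPoch p q (a * q ^ (N + 1)) N ≠ 0)
    (hac : ellPoch p q (a * q / c) N ≠ 0) (haU : ellPoch p q (a * q / U) N ≠ 0)
    (haV : ellPoch p q (a * q / V) N ≠ 0) (hlc : ellPoch p q (lam * q / c) N ≠ 0)
    (hlU : ellPoch p q (lam * q / U) N ≠ 0) (hlV : ellPoch p q (lam * q / V) N ≠ 0)
    {j : ℕ} (hj : j ≤ N) :
    ellTheta p lam * (innerWeight p q a b c d lam U V s₁ s₂ N j
      * ∑ i ∈ Finset.range (N - j + 1), jacksonTerm p q (a * q ^ (2 * j)) (a / lam) (c * q ^ j)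
        (U * q ^ j) (V * q ^ j) (N - j) i)
    = ellPoch p q a (N + 1) * ellPoch p q (lam * q / c) N * ellPoch p q (a * q / (c * U)) N
          * ellPoch p q (lam * q / U) N
        / (ellPoch p q (lam * q) N * ellPoch p q (a * q / c) N * ellPoch p q (a * q / U) N
          * ellPoch p q (lam * q / (c * U)) N)
      * rightWeight p q a b c d lam U V s₁ s₂ N j := by
  have hqk := fun m : ℕ => pow_ne_zero m hq
  have hqj := hqk j
  have eN : q ^ N = q ^ (N - j) * q ^ j := by rw [← pow_add, Nat.sub_add_cancel hj]
  have hqM := hqk (N - j)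
  have hlamm := fun m => ellTheta_ne_zero_of_ellPoch_ne_zero (m := m) hlamq hlamN
  have hL₂ : ellPoch p q (lam * q ^ (2 * j + 1)) (N - j) ≠ 0 :=
    ellPoch_ne_zero_iff.2 fun l hl => by
      have := hlamm (l + (2 * j + 1)) (by omega) (by omega)
      rwa [pow_add, mul_left_comm] at this
  have hL₁ : ellPoch p q (lam * q ^ j) j ≠ 0 :=
    ellPoch_ne_zero_iff.2 fun l hl => by
      have := hlamm (l + j) (by omega) (by omega)
      rwa [pow_add, mul_left_comm] at this
  have split : ∀ u : ℂ, ellPoch p q u N = ellPoch p q u j * ellPoch p q (u * q ^ j) (N - j) := by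
    intro u
    rw [← ellPoch_add, Nat.add_sub_cancel' hj]
  have hsp : ∀ {u : ℂ}, ellPoch p q u N ≠ 0 → ellPoch p q (u * q ^ j) (N - j) ≠ 0 := by
    intro u hu
    rw [split] at hu
    exact right_ne_zero_of_mul hu
  have e1 : a * q ^ (2 * j) * q / (a / lam) = lam * q ^ (2 * j + 1) := by
    rw [pow_succ]; field_simp
  have e2 : ∀ u : ℂ, u ≠ 0 → a * q ^ (2 * j) * q / (u * q ^ j) = a * q / u * q ^ j := by
    intro u hu
    rw [two_mul, pow_add]; field_simp
  have e3 : ∀ u : ℂ, u ≠ 0 → a * q ^ (2 * j) * q / (a / lam * (u * q ^ j))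
      = lam * q / u * q ^ j := by
    intro u hu
    rw [two_mul, pow_add]; field_simp
  have e4 : a * q ^ (2 * j) * q / (c * q ^ j * (U * q ^ j)) = a * q / (c * U) := by
    rw [two_mul, pow_add]; field_simp
  have e5 : a * q ^ (2 * j) * q / (a / lam * (c * q ^ j) * (U * q ^ j)) = lam * q / (c * U) := by
    rw [two_mul, pow_add]; field_simp
  have hJ := jackson hp hq (A := a * q ^ (2 * j)) (B := a / lam) (C := c * q ^ j) (D := U * q ^ j)
    (E := V * q ^ j) (N := N - j) (mul_ne_zero ha (hqk _))
    (by
      rw [pow_succ, eN] at hbal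
      rw [pow_succ, two_mul, pow_add]
      field_simp
      linear_combination hbal)
    (ellPoch_ne_zero_mono hqN (Nat.sub_le _ _))
    (by
      rw [show a * q ^ (2 * j) * q ^ (N - j + 1) = a * q ^ (N + 1) * q ^ j by
        rw [pow_succ, pow_succ, eN, two_mul, pow_add]; ring]
      exact hsp haN)
    (by rw [e1]; exact hL₂) (by rw [e2 c hc]; exact hsp hac) (by rw [e2 U hU]; exact hsp haU)
    (by rw [e2 V hV]; exact hsp haV)
  rw [e1, e2 c hc, e2 U hU, e3 c hc, e3 U hU, e4, e5] at hJ
  rw [hJ]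
  have r1 := ellPoch_sub hp hq (u := a * q / (c * U)) (by simp [*]) hj
  have r2 := ellPoch_sub hp hq (u := lam * q / (c * U)) (by simp [*]) hj
  rw [show q / (a * q / (c * U) * q ^ N) = lam * q / V by
    have := hqk N
    rw [pow_succ] at hbal
    field_simp
    linear_combination -hbal] at r1
  rw [show q / (lam * q / (c * U) * q ^ N) = a * q / V by
    have := hqk N
    rw [pow_succ] at hbal
    field_simp
    linear_combination -hbal] at r2
  have hX : (-(a * q / (c * U) * q ^ (N - j))) ^ j * (-(lam * b / a * q ^ j / q)) ^ j
      = (-(lam * q / (c * U) * q ^ (N - j))) ^ j * (-(b * q ^ j / q)) ^ j := by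
    rw [← mul_pow, ← mul_pow]
    congr 1
    field_simp
  have h1 : ellPoch p q a (2 * j) * ellPoch p q (a * q ^ (2 * j)) (N - j + 1)
      = ellPoch p q a (N + 1) * ellPoch p q (a * q ^ (N + 1)) j := by
    rw [← ellPoch_add, ← ellPoch_add]
    congr 1
    omega
  have h2 : ellTheta p lam * ellPoch p q (lam * q) N * ellPoch p q (lam * q ^ (N + 1)) j
      = ellPoch p q lam j * ellPoch p q (lam * q ^ j) j
        * (ellTheta p (lam * q ^ (2 * j)) * ellPoch p q (lam * q ^ (2 * j + 1)) (N - j)) := by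
    rw [← ellPoch_succ', ← ellPoch_add, ← ellPoch_add, show N + 1 + j = j + j + (N - j + 1) by omega,
      ellPoch_add p q lam (j + j), ellPoch_succ', pow_succ, two_mul, mul_assoc]
  unfold innerWeight rightWeight
  rw [r1, r2, split (lam * q / c), split (lam * q / U), split (a * q / c), split (a * q / U)]
  exact innerWeight_aux hlamq (ellPoch_ne_zero_mono hlamN hj)
    (pow_ne_zero _ (neg_ne_zero.2 (mul_ne_zero (by simp [*]) hqM))) (hqk _)
    (ellPoch_ne_zero_mono hlc hj) (ellPoch_ne_zero_mono hlU hj) (ellPoch_ne_zero_mono hlV hj)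
    hL₁ hL₂ (ellPoch_ne_zero_mono haN hj) h1 h2 hX

/-- The transformation in terms of slices: expand each slice by the connection formula, interchange
the sums over `k` and `j`, and sum over `i = k - j` by Jackson. -/
theorem sum_leftWeight {p q : ℂ} (hp : ‖p‖ < 1) (hq : q ≠ 0) {n N : ℕ} {z : Fin n → ℂ}
    (hz : IsGeneric p q z N) {a b c d e f g h lam U V s₁ s₂ : ℂ} (ha : a ≠ 0) (hb : b ≠ 0)
    (hc : c ≠ 0) (hd : d ≠ 0) (he : e ≠ 0) (hlam : lam ≠ 0) (hU : U ≠ 0) (hV : V ≠ 0)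
    (hbde : b * d * e * lam = a ^ 2 * q) (hbal : a * lam * q ^ (N + 1) = c * U * V)
    (hfgh : f * g * h * (∏ i, z i) ^ 2 = a * q / e)
    (hstep : ∀ m, stepValue p q n f g h (∏ i, z i) m
        * (f * g * h * (∏ i, z i) ^ 2 * q ^ (2 * m))
      = -(ellTheta p (q ^ m * U) * ellTheta p (q ^ m * V) * ellTheta p (q ^ m * s₁)
        * ellTheta p (q ^ m * s₂)))
    (hη : ∀ i, ellPoch p q (a * q / b * z i) N ≠ 0) (hqN : ellPoch p q q N ≠ 0)
    (hlamq : ellPoch p q (lam * q) N ≠ 0) (hlamN : ellPoch p q (lam * q ^ (N + 1)) N ≠ 0)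
    (hlam1 : ellTheta p lam ≠ 0) (haN : ellPoch p q (a * q ^ (N + 1)) N ≠ 0)
    (hac : ellPoch p q (a * q / c) N ≠ 0) (had : ellPoch p q (a * q / d) N ≠ 0)
    (haU : ellPoch p q (a * q / U) N ≠ 0)
    (haV : ellPoch p q (a * q / V) N ≠ 0) (hlc : ellPoch p q (lam * q / c) N ≠ 0)
    (hlU : ellPoch p q (lam * q / U) N ≠ 0) (hlV : ellPoch p q (lam * q / V) N ≠ 0)
    (hs₁ : ellPoch p q s₁ N ≠ 0) (hs₂ : ellPoch p q s₂ N ≠ 0) :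
    ∑ k ∈ Finset.range (N + 1), leftWeight p q a b c d U V s₁ s₂ N k * (ellPoch p q d k
        * dSum p q z f g h (a * q / b) k e (q / (b * q ^ k)))
    = ellPoch p q a (N + 1) * ellPoch p q (lam * q / c) N * ellPoch p q (a * q / (c * U)) N
          * ellPoch p q (lam * q / U) N
        / (ellPoch p q (lam * q) N * ellPoch p q (a * q / c) N * ellPoch p q (a * q / U) N
          * ellPoch p q (lam * q / (c * U)) N)
      * (1 / ellTheta p lam) * ∑ j ∈ Finset.range (N + 1),
        rightWeight p q a b c d lam U V s₁ s₂ N j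
          * dSum p q z f g h (a * q / b) j (lam * e / a) (q / (lam * b / a * q ^ j)) := by
  have hqk := fun m : ℕ => pow_ne_zero m hq
  set Gf : ℕ → ℂ := fun j =>
    dSum p q z f g h (a * q / b) j (lam * e / a) (q / (lam * b / a * q ^ j)) with hG
  have hτ : lam * e / a * (f * g * h * (∏ i, z i) ^ 2) = lam * q := by
    rw [hfgh]; field_simp
  have hlamm := fun m => ellTheta_ne_zero_of_ellPoch_ne_zero (m := m) hlamq hlamN
  have hinner : ∀ j i, j + i ≤ N → leftWeight p q a b c d U V s₁ s₂ N (j + i)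
        * (connCoeff p q n f g h (∏ i, z i) lam (j + i) j * Gf j
      * ((ellPoch p q (lam * d / a) j * ellPoch p q (a * q ^ (j + i)) j)
        * (ellPoch p q (a / lam) i * ellPoch p q (d / (a * q ^ (j + i))) i)))
      = innerWeight p q a b c d lam U V s₁ s₂ N j * Gf j * jacksonTerm p q (a * q ^ (2 * j))
        (a / lam) (c * q ^ j) (U * q ^ j) (V * q ^ j) (N - j) i := fun j i hij =>
    leftWeight_mul_connCoeff hp hq ha hd hlam hbde hU hV hc hτ hstep hs₁ hs₂ had hij (Gf j)
  obtain ⟨T, hT⟩ : ∃ T : ℕ → ℕ → ℂ, ∀ j i, T j i = innerWeight p q a b c d lam U V s₁ s₂ N j * Gf j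
      * jacksonTerm p q (a * q ^ (2 * j)) (a / lam) (c * q ^ j) (U * q ^ j) (V * q ^ j) (N - j) i :=
    ⟨_, fun _ _ => rfl⟩
  have hleft : ∀ k ∈ Finset.range (N + 1), leftWeight p q a b c d U V s₁ s₂ N k * (ellPoch p q d k
        * dSum p q z f g h (a * q / b) k e (q / (b * q ^ k)))
      = ∑ j ∈ Finset.range (k + 1), T j (k - j) := by
    intro k hk
    have hk : k ≤ N := Nat.lt_succ_iff.1 (Finset.mem_range.1 hk)
    have hqk' := hqk k
    -- For this `σ`, the relation `bdeλ = a²q` gives `ησ = d`, so the factor `(d)_k` set apart from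
    -- the weight is the one the formula needs.
    have hc := dSum_connection hp hq hz (f := f) (g := g) (h := h) (η := a * q / b)
      (σ := a / (lam * e)) (lam := lam) (by simp [*]) hη hqN (by rw [hfgh]; field_simp)
      (by simp [*]) hlamm hk (X := e) (Y := q / (b * q ^ k)) he (by simp [*]) (by field_simp)
    rw [show a * q / b * (a / (lam * e)) = d by field_simp; linear_combination -hbde] at hc
    rw [hc, connSum, Finset.mul_sum]
    refine Finset.sum_congr rfl fun j hj => ?_
    obtain ⟨i, rfl⟩ := Nat.exists_eq_add_of_le (Nat.lt_succ_iff.1 (Finset.mem_range.1 hj))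
    have hqj := hqk j
    have := hinner j i hk
    rw [Nat.add_sub_cancel_left, hT, ← this, hG]
    dsimp only
    rw [dSum_swap p q z f g h _ j (lam * e / a)]
    rw [show a * q / b / (lam * q ^ j) = q / (lam * b / a * q ^ j) by field_simp,
      show 1 / (a / (lam * e)) = lam * e / a by field_simp,
      show a * q / b / e = lam * d / a by field_simp; linear_combination -hbde,
      show a * q / b / (q / (b * q ^ (j + i))) = a * q ^ (j + i) by field_simp,
      show a / (lam * e) * e = a / lam by field_simp,
      show a / (lam * e) * (q / (b * q ^ (j + i))) = d / (a * q ^ (j + i)) by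
        field_simp; linear_combination -hbde]
  rw [Finset.sum_congr rfl hleft, Finset.sum_range_diag_flip, Finset.mul_sum]
  refine Finset.sum_congr rfl fun j hj => ?_
  have hj : j ≤ N := Nat.lt_succ_iff.1 (Finset.mem_range.1 hj)
  have := innerWeight_mul_jackson hp hq (b := b) (d := d) s₁ s₂ ha hlam hU hV hc hbal hqN hlamq
    hlamN haN hac haU haV hlc hlU hlV hj
  rw [Finset.sum_congr rfl fun i _ => hT j i, ← Finset.mul_sum,
    show N + 1 - j = N - j + 1 by omega]
  generalize ∑ i ∈ Finset.range (N - j + 1), jacksonTerm p q (a * q ^ (2 * j)) (a / lam)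
    (c * q ^ j) (U * q ^ j) (V * q ^ j) (N - j) i = S at *
  rw [mul_comm, ← eq_div_iff hlam1] at this
  linear_combination Gf j * this

/-! ### Slicing the multiple sums and the two parities -/

theorem pow_choose_two_sq (q : ℂ) (m : ℕ) :
    q ^ (m.choose 2) * q ^ (m.choose 2) * q ^ m = (q ^ m) ^ m := by
  rw [← pow_add, ← pow_add, ← pow_mul]
  congr 1
  induction m with
  | zero => rfl
  | succ m ih =>
    rw [Nat.choose_succ_succ' m 1, Nat.choose_one_right]
    linarith

/-- Reversal of `(β/z_i)_k` against `(β/z_i)_{k-m}` leaves `(q^(1-k) z_i/β)_m`, which is the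
parameter `Y`. The power of `z_i` and the quadratic power of `q` are the ones built into the
one-variable factor. -/
theorem ellPoch_div_mul_eq_dFactor {p q : ℂ} (hp : ‖p‖ < 1) (hq : q ≠ 0) {n : ℕ} {z : Fin n → ℂ}
    (hz : ∀ i, z i ≠ 0) {β : ℂ} (hβ : β ≠ 0) (f g h η X : ℂ) (i : Fin n) {k m : ℕ} (hm : m ≤ k)
    (h0 : ellPoch p q (β / z i) (k - m) ≠ 0) :
    ellPoch p q (β / z i) k / ellPoch p q (β / z i) (k - m)
        * (ellPoch p q (X * z i) m * (ellPoch p q (f * z i) m * (ellPoch p q (g * z i) m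
          * ellPoch p q (h * z i) m))
        / (ellPoch p q (η * z i) m * ∏ j, ellPoch p q (q * (z i / z j)) m))
      = (-(β * q ^ k / q)) ^ m * dFactor p q z f g h η X (q / (β * q ^ k)) i m := by
  have hzi := hz i
  have hqm := pow_ne_zero m hq
  have hqkm := pow_ne_zero (k - m) hq
  have e1 : (-(β * q ^ k / q)) ^ m / (z i ^ m * q ^ (m.choose 2))
      = (-(β / z i * q ^ (k - m))) ^ m * q ^ (m.choose 2) := by
    rw [div_eq_iff (mul_ne_zero (pow_ne_zero _ hzi) (pow_ne_zero _ hq))]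
    have : (-(β * q ^ k / q)) ^ m * q ^ m
        = (-(β / z i * q ^ (k - m))) ^ m * z i ^ m * (q ^ m) ^ m := by
      rw [← mul_pow, ← mul_pow, ← mul_pow]
      congr 1
      rw [show q ^ k = q ^ (k - m) * q ^ m by rw [← pow_add, Nat.sub_add_cancel hm]]
      field_simp
    rw [← pow_choose_two_sq] at this
    exact mul_right_cancel₀ hqm (by linear_combination this)
  rw [ellPoch_sub hp hq (div_ne_zero hβ hzi) hm, mul_div_cancel_left₀ _ h0, ← e1,
    show q / (β / z i * q ^ k) = q / (β * q ^ k) * z i by field_simp]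
  unfold dFactor
  ring

theorem sum_indexSet (n N : ℕ) (F : (Fin n → ℕ) → ℂ) :
    ∑ x ∈ indexSet n N, F x
      = ∑ k ∈ Finset.range (N + 1), ∑ x ∈ Finset.piAntidiag Finset.univ k, F x := by
  rw [← Finset.sum_fiberwise_of_maps_to (t := Finset.range (N + 1)) (g := wt)
    fun x hx => Finset.mem_range.2 (Nat.lt_succ_of_le (mem_indexSet.1 hx))]
  refine Finset.sum_congr rfl fun k hk => Finset.sum_congr ?_ fun _ _ => rfl
  ext x
  rw [Finset.mem_filter, mem_indexSet, mem_simplex, wt]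
  have := Finset.mem_range.1 hk
  omega

theorem sum_indexSet_eq_sum_dSum {p q : ℂ} (hp : ‖p‖ < 1) (hq : q ≠ 0) {n N : ℕ} {z : Fin n → ℂ}
    (hz : ∀ i, z i ≠ 0) {β : ℂ} (hβ : β ≠ 0) (f g h η X : ℂ) (T R S A : ℕ → ℂ)
    (h0 : ∀ x ∈ indexSet n N, ∀ i, ellPoch p q (β / z i) (wt x - x i) ≠ 0) :
    ∑ x ∈ indexSet n N, deltaRatio p q z x * T (wt x)
        * ((∏ i, ∏ j ∈ Finset.Ioi i, ellPoch p q (z i * z j) (x i + x j))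
          / ∏ i, ellPoch p q (β / z i) (wt x - x i))
        * (R (wt x) * (∏ i, ellPoch p q (β / z i) (wt x)) / S (wt x)) * q ^ wt x
        * (∏ i, ellPochs p q [X * z i, f * z i, g * z i, h * z i] (x i)
          / (ellPoch p q (η * z i) (x i) * ∏ j, ellPoch p q (q * (z i / z j)) (x i)))
        * A (wt x)
      = ∑ k ∈ Finset.range (N + 1), T k * (R k / S k) * q ^ k * A k * (-(β * q ^ k / q)) ^ k
        * dSum p q z f g h η k X (q / (β * q ^ k)) := by
  rw [sum_indexSet]
  refine Finset.sum_congr rfl fun k hk => ?_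
  rw [dSum, Finset.mul_sum]
  refine Finset.sum_congr rfl fun x hx => ?_
  have hwt : wt x = k := mem_simplex.1 hx
  have hx' : x ∈ indexSet n N := mem_indexSet.2 (by rw [hwt]; have := Finset.mem_range.1 hk; omega)
  have hf := fun i => ellPoch_div_mul_eq_dFactor hp hq hz hβ f g h η X i (k := k)
    (le_of_mem_simplex hx i) (by rw [← hwt]; exact h0 x hx' i)
  have hprod := Finset.prod_congr (rfl : Finset.univ = (Finset.univ : Finset (Fin n)))
    fun i _ => hf i
  rw [Finset.prod_mul_distrib, Finset.prod_mul_distrib, Finset.prod_div_distrib,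
    Finset.prod_pow_eq_pow_sum, show ∑ i, x i = k from hwt] at hprod
  simp only [ellPochs, List.map_cons, List.map_nil, List.prod_cons, List.prod_nil, mul_one]
  rw [hwt, dTerm]
  linear_combination (deltaRatio p q z x * T k
    * (∏ i, ∏ j ∈ Finset.Ioi i, ellPoch p q (z i * z j) (x i + x j)) * (R k / S k) * q ^ k * A k)
    * hprod

/-- The eliminated fourth parameter has `b₄ Z q^m` equal to the inverse of `q^m aq/(eZ)`; inverting
that theta gives the sign and the monomial. This fixes `U = fZ`, `V = gZ`. -/
theorem stepValue_odd {p q : ℂ} (hp : ‖p‖ < 1) (hq : q ≠ 0) {n : ℕ} (hn : Odd n)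
    {a e f g Z : ℂ} (ha : a ≠ 0) (he : e ≠ 0) (hf : f ≠ 0) (hg : g ≠ 0) (hZ : Z ≠ 0) (m : ℕ) :
    stepValue p q n f g (a * q / (e * f * g * Z ^ 2)) Z m
        * (f * g * (a * q / (e * f * g * Z ^ 2)) * Z ^ 2 * q ^ (2 * m))
      = -(ellTheta p (q ^ m * (f * Z)) * ellTheta p (q ^ m * (g * Z))
        * ellTheta p (q ^ m * (a * q / (e * f * g * Z))) * ellTheta p (q ^ m * (a * q / (e * Z)))) := by
  have hqm := pow_ne_zero m hq
  have hs : q ^ m * (a * q / (e * Z)) ≠ 0 :=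
    mul_ne_zero hqm (div_ne_zero (mul_ne_zero ha hq) (mul_ne_zero he hZ))
  unfold stepValue typeDValue
  rw [if_pos hn, show 1 / (f * g * (a * q / (e * f * g * Z ^ 2)) * (Z * q ^ m) ^ 2) * (Z * q ^ m)
      = (q ^ m * (a * q / (e * Z)))⁻¹ by field_simp, ellTheta_inv hp hs,
    show f * (Z * q ^ m) = q ^ m * (f * Z) by ring, show g * (Z * q ^ m) = q ^ m * (g * Z) by ring,
    show a * q / (e * f * g * Z ^ 2) * (Z * q ^ m) = q ^ m * (a * q / (e * f * g * Z)) by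
      field_simp, two_mul, pow_add]
  generalize ellTheta p (q ^ m * (f * Z)) = t₁
  generalize ellTheta p (q ^ m * (g * Z)) = t₂
  generalize ellTheta p (q ^ m * (a * q / (e * f * g * Z))) = t₃
  generalize ellTheta p (q ^ m * (a * q / (e * Z))) = t₄
  field_simp

/-- Here the product of the first and the eliminated parameter gives the inverse of `q^m aq/(efZ)`.
This fixes `U = Z`, `V = fgZ`. -/
theorem stepValue_even {p q : ℂ} (hp : ‖p‖ < 1) (hq : q ≠ 0) {n : ℕ} (hn : ¬ Odd n)
    {a e f g Z : ℂ} (ha : a ≠ 0) (he : e ≠ 0) (hf : f ≠ 0) (hg : g ≠ 0) (hZ : Z ≠ 0) (m : ℕ) :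
    stepValue p q n f g (a * q / (e * f * g * Z ^ 2)) Z m
        * (f * g * (a * q / (e * f * g * Z ^ 2)) * Z ^ 2 * q ^ (2 * m))
      = -(ellTheta p (q ^ m * Z) * ellTheta p (q ^ m * (f * g * Z))
        * ellTheta p (q ^ m * (a * q / (e * g * Z))) * ellTheta p (q ^ m * (a * q / (e * f * Z)))) := by
  have hqm := pow_ne_zero m hq
  have hs : q ^ m * (a * q / (e * f * Z)) ≠ 0 :=
    mul_ne_zero hqm (div_ne_zero (mul_ne_zero ha hq) (mul_ne_zero (mul_ne_zero he hf) hZ))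
  unfold stepValue typeDValue
  rw [if_neg hn,
    show f * (1 / (f * g * (a * q / (e * f * g * Z ^ 2)) * (Z * q ^ m) ^ 2)) * (Z * q ^ m)
      = (q ^ m * (a * q / (e * f * Z)))⁻¹ by field_simp, ellTheta_inv hp hs,
    show f * g * (Z * q ^ m) = q ^ m * (f * g * Z) by ring,
    show f * (a * q / (e * f * g * Z ^ 2)) * (Z * q ^ m) = q ^ m * (a * q / (e * g * Z)) by
      field_simp, mul_comm Z, two_mul, pow_add]
  generalize ellTheta p (q ^ m * Z) = t₁
  generalize ellTheta p (q ^ m * (f * g * Z)) = t₂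
  generalize ellTheta p (q ^ m * (a * q / (e * g * Z))) = t₃
  generalize ellTheta p (q ^ m * (a * q / (e * f * Z))) = t₄
  field_simp

/-- The theorem for both parities at once, with `A` and `B` written through `U`, `V`, `s₁`, `s₂`.
Slicing both sides reduces it to `sum_leftWeight`, up to the constants `θ(a)` and `θ(λ)`. -/
theorem elliptic_bailey_typeD {p q : ℂ} (hp : ‖p‖ < 1) (hq : q ≠ 0) {n N : ℕ} {z : Fin n → ℂ}
    (hz : IsGeneric p q z N) {a b c d e f g h lam U V s₁ s₂ : ℂ} (ha : a ≠ 0) (hb : b ≠ 0)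
    (hc : c ≠ 0) (hd : d ≠ 0) (he : e ≠ 0) (hlam : lam ≠ 0) (hU : U ≠ 0) (hV : V ≠ 0)
    (hbde : b * d * e * lam = a ^ 2 * q) (hbal : a * lam * q ^ (N + 1) = c * U * V)
    (hfgh : f * g * h * (∏ i, z i) ^ 2 = a * q / e)
    (hstep : ∀ m, stepValue p q n f g h (∏ i, z i) m
        * (f * g * h * (∏ i, z i) ^ 2 * q ^ (2 * m))
      = -(ellTheta p (q ^ m * U) * ellTheta p (q ^ m * V) * ellTheta p (q ^ m * s₁)
        * ellTheta p (q ^ m * s₂)))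
    (hη : ∀ i, ellPoch p q (a * q / b * z i) N ≠ 0) (hqN : ellPoch p q q N ≠ 0)
    (hbz : ∀ x ∈ indexSet n N, ∀ i, ellPoch p q (b / z i) (wt x - x i) ≠ 0)
    (hlbz : ∀ x ∈ indexSet n N, ∀ i, ellPoch p q (lam * b / a / z i) (wt x - x i) ≠ 0)
    (ha1 : ellTheta p a ≠ 0) (hlam1 : ellTheta p lam ≠ 0)
    (hlamq : ellPoch p q (lam * q) N ≠ 0) (hlamN : ellPoch p q (lam * q ^ (N + 1)) N ≠ 0)
    (haN : ellPoch p q (a * q ^ (N + 1)) N ≠ 0)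
    (hac : ellPoch p q (a * q / c) N ≠ 0) (had : ellPoch p q (a * q / d) N ≠ 0)
    (haU : ellPoch p q (a * q / U) N ≠ 0)
    (haV : ellPoch p q (a * q / V) N ≠ 0) (hlc : ellPoch p q (lam * q / c) N ≠ 0)
    (hlU : ellPoch p q (lam * q / U) N ≠ 0) (hlV : ellPoch p q (lam * q / V) N ≠ 0)
    (hs₁ : ellPoch p q s₁ N ≠ 0) (hs₂ : ellPoch p q s₂ N ≠ 0) {A B : ℕ → ℂ}
    (hA : ∀ k, A k = 1 / (ellPoch p q s₁ k * ellPoch p q s₂ k * ellPoch p q (a * q / U) k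
      * ellPoch p q (a * q / V) k))
    (hB : ∀ k, B k = ellPoch p q (a * q / (c * U)) N * ellPoch p q (lam * q / U) N
      / (ellPoch p q (a * q / U) N * ellPoch p q (lam * q / (c * U)) N
        * (ellPoch p q s₁ k * ellPoch p q s₂ k * ellPoch p q (lam * q / U) k
          * ellPoch p q (lam * q / V) k))) :
    ∑ x ∈ indexSet n N,
      deltaRatio p q z x * (ellTheta p (a * q ^ (2 * wt x)) / ellTheta p a)
      * ((∏ i, ∏ j ∈ Finset.Ioi i, ellPoch p q (z i * z j) (x i + x j))
          / ∏ i, ellPoch p q (b / z i) (wt x - x i))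
      * (ellPochs p q [a, (q ^ N)⁻¹, c, d] (wt x) * (∏ i, ellPoch p q (b / z i) (wt x))
          / ellPochs p q [a * q ^ (N + 1), a * q / c, a * q / d] (wt x))
      * q ^ wt x
      * (∏ i, ellPochs p q [e * z i, f * z i, g * z i, h * z i] (x i)
          / (ellPoch p q (a * q / b * z i) (x i) * ∏ j, ellPoch p q (q * (z i / z j)) (x i)))
      * A (wt x)
    = ellPochs p q [a * q, lam * q / c] N / ellPochs p q [lam * q, a * q / c] N
      * ∑ x ∈ indexSet n N,
        deltaRatio p q z x * (ellTheta p (lam * q ^ (2 * wt x)) / ellTheta p lam)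
        * ((∏ i, ∏ j ∈ Finset.Ioi i, ellPoch p q (z i * z j) (x i + x j))
            / ∏ i, ellPoch p q (lam * b / a / z i) (wt x - x i))
        * (ellPochs p q [lam, (q ^ N)⁻¹, c, lam * d / a] (wt x)
              * (∏ i, ellPoch p q (lam * b / a / z i) (wt x))
            / ellPochs p q [lam * q ^ (N + 1), lam * q / c, a * q / d] (wt x))
        * q ^ wt x
        * (∏ i, ellPochs p q [lam * e / a * z i, f * z i, g * z i, h * z i] (x i)
            / (ellPoch p q (a * q / b * z i) (x i) * ∏ j, ellPoch p q (q * (z i / z j)) (x i)))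
        * B (wt x) := by
  have h1 := sum_indexSet_eq_sum_dSum hp hq hz.1 hb f g h (a * q / b) e
    (fun k => ellTheta p (a * q ^ (2 * k)) / ellTheta p a)
    (fun k => ellPochs p q [a, (q ^ N)⁻¹, c, d] k)
    (fun k => ellPochs p q [a * q ^ (N + 1), a * q / c, a * q / d] k) A hbz
  have h2 := sum_indexSet_eq_sum_dSum hp hq hz.1 (β := lam * b / a)
    (div_ne_zero (mul_ne_zero hlam hb) ha) f g h (a * q / b) (lam * e / a)
    (fun k => ellTheta p (lam * q ^ (2 * k)) / ellTheta p lam)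
    (fun k => ellPochs p q [lam, (q ^ N)⁻¹, c, lam * d / a] k)
    (fun k => ellPochs p q [lam * q ^ (N + 1), lam * q / c, a * q / d] k) B hlbz
  refine h1.trans (Eq.trans ?_ (congrArg _ h2).symm)
  have key := sum_leftWeight hp hq hz ha hb hc hd he hlam hU hV hbde hbal hfgh hstep hη hqN
    hlamq hlamN hlam1 haN hac had haU haV hlc hlU hlV hs₁ hs₂
  have hl : ∀ k ∈ Finset.range (N + 1), ellTheta p (a * q ^ (2 * k)) / ellTheta p a
        * (ellPochs p q [a, (q ^ N)⁻¹, c, d] k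
          / ellPochs p q [a * q ^ (N + 1), a * q / c, a * q / d] k) * q ^ k * A k
        * (-(b * q ^ k / q)) ^ k * dSum p q z f g h (a * q / b) k e (q / (b * q ^ k))
      = 1 / ellTheta p a * (leftWeight p q a b c d U V s₁ s₂ N k * (ellPoch p q d k
        * dSum p q z f g h (a * q / b) k e (q / (b * q ^ k)))) := by
    intro k _
    rw [hA, leftWeight]
    simp only [ellPochs, List.map_cons, List.map_nil, List.prod_cons, List.prod_nil, mul_one]
    ring
  have hr : ∀ k ∈ Finset.range (N + 1), ellTheta p (lam * q ^ (2 * k)) / ellTheta p lam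
        * (ellPochs p q [lam, (q ^ N)⁻¹, c, lam * d / a] k
          / ellPochs p q [lam * q ^ (N + 1), lam * q / c, a * q / d] k) * q ^ k * B k
        * (-(lam * b / a * q ^ k / q)) ^ k
        * dSum p q z f g h (a * q / b) k (lam * e / a) (q / (lam * b / a * q ^ k))
      = (1 / ellTheta p lam * (ellPoch p q (a * q / (c * U)) N * ellPoch p q (lam * q / U) N
          / (ellPoch p q (a * q / U) N * ellPoch p q (lam * q / (c * U)) N)))
        * (rightWeight p q a b c d lam U V s₁ s₂ N k
          * dSum p q z f g h (a * q / b) k (lam * e / a) (q / (lam * b / a * q ^ k))) := by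
    intro k _
    rw [hB, rightWeight]
    simp only [ellPochs, List.map_cons, List.map_nil, List.prod_cons, List.prod_nil, mul_one]
    ring
  rw [Finset.sum_congr rfl hl, Finset.sum_congr rfl hr, ← Finset.mul_sum, ← Finset.mul_sum, key]
  simp only [ellPochs, List.map_cons, List.map_nil, List.prod_cons, List.prod_nil, mul_one]
  rw [ellPoch_succ' p q a]
  generalize ∑ j ∈ Finset.range (N + 1), rightWeight p q a b c d lam U V s₁ s₂ N j
    * dSum p q z f g h (a * q / b) j (lam * e / a) (q / (lam * b / a * q ^ j)) = W
  field_simp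

end

theorem corollary4p2
    (p q : ℂ) (hp : ‖p‖ < 1) (hq : q ≠ 0) (n N : ℕ)
    (a b c d e f g lam Z : ℂ) (z : Fin n → ℂ) (ha : a ≠ 0)
    (hZ : Z = ∏ i, z i)
    (hbal : a ^ 3 * q ^ (N + 2) = b * c * d * e * f * g * ∏ i, z i ^ 2)
    (hlam : lam = a ^ 2 * q / (b * d * e))
    -- No denominator in the identity vanishes. (All parameters are non-zero by `hbal`.)
    (hzz : ∀ i j, i < j → ellTheta p (z j / z i) ≠ 0)
    (hqzz : ∀ i j, ellPoch p q (q * z i / z j) N ≠ 0)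
    (hθ : ellTheta p a ≠ 0 ∧ ellTheta p lam ≠ 0)
    (hbz : ∀ x ∈ indexSet n N, ∀ i,
      ellPoch p q (b / z i) (wt x - x i) ≠ 0 ∧
      ellPoch p q (lam * b / (a * z i)) (wt x - x i) ≠ 0)
    (hazb : ∀ i, ellPoch p q (a * q * z i / b) N ≠ 0)
    (hden : ellPochs p q
      [a * q ^ (N + 1), a * q / c, a * q / d, lam * q, lam * q ^ (N + 1), lam * q / c] N ≠ 0)
    (hodd : Odd n → ellPochs p q
      [a * q / (e * Z), a * q / (f * Z), a * q / (g * Z), a * q / (e * f * g * Z),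
        lam * q / (c * f * Z), lam * q / (f * Z), lam * q / (g * Z)] N ≠ 0)
    (heven : Even n → ellPochs p q
      [a * q / Z, a * q / (e * f * Z), a * q / (e * g * Z), a * q / (f * g * Z),
        lam * q / (c * Z), lam * q / Z, lam * q / (f * g * Z)] N ≠ 0) :
    ∑ x ∈ indexSet n N,
      deltaRatio p q z x * (ellTheta p (a * q ^ (2 * wt x)) / ellTheta p a)
      * ((∏ i, ∏ j ∈ Finset.Ioi i, ellPoch p q (z i * z j) (x i + x j))
          / ∏ i, ellPoch p q (b / z i) (wt x - x i))
      * (ellPochs p q [a, (q ^ N)⁻¹, c, d] (wt x) * (∏ i, ellPoch p q (b / z i) (wt x))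
          / ellPochs p q [a * q ^ (N + 1), a * q / c, a * q / d] (wt x))
      * q ^ wt x
      * (∏ i, ellPochs p q
            [e * z i, f * z i, g * z i, a * q * z i / (e * f * g * Z ^ 2)] (x i)
          / (ellPoch p q (a * q * z i / b) (x i) * ∏ j, ellPoch p q (q * z i / z j) (x i)))
      * (if Odd n then
          1 / ellPochs p q
            [a * q / (e * Z), a * q / (f * Z), a * q / (g * Z), a * q / (e * f * g * Z)] (wt x)
        else
          1 / ellPochs p q
            [a * q / Z, a * q / (e * f * Z), a * q / (e * g * Z), a * q / (f * g * Z)] (wt x))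
    = ellPochs p q [a * q, lam * q / c] N / ellPochs p q [lam * q, a * q / c] N
      * ∑ x ∈ indexSet n N,
        deltaRatio p q z x * (ellTheta p (lam * q ^ (2 * wt x)) / ellTheta p lam)
        * ((∏ i, ∏ j ∈ Finset.Ioi i, ellPoch p q (z i * z j) (x i + x j))
            / ∏ i, ellPoch p q (lam * b / (a * z i)) (wt x - x i))
        * (ellPochs p q [lam, (q ^ N)⁻¹, c, lam * d / a] (wt x)
              * (∏ i, ellPoch p q (lam * b / (a * z i)) (wt x))
            / ellPochs p q [lam * q ^ (N + 1), lam * q / c, a * q / d] (wt x))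
        * q ^ wt x
        * (∏ i, ellPochs p q
              [lam * e * z i / a, f * z i, g * z i, a * q * z i / (e * f * g * Z ^ 2)] (x i)
            / (ellPoch p q (a * q * z i / b) (x i) * ∏ j, ellPoch p q (q * z i / z j) (x i)))
        * (if Odd n then
            ellPochs p q [a * q / (c * f * Z), lam * q / (f * Z)] N
              / (ellPochs p q [a * q / (f * Z), lam * q / (c * f * Z)] N
                * ellPochs p q
                  [a * q / (e * Z), lam * q / (f * Z), lam * q / (g * Z),
                    a * q / (e * f * g * Z)] (wt x))
          else
            ellPochs p q [a * q / (c * Z), lam * q / Z] N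
              / (ellPochs p q [a * q / Z, lam * q / (c * Z)] N
                * ellPochs p q
                  [lam * q / Z, a * q / (e * f * Z), a * q / (e * g * Z),
                    lam * q / (f * g * Z)] (wt x))) := by
  have hqk := fun m : ℕ => pow_ne_zero m hq
  have hne : b * c * d * e * f * g * ∏ i, z i ^ 2 ≠ 0 := by
    rw [← hbal]; exact mul_ne_zero (pow_ne_zero _ ha) (hqk _)
  rw [Finset.prod_pow, ← hZ] at hbal hne
  have hZ2 : Z ^ 2 ≠ 0 := right_ne_zero_of_mul hne
  have hZ0 : Z ≠ 0 := fun h => hZ2 (by simp [h])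
  have hz : ∀ i, z i ≠ 0 := fun i h => hZ0 (by
    rw [hZ]; exact Finset.prod_eq_zero (Finset.mem_univ i) h)
  have hne := left_ne_zero_of_mul hne
  have hg := right_ne_zero_of_mul hne
  have hne := left_ne_zero_of_mul hne
  have hf := right_ne_zero_of_mul hne
  have hne := left_ne_zero_of_mul hne
  have he := right_ne_zero_of_mul hne
  have hne := left_ne_zero_of_mul hne
  have hd := right_ne_zero_of_mul hne
  have hne := left_ne_zero_of_mul hne
  have hc := right_ne_zero_of_mul hne
  have hb := left_ne_zero_of_mul hne
  have hbde : b * d * e * lam = a ^ 2 * q := by rw [hlam]; field_simp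
  have hlam0 : lam ≠ 0 := by
    rw [hlam]; exact div_ne_zero (mul_ne_zero (pow_ne_zero _ ha) hq)
      (mul_ne_zero (mul_ne_zero hb hd) he)
  have hbal' : a * lam * q ^ (N + 1) = c * (f * g * Z ^ 2) := by
    apply mul_left_cancel₀ (mul_ne_zero (mul_ne_zero hb hd) he)
    linear_combination hbal + a * q ^ (N + 1) * hbde
  clear hlam
  simp only [ellPochs, List.map_cons, List.map_nil, List.prod_cons, List.prod_nil, mul_one,
    mul_ne_zero_iff] at hden hodd heven
  obtain ⟨haN, hac, had, hlq, hlN, hlc⟩ := hden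
  -- For `n = 0` the hypothesis on `q z_i/z_j` is empty and does not provide `(q)_N ≠ 0`. Each sum
  -- then has a single term and the prefactors cancel.
  rcases Nat.eq_zero_or_pos n with rfl | hn
  · have hev : Even 0 := ⟨0, rfl⟩
    obtain ⟨h1, -, -, -, h2, h3, -⟩ := heven hev
    have hI : indexSet 0 N = {fun _ => 0} := by
      ext x
      simp [mem_indexSet, wt, Subsingleton.elim x fun _ => 0]
    rw [Fin.prod_univ_zero] at hZ
    subst hZ
    rw [hI, Finset.sum_singleton, Finset.sum_singleton]
    simp only [div_one, mul_one] at h1 h2 h3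
    simp [wt, deltaRatio, ellPochs, ellPoch_zero, hθ.1, hθ.2]
    generalize ellPoch p q (a * q) N = u₁ at *
    generalize ellPoch p q (a * q / c) N = u₂ at *
    generalize ellPoch p q (lam * q) N = u₃ at *
    generalize ellPoch p q (lam * q / c) N = u₄ at *
    field_simp
  · have hqN : ellPoch p q q N ≠ 0 := by
      have := hqzz ⟨0, hn⟩ ⟨0, hn⟩
      rwa [mul_div_assoc, div_self (hz _), mul_one] at this
    have hgen := isGeneric_of_ne_zero hp hq hz hzz hqzz
    have e1 : ∀ i, lam * b / (a * z i) = lam * b / a / z i := fun i => by rw [div_div]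
    have e2 : ∀ i, a * q * z i / b = a * q / b * z i := fun i => by ring
    have e3 : ∀ i, lam * e * z i / a = lam * e / a * z i := fun i => by ring
    have e4 : ∀ i, a * q * z i / (e * f * g * Z ^ 2) = a * q / (e * f * g * Z ^ 2) * z i :=
      fun i => by ring
    have e5 : ∀ i j, q * z i / z j = q * (z i / z j) := fun i j => mul_div_assoc _ _ _
    simp only [e1] at hbz
    simp only [e2] at hazb
    simp only [e1, e2, e3, e4, e5]
    have hfgh : f * g * (a * q / (e * f * g * Z ^ 2)) * Z ^ 2 = a * q / e := by field_simp
    by_cases hn2 : Odd n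
    · obtain ⟨h1, h2, h3, h4, h5, h6, h7⟩ := hodd hn2
      simp only [if_pos hn2]
      -- Odd case: `U = fZ`, `V = gZ`, so that `cUV = cfgZ²` as the balancing requires.
      refine elliptic_bailey_typeD hp hq hgen ha hb hc hd he hlam0
        (mul_ne_zero hf hZ0) (mul_ne_zero hg hZ0) hbde (by rw [hbal']; ring) (by rw [← hZ, hfgh])
        (by rw [← hZ]; exact stepValue_odd hp hq hn2 ha he hf hg hZ0) hazb hqN
        (fun x hx i => (hbz x hx i).1) (fun x hx i => (hbz x hx i).2) hθ.1 hθ.2 hlq hlN haN hac had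
        h2 h3 hlc h6 h7 h4 h1 (A := fun k => 1 / ellPochs p q _ k)
        (B := fun k => _ / (_ * ellPochs p q _ k)) (fun k => ?_) (fun k => ?_)
      · simp only [ellPochs, List.map_cons, List.map_nil, List.prod_cons, List.prod_nil, mul_one]
        ring
      · simp only [ellPochs, List.map_cons, List.map_nil, List.prod_cons, List.prod_nil, mul_one,
          ← mul_assoc c f Z]
        ring
    · obtain ⟨h1, h2, h3, h4, h5, h6, h7⟩ := heven (Nat.not_odd_iff_even.1 hn2)
      simp only [if_neg hn2]
      -- Even case: `U = Z`, `V = fgZ`, with the same product `UV`.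
      refine elliptic_bailey_typeD hp hq hgen ha hb hc hd he hlam0
        hZ0 (mul_ne_zero (mul_ne_zero hf hg) hZ0) hbde (by rw [hbal']; ring) (by rw [← hZ, hfgh])
        (by rw [← hZ]; exact stepValue_even hp hq hn2 ha he hf hg hZ0) hazb hqN
        (fun x hx i => (hbz x hx i).1) (fun x hx i => (hbz x hx i).2) hθ.1 hθ.2 hlq hlN haN hac had
        h1 h4 hlc h6 h7 h3 h2 (A := fun k => 1 / ellPochs p q _ k)
        (B := fun k => _ / (_ * ellPochs p q _ k)) (fun k => ?_) (fun k => ?_)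
      · simp only [ellPochs, List.map_cons, List.map_nil, List.prod_cons, List.prod_nil, mul_one]
        ring
      · simp only [ellPochs, List.map_cons, List.map_nil, List.prod_cons, List.prod_nil, mul_one]
        ring
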